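/- Let $G$ be an infinite locally compact (Hausdorff) group with a fixed left Haar measure $dx$, and let $\omega:G\to[1,\infty)$ be a weight function, i.e. $\omega$ is continuous, $\omega(xy)\le\omega(x)\omega(y)$ for all $x,y\in G$, and $\omega(e)=1$. Notation. "Almost everywhere" on $G$, $G\times G$, $G\times G\times G$ means locally almost everywhere: the exceptional set meets every compact set in a Haar-null set (for $\sigma$-compact $G$ this is the usual notion). $L^1(G,\omega)$ is the Banach algebra, under convolution, of (classes of) functions $f:G\to\mathbb C$ with $\|f\|_\omega=\int_G|f|\,\omega\,dx<\infty$. $L^\infty(G,1/\omega)$ is the Banach space of Borel functions $h:G\to\mathbb C$, identified when equal almost everywhere, with $\|h\|=\operatorname{ess\,sup}|h|/\omega<\infty$; it is identified with the dual $L^1(G,\omega)$-bimodule $L^1(G,\omega)^*$ through $\langle h,f\rangle=\int_G f(x)h(x)\,dx$. For a Banach algebra $A$, a bounded derivation $D:A\to A^*$ is a bounded linear map with $D(ab)=D(a)\cdot b+a\cdot D(b)$, where $(\varphi\cdot a)(b)=\varphi(ab)$ and $(a\cdot\varphi)(b)=\varphi(ba)$; it is inner if $D(a)=z\cdot a-a\cdot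 z$ for some $z\in A^*$; $A$ is weakly amenable if every bounded derivation $A\to A^*$ is inner. A Borel function $p:G\times G\to\mathbb C$ is quasi-additive if $p(xy,z)=p(x,yz)+p(y,zx)$ for almost every $(x,y,z)$; a quasi-additive $p$ is inner if there is $h\in L^\infty(G,1/\omega)$ with $p(x,y)=h(xy)-h(yx)$ for almost every $(x,y)$, and non-inner otherwise. Put $C(p,\omega)=\sup_{x,y\in G}\frac{|p(x,y)|}{\omega(x)\omega(y)}\in[0,\infty]$. Let $D(G,\omega)$ be the set of quasi-additive $p$ with $C(p,\omega)<\infty$, and $I(G,\omega)$ the set of inner quasi-additive functions. Theorem. The following assertions are equivalent. (a) $L^1(G,\omega)$ is weakly amenable. (b) For every bounded derivation $D:L^1(G,\omega)\to L^\infty(G,1/\omega)$ there exists $h\in L^\infty(G,1/\omega)$ such that $\langle D(f),g\rangle=\int_G\int_G f(x)g(y)\,(h(xy)-h(yx))\,dx\,dy$ for all $f,g\in L^1(G,\omega)$. (c) For every $p\in D(G,\omega)$ there exists $h\in L^\infty(G,1/\omega)$ such that $p(x,y)=h(xy)-h(yx)$ for almost every $(x,y)\in G\times G$. (d) Every quasi-additive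 function $p$ with $C(p,\omega)<\infty$ is inner. (e) Every non-inner quasi-additive function $p$ is unbounded, i.e. $C(p,\omega)=\infty$. (f) $D(G,\omega)=I(G,\omega)$ as sets of classes modulo equality almost everywhere on $G\times G$. -/

import Mathlib

open MeasureTheory Filter Topology
open scoped ENNReal Pointwise

namespace Beurling

/-- A weight function: a continuous submultiplicative `ω : G → [1, ∞)` with `ω(e) = 1`. -/
structure Weight (G : Type*) [Group G] [TopologicalSpace G] where
  toFun : G → ℝ
  continuous' : Continuous toFun
  one_le' : ∀ x, 1 ≤ toFun x
  mul_le' : ∀ x y, toFun (x * y) ≤ toFun x * toFun y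
  map_one' : toFun 1 = 1

instance {G : Type*} [Group G] [TopologicalSpace G] : CoeFun (Weight G) (fun _ => G → ℝ) :=
  ⟨Weight.toFun⟩

theorem Weight.pos {G : Type*} [Group G] [TopologicalSpace G] (ω : Weight G) (x : G) :
    0 < ω x := lt_of_lt_of_le one_pos (ω.one_le' x)

/-- "Locally almost everywhere" on a locally compact group `X`: a property holds eventually along
this filter iff on every compact set it fails only on a set of Haar measure zero. The Haar measure
lives on the Borel sets of the topology of `X` (for `X = G × G` these may be more than the product
σ-algebra). For σ-compact `X` this is the usual almost everywhere filter of Haar measure. -/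
noncomputable def locallyAE (X : Type*) [Group X] [TopologicalSpace X] [IsTopologicalGroup X]
    [LocallyCompactSpace X] : Filter X :=
  letI : MeasurableSpace X := borel X
  haveI : BorelSpace X := ⟨rfl⟩
  ⨆ K : {K : Set X // IsCompact K}, ae ((Measure.haar : Measure X).restrict K.1)

/-- Borel measurability of complex functions on a topological space. -/
def BorelFun {X : Type*} [TopologicalSpace X] (f : X → ℂ) : Prop :=
  @Measurable X ℂ (borel X) (borel ℂ) f

section Generic

variable {A : Type*} [NonUnitalNormedRing A] [NormedSpace ℂ A] [IsScalarTower ℂ A A]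
  [SMulCommClass ℂ A A]

/-- The right action on the dual of a Banach algebra, `(φ · a)(b) = φ(ab)`. -/
noncomputable def dualRight (φ : StrongDual ℂ A) (a : A) : StrongDual ℂ A :=
  φ.comp (ContinuousLinearMap.mul ℂ A a)

/-- The left action on the dual of a Banach algebra, `(a · φ)(b) = φ(ba)`. -/
noncomputable def dualLeft (a : A) (φ : StrongDual ℂ A) : StrongDual ℂ A :=
  φ.comp ((ContinuousLinearMap.mul ℂ A).flip a)

/-- Bounded derivations into the dual: `D(ab) = D(a) · b + a · D(b)`. -/
def IsDerivation (D : A →L[ℂ] StrongDual ℂ A) : Prop :=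
  ∀ a b : A, D (a * b) = dualRight (D a) b + dualLeft a (D b)

/-- Inner derivations `ad_z(a) = z · a - a · z`. -/
def IsInnerDerivation (D : A →L[ℂ] StrongDual ℂ A) : Prop :=
  ∃ z : StrongDual ℂ A, ∀ a : A, D a = dualRight z a - dualLeft a z

/-- Weak amenability: every bounded derivation from `A` into its dual is inner. -/
def WeaklyAmenable (A : Type*) [NonUnitalNormedRing A] [NormedSpace ℂ A] [IsScalarTower ℂ A A]
    [SMulCommClass ℂ A A] : Prop :=
  ∀ D : A →L[ℂ] StrongDual ℂ A, IsDerivation D → IsInnerDerivation D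

end Generic

section Group

variable {G : Type*} [Group G] [TopologicalSpace G] [IsTopologicalGroup G] [LocallyCompactSpace G]

/-- A representative `h` of an element of `L^∞(G, 1/ω)`: Borel measurable with `h/ω`
essentially bounded (outside a locally null set). -/
def MemLinf (ω : Weight G) (h : G → ℂ) : Prop :=
  BorelFun h ∧ ∃ C : ℝ, ∀ᶠ x in locallyAE G, ‖h x‖ ≤ C * ω x

/-- Quasi-additive functions: `p` is Borel and `p(xy, z) = p(x, yz) + p(y, zx)` for (locally)
almost every `(x, y, z)`. -/
def QuasiAdditive (p : G × G → ℂ) : Prop :=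
  BorelFun p ∧ ∀ᶠ t in locallyAE (G × G × G),
    p (t.1 * t.2.1, t.2.2) = p (t.1, t.2.1 * t.2.2) + p (t.2.1, t.2.2 * t.1)

/-- The constant `C(p, ω) = sup |p(x, y)| / (ω(x) ω(y))`, in `[0, ∞]`. -/
noncomputable def supConst (ω : Weight G) (p : G × G → ℂ) : ℝ≥0∞ :=
  ⨆ (x : G) (y : G), ENNReal.ofReal (‖p (x, y)‖ / (ω x * ω y))

/-- The kernel identity `p(x, y) = h(xy) - h(yx)` almost everywhere. -/
def HasKernel (p : G × G → ℂ) (h : G → ℂ) : Prop :=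
  ∀ᶠ t in locallyAE (G × G), p t = h (t.1 * t.2) - h (t.2 * t.1)

/-- The set `D(G, ω)`. -/
def boundedQA (ω : Weight G) : Set (G × G → ℂ) :=
  {p | QuasiAdditive p ∧ supConst ω p < ∞}

/-- The set `I(G, ω)` of inner quasi-additive functions. -/
def innerQA (ω : Weight G) : Set (G × G → ℂ) :=
  {p | QuasiAdditive p ∧ ∃ h : G → ℂ, MemLinf ω h ∧ HasKernel p h}

/-- The classes of the functions in `S` modulo equality locally almost everywhere. -/
def classes (S : Set (G × G → ℂ)) : Set (Germ (locallyAE (G × G)) ℂ) :=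
  (fun p : G × G → ℂ => (p : Germ (locallyAE (G × G)) ℂ)) '' S

theorem BorelFun.add {X : Type*} [TopologicalSpace X] {f g : X → ℂ} (hf : BorelFun f)
    (hg : BorelFun g) : BorelFun (f + g) := by
  borelize X
  exact Measurable.add hf hg

theorem BorelFun.const_smul {X : Type*} [TopologicalSpace X] {f : X → ℂ} (hf : BorelFun f)
    (c : ℂ) : BorelFun (c • f) := by
  borelize X
  exact Measurable.const_smul hf c

theorem BorelFun.zero {X : Type*} [TopologicalSpace X] : BorelFun (0 : X → ℂ) := by
  borelize X
  exact measurable_const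

/-- `L^∞(G, 1/ω)` as a space of classes of functions modulo equality locally almost everywhere. -/
def linfSubmodule (ω : Weight G) : Submodule ℂ (Germ (locallyAE G) ℂ) where
  carrier := {φ | ∃ h : G → ℂ, MemLinf ω h ∧ (h : Germ (locallyAE G) ℂ) = φ}
  zero_mem' := ⟨0, ⟨BorelFun.zero, 0, by simp⟩, rfl⟩
  add_mem' := by
    rintro _ _ ⟨h, ⟨hm, C, hC⟩, rfl⟩ ⟨k, ⟨km, C', hC'⟩, rfl⟩
    refine ⟨h + k, ⟨hm.add km, C + C', ?_⟩, rfl⟩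
    filter_upwards [hC, hC'] with x h1 h2
    rw [add_mul]
    exact (norm_add_le _ _).trans (add_le_add h1 h2)
  smul_mem' := by
    rintro c _ ⟨h, ⟨hm, C, hC⟩, rfl⟩
    refine ⟨c • h, ⟨hm.const_smul c, ‖c‖ * C, ?_⟩, rfl⟩
    filter_upwards [hC] with x h1
    rw [Pi.smul_apply, norm_smul, mul_assoc]
    exact mul_le_mul_of_nonneg_left h1 (norm_nonneg _)

/-- The space `L^∞(G, 1/ω)`. -/
def Linf (ω : Weight G) : Type _ := linfSubmodule ω

noncomputable instance (ω : Weight G) : AddCommGroup (Linf ω) :=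
  inferInstanceAs (AddCommGroup (linfSubmodule ω))

noncomputable instance (ω : Weight G) : Module ℂ (Linf ω) :=
  inferInstanceAs (Module ℂ (linfSubmodule ω))

/-- A Borel function representing an element of `L^∞(G, 1/ω)`. -/
noncomputable def Linf.rep {ω : Weight G} (h : Linf ω) : G → ℂ :=
  Classical.choose (show linfSubmodule ω from h).2

noncomputable instance (ω : Weight G) : CoeFun (Linf ω) (fun _ => G → ℂ) := ⟨Linf.rep⟩

theorem Linf.memLinf {ω : Weight G} (h : Linf ω) : MemLinf ω h :=
  (Classical.choose_spec (show linfSubmodule ω from h).2).1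

theorem Linf.germ_rep {ω : Weight G} (h : Linf ω) :
    (h.rep : Germ (locallyAE G) ℂ) = (show linfSubmodule ω from h).1 :=
  (Classical.choose_spec (show linfSubmodule ω from h).2).2

theorem Linf.ext {ω : Weight G} {h k : Linf ω} (e : h.rep =ᶠ[locallyAE G] k.rep) : h = k :=
  Subtype.ext (((Linf.germ_rep h).symm.trans (Germ.coe_eq.2 e)).trans (Linf.germ_rep k))

/-- The class in `L^∞(G, 1/ω)` of a Borel function. -/
noncomputable def Linf.mk (ω : Weight G) (h : G → ℂ) (hh : MemLinf ω h) : Linf ω := ⟨h, h, hh, rfl⟩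

theorem Linf.coe_mk (ω : Weight G) {h : G → ℂ} (hh : MemLinf ω h) :
    (Linf.mk ω h hh).rep =ᶠ[locallyAE G] h :=
  Germ.coe_eq.1 (Linf.germ_rep (Linf.mk ω h hh))

theorem Linf.coe_add {ω : Weight G} (h k : Linf ω) :
    (h + k).rep =ᶠ[locallyAE G] h.rep + k.rep := by
  refine Germ.coe_eq.1 ((Linf.germ_rep _).trans ?_)
  rw [Germ.coe_add, Linf.germ_rep, Linf.germ_rep]
  rfl

theorem Linf.coe_smul {ω : Weight G} (c : ℂ) (h : Linf ω) :
    (c • h).rep =ᶠ[locallyAE G] c • h.rep := by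
  refine Germ.coe_eq.1 ((Linf.germ_rep _).trans ?_)
  rw [Germ.coe_smul, Linf.germ_rep]
  rfl

theorem Linf.coe_zero {ω : Weight G} : (0 : Linf ω).rep =ᶠ[locallyAE G] 0 :=
  Germ.coe_eq.1 (Linf.germ_rep _)

/-- The norm `‖h‖ = ess sup |h| / ω` (essential with respect to locally null sets). -/
noncomputable instance (ω : Weight G) : Norm (Linf ω) :=
  ⟨fun h => sInf {C : ℝ | 0 ≤ C ∧ ∀ᶠ x in locallyAE G, ‖h x‖ ≤ C * ω x}⟩

theorem Linf.norm_def {ω : Weight G} (h : Linf ω) :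
    ‖h‖ = sInf {C : ℝ | 0 ≤ C ∧ ∀ᶠ x in locallyAE G, ‖h x‖ ≤ C * ω x} := rfl

theorem Linf.norm_le {ω : Weight G} (h : Linf ω) {C : ℝ} (hC : 0 ≤ C)
    (hb : ∀ᶠ x in locallyAE G, ‖h x‖ ≤ C * ω x) : ‖h‖ ≤ C :=
  csInf_le ⟨0, fun _ hD => hD.1⟩ ⟨hC, hb⟩

theorem Linf.norm_nonneg' {ω : Weight G} (h : Linf ω) : 0 ≤ ‖h‖ :=
  Real.sInf_nonneg fun _ hC => hC.1

theorem eventually_locallyAE_nat {P : ℕ → G → Prop} (h : ∀ n, ∀ᶠ x in locallyAE G, P n x) :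
    ∀ᶠ x in locallyAE G, ∀ n, P n x := by
  borelize G
  simp only [locallyAE, eventually_iSup] at h ⊢
  exact fun K => eventually_countable_forall.2 fun n => h n K

theorem Linf.bound {ω : Weight G} (h : Linf ω) :
    ∀ᶠ x in locallyAE G, ‖h x‖ ≤ ‖h‖ * ω x := by
  have hne : {C : ℝ | 0 ≤ C ∧ ∀ᶠ x in locallyAE G, ‖h x‖ ≤ C * ω x}.Nonempty := by
    obtain ⟨C, hC⟩ := h.memLinf.2
    refine ⟨max C 0, le_max_right _ _, ?_⟩
    filter_upwards [hC] with x hx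
    exact hx.trans (mul_le_mul_of_nonneg_right (le_max_left _ _) (ω.pos x).le)
  have key : ∀ n : ℕ, ∀ᶠ x in locallyAE G, ‖h x‖ ≤ (‖h‖ + 1 / (n + 1 : ℝ)) * ω x := fun n => by
    obtain ⟨C, ⟨-, hC⟩, hlt⟩ := exists_lt_of_csInf_lt hne
      (lt_add_of_pos_right (sInf _) (show (0 : ℝ) < 1 / (n + 1 : ℝ) by positivity))
    filter_upwards [hC] with x hx
    exact hx.trans (mul_le_mul_of_nonneg_right hlt.le (ω.pos x).le)
  filter_upwards [eventually_locallyAE_nat key] with x hx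
  have hl : Tendsto (fun n : ℕ => (‖h‖ + 1 / (n + 1 : ℝ)) * ω x) atTop (𝓝 ((‖h‖ + 0) * ω x)) :=
    (tendsto_const_nhds.add tendsto_one_div_add_atTop_nhds_zero_nat).mul_const _
  rw [add_zero] at hl
  exact ge_of_tendsto' hl hx

theorem Linf.core (ω : Weight G) : NormedSpace.Core ℂ (Linf ω) where
  norm_nonneg := Linf.norm_nonneg'
  norm_smul c h := by
    have hle : ∀ (c : ℂ) (h : Linf ω), ‖c • h‖ ≤ ‖c‖ * ‖h‖ := fun c h => by
      refine Linf.norm_le _ (mul_nonneg (norm_nonneg _) h.norm_nonneg') ?_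
      filter_upwards [Linf.coe_smul c h, h.bound] with x h1 h2
      rw [h1, Pi.smul_apply, norm_smul, mul_assoc]
      exact mul_le_mul_of_nonneg_left h2 (norm_nonneg _)
    refine le_antisymm (hle c h) ?_
    rcases eq_or_ne c 0 with rfl | hc
    · simpa using Linf.norm_nonneg' _
    · have h1 := hle c⁻¹ (c • h)
      rw [inv_smul_smul₀ hc, norm_inv] at h1
      have hc' : 0 < ‖c‖ := norm_pos_iff.2 hc
      calc ‖c‖ * ‖h‖ ≤ ‖c‖ * (‖c‖⁻¹ * ‖c • h‖) := mul_le_mul_of_nonneg_left h1 hc'.le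
        _ = ‖c • h‖ := by field_simp
  norm_triangle h k := by
    refine Linf.norm_le _ (add_nonneg h.norm_nonneg' k.norm_nonneg') ?_
    filter_upwards [Linf.coe_add h k, h.bound, k.bound] with x h1 h2 h3
    rw [h1, Pi.add_apply, add_mul]
    exact (norm_add_le _ _).trans (add_le_add h2 h3)
  norm_eq_zero_iff h := by
    constructor
    · intro h0
      refine Linf.ext ?_
      filter_upwards [h.bound, Linf.coe_zero (ω := ω)] with x h1 h2
      rw [h0, zero_mul] at h1
      rw [h2, Pi.zero_apply]
      exact norm_le_zero_iff.1 h1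
    · rintro rfl
      refine le_antisymm (Linf.norm_le _ le_rfl ?_) (Linf.norm_nonneg' _)
      filter_upwards [Linf.coe_zero (ω := ω)] with x h2
      simp [h2]

noncomputable instance (ω : Weight G) : NormedAddCommGroup (Linf ω) :=
  NormedAddCommGroup.ofCore (Linf.core ω)

noncomputable instance (ω : Weight G) : NormedSpace ℂ (Linf ω) :=
  NormedSpace.ofCore (Linf.core ω)

variable [MeasurableSpace G] [BorelSpace G]

theorem eventually_locallyAE {P : G → Prop} :
    (∀ᶠ x in locallyAE G, P x) ↔
      ∀ K : Set G, IsCompact K → ∀ᵐ x ∂(Measure.haar : Measure G).restrict K, P x := by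
  obtain rfl : ‹MeasurableSpace G› = borel G := BorelSpace.measurable_eq
  simp [locallyAE, eventually_iSup]

/-- The measure `ω(x) dx`. -/
noncomputable def wMeasure (ω : Weight G) : Measure G :=
  (Measure.haar : Measure G).withDensity fun x => ENNReal.ofReal (ω x)

/-- `L^1(G, ω)`: (classes of) functions with `∫ |f| ω dx < ∞`, normed by `‖f‖ = ∫ |f| ω dx`. -/
def L1 (ω : Weight G) : Type _ := Lp ℂ 1 (wMeasure ω)

noncomputable instance (ω : Weight G) : NormedAddCommGroup (L1 ω) :=
  inferInstanceAs (NormedAddCommGroup (Lp ℂ 1 (wMeasure ω)))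

noncomputable instance (ω : Weight G) : NormedSpace ℂ (L1 ω) :=
  inferInstanceAs (NormedSpace ℂ (Lp ℂ 1 (wMeasure ω)))

instance (ω : Weight G) : CompleteSpace (L1 ω) :=
  inferInstanceAs (CompleteSpace (Lp ℂ 1 (wMeasure ω)))

/-- A function representing an element of `L^1(G, ω)`. -/
noncomputable def L1.rep {ω : Weight G} (f : L1 ω) : G → ℂ :=
  ((show Lp ℂ 1 (wMeasure ω) from f : Lp ℂ 1 (wMeasure ω)) : G → ℂ)

noncomputable instance (ω : Weight G) : CoeFun (L1 ω) (fun _ => G → ℂ) := ⟨L1.rep⟩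

/-- The class in `L^1(G, ω)` of an integrable function. -/
noncomputable def L1.mk (ω : Weight G) (f : G → ℂ) (hf : MemLp f 1 (wMeasure ω)) : L1 ω :=
  hf.toLp f

theorem L1.memLp {ω : Weight G} (f : L1 ω) : MemLp f 1 (wMeasure ω) :=
  Lp.memLp (show Lp ℂ 1 (wMeasure ω) from f)

theorem L1.coe_mk (ω : Weight G) {f : G → ℂ} (hf : MemLp f 1 (wMeasure ω)) :
    L1.mk ω f hf =ᵐ[wMeasure ω] f := hf.coeFn_toLp

theorem L1.ext {ω : Weight G} {f g : L1 ω} (h : f =ᵐ[wMeasure ω] g) : f = g :=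
  Lp.ext (f := (show Lp ℂ 1 (wMeasure ω) from f)) (g := (show Lp ℂ 1 (wMeasure ω) from g)) h

theorem L1.coe_add {ω : Weight G} (f g : L1 ω) : (f + g).rep =ᵐ[wMeasure ω] f.rep + g.rep :=
  Lp.coeFn_add (show Lp ℂ 1 (wMeasure ω) from f) (show Lp ℂ 1 (wMeasure ω) from g)

theorem L1.coe_sub {ω : Weight G} (f g : L1 ω) : (f - g).rep =ᵐ[wMeasure ω] f.rep - g.rep :=
  Lp.coeFn_sub (show Lp ℂ 1 (wMeasure ω) from f) (show Lp ℂ 1 (wMeasure ω) from g)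

theorem L1.coe_smul {ω : Weight G} (c : ℂ) (f : L1 ω) :
    (c • f).rep =ᵐ[wMeasure ω] c • f.rep :=
  Lp.coeFn_smul c (show Lp ℂ 1 (wMeasure ω) from f)

theorem L1.norm_eq {ω : Weight G} (f : L1 ω) : ‖f‖ = (eLpNorm f.rep 1 (wMeasure ω)).toReal :=
  Lp.norm_def (show Lp ℂ 1 (wMeasure ω) from f)

theorem L1.norm_mk (ω : Weight G) {f : G → ℂ} (hf : MemLp f 1 (wMeasure ω)) :
    ‖L1.mk ω f hf‖ = (eLpNorm f 1 (wMeasure ω)).toReal := by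
  rw [L1.norm_eq, eLpNorm_congr_ae (L1.coe_mk ω hf)]

theorem Weight.measurable_ofReal {G : Type*} [Group G] [TopologicalSpace G] [MeasurableSpace G]
    [BorelSpace G] (ω : Weight G) : Measurable fun x => ENNReal.ofReal (ω x) :=
  ω.continuous'.measurable.ennreal_ofReal

theorem ae_wMeasure (ω : Weight G) : ae (wMeasure ω) = ae (Measure.haar : Measure G) := by
  ext s
  have h := ae_withDensity_iff (μ := (Measure.haar : Measure G)) (p := fun x => x ∈ s) ω.measurable_ofReal
  have : ∀ x, ENNReal.ofReal (ω x) ≠ 0 := fun x => by simpa using ω.pos x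
  simp only [this, ne_eq, not_false_eq_true, true_imp_iff] at h
  exact h

theorem map_wMeasure_le (ω : Weight G) (y : G) :
    (wMeasure ω).map (fun x => y⁻¹ * x) ≤ ENNReal.ofReal (ω y) • wMeasure ω := by
  have hm : Measurable fun x : G => y⁻¹ * x := (continuous_const_mul y⁻¹).measurable
  refine Measure.le_iff.2 fun s hs => ?_
  rw [Measure.map_apply hm hs, Measure.smul_apply, wMeasure, withDensity_apply _ (hm hs),
    withDensity_apply _ hs, ← lintegral_indicator (hm hs), ← lintegral_indicator hs,
    ← lintegral_mul_left_eq_self _ y, smul_eq_mul,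
    ← lintegral_const_mul _ (ω.measurable_ofReal.indicator hs)]
  refine lintegral_mono fun x => ?_
  by_cases hx : x ∈ s
  · simp only [Set.indicator, Set.mem_preimage, inv_mul_cancel_left, hx, if_true]
    rw [← ENNReal.ofReal_mul (ω.pos y).le]
    exact ENNReal.ofReal_le_ofReal (ω.mul_le' y x)
  · simp [Set.indicator, hx]

theorem memLp_translate (ω : Weight G) (y : G) {g : G → ℂ} (hg : MemLp g 1 (wMeasure ω)) :
    MemLp (fun x => g (y⁻¹ * x)) 1 (wMeasure ω) :=
  (hg.of_measure_le_smul ENNReal.ofReal_ne_top (map_wMeasure_le ω y)).comp_of_map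
    (continuous_const_mul y⁻¹).measurable.aemeasurable

theorem eLpNorm_translate_le (ω : Weight G) (y : G) {g : G → ℂ} (hg : MemLp g 1 (wMeasure ω)) :
    eLpNorm (fun x => g (y⁻¹ * x)) 1 (wMeasure ω) ≤
      ENNReal.ofReal (ω y) * eLpNorm g 1 (wMeasure ω) := by
  have h1 := hg.of_measure_le_smul ENNReal.ofReal_ne_top (map_wMeasure_le ω y)
  have h2 := eLpNorm_map_measure (p := 1) h1.aestronglyMeasurable
    (continuous_const_mul y⁻¹).measurable.aemeasurable
  have h3 := eLpNorm_le_of_measure_le_smul (f := g) (p := 1) (map_wMeasure_le ω y)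
  rw [h2] at h3
  simpa [Function.comp_def] using h3

theorem tendsto_translate_ae (ω : Weight G) (y : G) :
    Tendsto (fun x => y⁻¹ * x) (ae (wMeasure ω)) (ae (wMeasure ω)) := by
  rw [ae_wMeasure]
  exact (measurePreserving_mul_left (Measure.haar : Measure G) y⁻¹).quasiMeasurePreserving.tendsto_ae

/-- Left translation `(L_y g)(x) = g(y⁻¹ x)` on `L^1(G, ω)`, as a function. -/
noncomputable def translateFun (ω : Weight G) (y : G) (g : L1 ω) : L1 ω :=
  L1.mk ω (fun x => g (y⁻¹ * x)) (memLp_translate ω y g.memLp)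

theorem translateFun_add (ω : Weight G) (y : G) (f g : L1 ω) :
    translateFun ω y (f + g) = translateFun ω y f + translateFun ω y g := by
  refine L1.ext ?_
  have h1 : (translateFun ω y f).rep =ᵐ[wMeasure ω] fun x => f (y⁻¹ * x) := L1.coe_mk ω _
  have h2 : (translateFun ω y g).rep =ᵐ[wMeasure ω] fun x => g (y⁻¹ * x) := L1.coe_mk ω _
  have h3 : (translateFun ω y (f + g)).rep =ᵐ[wMeasure ω] fun x => (f + g).rep (y⁻¹ * x) :=
    L1.coe_mk ω _
  have h4 := (tendsto_translate_ae ω y).eventually (L1.coe_add f g)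
  have h5 := L1.coe_add (translateFun ω y f) (translateFun ω y g)
  filter_upwards [h1, h2, h3, h4, h5] with x h1 h2 h3 h4 h5
  rw [h3, h4, h5, Pi.add_apply, Pi.add_apply, h1, h2]

theorem translateFun_smul (ω : Weight G) (y : G) (c : ℂ) (f : L1 ω) :
    translateFun ω y (c • f) = c • translateFun ω y f := by
  refine L1.ext ?_
  have h1 : (translateFun ω y f).rep =ᵐ[wMeasure ω] fun x => f (y⁻¹ * x) := L1.coe_mk ω _
  have h3 : (translateFun ω y (c • f)).rep =ᵐ[wMeasure ω] fun x => (c • f).rep (y⁻¹ * x) :=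
    L1.coe_mk ω _
  have h4 := (tendsto_translate_ae ω y).eventually (L1.coe_smul c f)
  have h5 := L1.coe_smul c (translateFun ω y f)
  filter_upwards [h1, h3, h4, h5] with x h1 h3 h4 h5
  rw [h3, h4, h5, Pi.smul_apply, Pi.smul_apply, h1]

theorem norm_translateFun_le (ω : Weight G) (y : G) (g : L1 ω) :
    ‖translateFun ω y g‖ ≤ ω y * ‖g‖ := by
  have h2 := ENNReal.toReal_mono
    (ENNReal.mul_ne_top ENNReal.ofReal_ne_top g.memLp.eLpNorm_ne_top)
    (eLpNorm_translate_le ω y g.memLp)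
  rw [ENNReal.toReal_mul, ENNReal.toReal_ofReal (ω.pos y).le, ← L1.norm_eq] at h2
  exact (le_of_eq (L1.norm_mk ω _)).trans h2

/-- Left translation `(L_y g)(x) = g(y⁻¹ x)` as a bounded operator on `L^1(G, ω)`. -/
noncomputable def translate (ω : Weight G) (y : G) : L1 ω →L[ℂ] L1 ω :=
  LinearMap.mkContinuous
    { toFun := translateFun ω y
      map_add' := translateFun_add ω y
      map_smul' := translateFun_smul ω y }
    (ω y) (norm_translateFun_le ω y)

theorem coe_translate (ω : Weight G) (y : G) (g : L1 ω) :
    translate ω y g =ᵐ[wMeasure ω] fun x => g (y⁻¹ * x) :=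
  L1.coe_mk ω (memLp_translate ω y g.memLp)

theorem norm_translate_le (ω : Weight G) (y : G) (g : L1 ω) :
    ‖translate ω y g‖ ≤ ω y * ‖g‖ :=
  norm_translateFun_le ω y g

theorem translate_mul (ω : Weight G) (y z : G) (g : L1 ω) :
    translate ω (y * z) g = translate ω y (translate ω z g) := by
  refine L1.ext ?_
  filter_upwards [coe_translate ω (y * z) g, coe_translate ω y (translate ω z g),
    (tendsto_translate_ae ω y).eventually (coe_translate ω z g)] with x h1 h2 h3
  rw [h1, h2, h3, mul_inv_rev, mul_assoc]

/-- `f ∈ L^1(G, ω)` iff `ω f ∈ L^1(G)`. -/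
theorem memLp_iff (ω : Weight G) (f : G → ℂ) :
    MemLp f 1 (wMeasure ω) ↔ Integrable (fun x => (ω x : ℂ) * f x) (Measure.haar : Measure G) := by
  rw [memLp_one_iff_integrable, wMeasure]
  have := integrable_withDensity_iff_integrable_smul (μ := (Measure.haar : Measure G))
    (f := fun x => (ω x).toNNReal) ω.continuous'.measurable.real_toNNReal (g := f)
  refine this.trans (integrable_congr (Eventually.of_forall fun x => ?_))
  simp [NNReal.smul_def, Real.coe_toNNReal _ (ω.pos x).le]

theorem L1.norm_eq_integral {ω : Weight G} (f : L1 ω) :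
    ‖f‖ = ∫ x, ω x * ‖f x‖ ∂(Measure.haar : Measure G) := by
  have h := memLp_one_iff_integrable.1 f.memLp
  rw [L1.norm_eq, eLpNorm_one_eq_lintegral_enorm, ← integral_norm_eq_lintegral_enorm h.1]
  have := integral_withDensity_eq_integral_smul (μ := (Measure.haar : Measure G))
    (f := fun x => (ω x).toNNReal) ω.continuous'.measurable.real_toNNReal (fun x => ‖f x‖)
  refine this.trans (integral_congr_ae (Eventually.of_forall fun x => ?_))
  simp [NNReal.smul_def, Real.coe_toNNReal _ (ω.pos x).le]

/-- Compactly supported continuous functions are dense in `L^1(G)`. -/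
theorem exists_compactSupport_haar {f : G → ℂ} (hf : Integrable f (Measure.haar : Measure G))
    {ε : ℝ} (hε : 0 < ε) :
    ∃ g : G → ℂ, HasCompactSupport g ∧ ∫ x, ‖f x - g x‖ ∂(Measure.haar : Measure G) ≤ ε ∧
      Continuous g ∧ Integrable g (Measure.haar : Measure G) := by
  have hε' : ENNReal.ofReal ε ≠ 0 := by simpa using hε
  have h0P : ∀ (c : ℂ) ⦃s : Set G⦄, MeasurableSet s → (Measure.haar : Measure G) s < ∞ →
      ∀ {ε : ℝ≥0∞}, ε ≠ 0 → ∃ g : G → ℂ,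
        eLpNorm (g - s.indicator fun _ => c) 1 (Measure.haar : Measure G) ≤ ε ∧
          (Continuous g ∧ HasCompactSupport g) := by
    intro c s hs hμ δ hδ
    obtain ⟨η, ηpos, hη⟩ := exists_eLpNorm_indicator_le (μ := (Measure.haar : Measure G))
      ENNReal.one_ne_top c hδ
    have hη2 : (η : ℝ≥0∞) / 2 ≠ 0 := by simpa using ηpos.ne'
    obtain ⟨K, hKs, hK, hKc, hμK⟩ := hs.exists_isCompact_isClosed_sdiff_lt hμ.ne hη2
    have hKfin : (Measure.haar : Measure G) K ≠ ∞ := hK.measure_lt_top.ne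
    obtain ⟨U, hKU, hU, -, hμU⟩ := hKc.measurableSet.exists_isOpen_sdiff_lt hKfin hη2
    obtain ⟨u, hf1, hf0, hfs, hf⟩ := exists_continuous_one_zero_of_isCompact hK hU.isClosed_compl
      (Set.disjoint_compl_right_iff_subset.2 hKU)
    refine ⟨fun x => (u x : ℂ) * c, ?_, ?_, ?_⟩
    · refine le_trans (eLpNorm_mono fun x => ?_) (hη ((U \ K) ∪ (s \ K)) ?_)
      · have h01 := hf x
        by_cases hxK : x ∈ K
        · have h1 : x ∉ (U \ K) ∪ (s \ K) := by simp [hxK]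
          rw [Set.indicator_of_notMem h1, Pi.sub_apply, Set.indicator_of_mem (hKs hxK)]
          simp [hf1 hxK]
        · by_cases hxU : x ∈ U <;> by_cases hxs : x ∈ s
          · have h1 : x ∈ (U \ K) ∪ (s \ K) := Or.inl ⟨hxU, hxK⟩
            have h2 : (u x : ℂ) * c - c = ((u x - 1 : ℝ) : ℂ) * c := by push_cast; ring
            rw [Set.indicator_of_mem h1, Pi.sub_apply, Set.indicator_of_mem hxs, h2, norm_mul,
              Complex.norm_real, Real.norm_eq_abs]
            exact mul_le_of_le_one_left (norm_nonneg _)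
              (abs_le.2 ⟨by linarith [h01.1], by linarith [h01.2]⟩)
          · have h1 : x ∈ (U \ K) ∪ (s \ K) := Or.inl ⟨hxU, hxK⟩
            rw [Set.indicator_of_mem h1, Pi.sub_apply, Set.indicator_of_notMem hxs, sub_zero,
              norm_mul, Complex.norm_real, Real.norm_eq_abs]
            exact mul_le_of_le_one_left (norm_nonneg _)
              (abs_le.2 ⟨by linarith [h01.1], h01.2⟩)
          · have h1 : x ∈ (U \ K) ∪ (s \ K) := Or.inr ⟨hxs, hxK⟩
            rw [Set.indicator_of_mem h1, Pi.sub_apply, Set.indicator_of_mem hxs]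
            simp [hf0 hxU]
          · have h1 : x ∉ (U \ K) ∪ (s \ K) := by simp [hxU, hxs]
            rw [Set.indicator_of_notMem h1, Pi.sub_apply, Set.indicator_of_notMem hxs]
            simp [hf0 hxU]
      · refine (measure_union_le _ _).trans ?_
        rw [← ENNReal.add_halves (η : ℝ≥0∞)]
        exact add_le_add hμU.le hμK.le
    · exact (Complex.continuous_ofReal.comp u.continuous).mul continuous_const
    · exact (hfs.comp_left (g := fun t : ℝ => (t : ℂ)) Complex.ofReal_zero).mul_right
  obtain ⟨g, hg, hgc, hgs⟩ := (memLp_one_iff_integrable.2 hf).induction_dense ENNReal.one_ne_top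
    (fun g : G → ℂ => Continuous g ∧ HasCompactSupport g) h0P
    (fun f g hf hg => ⟨hf.1.add hg.1, hf.2.add hg.2⟩)
    (fun f hf => (hf.1.stronglyMeasurable_of_hasCompactSupport hf.2).aestronglyMeasurable) hε'
  have hgi : Integrable g (Measure.haar : Measure G) := hgc.integrable_of_hasCompactSupport hgs
  refine ⟨g, hgs, ?_, hgc, hgi⟩
  rw [eLpNorm_one_eq_lintegral_enorm] at hg
  have h2 := ENNReal.toReal_mono ENNReal.ofReal_ne_top hg
  rw [ENNReal.toReal_ofReal hε.le] at h2
  rwa [← integral_norm_eq_lintegral_enorm (hf.sub hgi).1] at h2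

/-- An integrable function is an almost everywhere limit of compactly supported continuous ones. -/
theorem exists_seq_compactSupport {F : G → ℂ} (hF : Integrable F (Measure.haar : Measure G)) :
    ∃ k : ℕ → G → ℂ, (∀ n, Continuous (k n)) ∧ (∀ n, HasCompactSupport (k n)) ∧
      ∀ᵐ x ∂(Measure.haar : Measure G), Tendsto (fun n => k n x) atTop (𝓝 (F x)) := by
  choose k hks hk1 hkc hki using fun n : ℕ =>
    exists_compactSupport_haar hF (ε := 1 / (n + 1 : ℝ)) (by positivity)
  have hlim : Tendsto (fun n => eLpNorm (k n - F) 1 (Measure.haar : Measure G)) atTop (𝓝 0) := by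
    refine tendsto_of_tendsto_of_tendsto_of_le_of_le tendsto_const_nhds
      (h := fun n : ℕ => ENNReal.ofReal (1 / (n + 1 : ℝ))) ?_ (fun _ => bot_le) fun n => ?_
    · simpa using ENNReal.tendsto_ofReal tendsto_one_div_add_atTop_nhds_zero_nat
    · have hi : Integrable (fun y => F y - k n y) (Measure.haar : Measure G) := hF.sub (hki n)
      have e : k n - F = -(fun y => F y - k n y) := by
        funext y; simp
      rw [e, eLpNorm_neg, eLpNorm_one_eq_lintegral_enorm,
        ← ofReal_integral_norm_eq_lintegral_enorm hi]
      exact ENNReal.ofReal_le_ofReal (hk1 n)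
  obtain ⟨φ, -, hφ⟩ := (tendstoInMeasure_of_tendsto_eLpNorm one_ne_zero
    (fun n => (hki n).1) hF.1 hlim).exists_seq_tendsto_ae
  exact ⟨fun n => k (φ n), fun n => hkc _, fun n => hks _, hφ⟩

/-- A property that holds locally almost everywhere holds almost everywhere on the set where an
element of `L^1(G, ω)` does not vanish. -/
theorem L1.ae_of_locallyAE {ω : Weight G} (f : L1 ω) {P : G → Prop}
    (hP : ∀ᶠ x in locallyAE G, P x) : ∀ᵐ x ∂(Measure.haar : Measure G), f x ≠ 0 → P x := by
  obtain ⟨k, -, hks, hk⟩ := exists_seq_compactSupport ((memLp_iff ω f).1 f.memLp)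
  have h1 : ∀ᵐ x ∂(Measure.haar : Measure G), ∀ n, x ∈ tsupport (k n) → P x :=
    ae_all_iff.2 fun n => (ae_restrict_iff' (isClosed_tsupport _).measurableSet).1
      (eventually_locallyAE.1 hP _ (hks n))
  filter_upwards [hk, h1] with x hx h1x hfx
  by_contra hPx
  have h0 : ∀ n, k n x = 0 := fun n => by
    by_contra hn
    exact hPx (h1x n (subset_tsupport _ hn))
  simp only [h0] at hx
  have := tendsto_nhds_unique hx tendsto_const_nhds
  have hne : (ω x : ℂ) ≠ 0 := by exact_mod_cast (ω.pos x).ne'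
  exact (mul_ne_zero hne hfx) this

theorem exists_compactSupport (ω : Weight G) (f : L1 ω) {ε : ℝ} (hε : 0 < ε) :
    ∃ k : G → ℂ, ∃ hk : MemLp k 1 (wMeasure ω), Continuous k ∧ HasCompactSupport k ∧
      ‖f - L1.mk ω k hk‖ ≤ ε := by
  obtain ⟨g, hgc, hg1, hgcont, hgi⟩ :=
    exists_compactSupport_haar ((memLp_iff ω f).1 f.memLp) hε
  have hne : ∀ x, (ω x : ℂ) ≠ 0 := fun x => by exact_mod_cast (ω.pos x).ne'
  have hk : MemLp (fun x => (ω x : ℂ)⁻¹ * g x) 1 (wMeasure ω) := by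
    rw [memLp_iff]
    simpa [mul_inv_cancel_left₀ (hne _)] using hgi
  refine ⟨_, hk, ?_, hgc.mul_left, ?_⟩
  · exact ((Complex.continuous_ofReal.comp ω.continuous').inv₀ hne).mul hgcont
  · rw [L1.norm_eq_integral]
    refine le_trans (le_of_eq (integral_congr_ae ?_)) hg1
    have h1 := L1.coe_sub f (L1.mk ω _ hk)
    have h2 := L1.coe_mk ω hk
    rw [EventuallyEq, ae_wMeasure] at h1 h2
    filter_upwards [h1, h2] with x h1 h2
    rw [h1, Pi.sub_apply, h2]
    have : ω x = ‖(ω x : ℂ)‖ := by simp [abs_of_pos (ω.pos x)]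
    nth_rewrite 1 [this]
    rw [← norm_mul, mul_sub, mul_inv_cancel_left₀ (hne _)]

theorem continuous_translate_mk (ω : Weight G) {k : G → ℂ} (hk : MemLp k 1 (wMeasure ω))
    (hc : Continuous k) (hs : HasCompactSupport k) :
    Continuous fun y => translate ω y (L1.mk ω k hk) := by
  refine continuous_iff_continuousAt.2 fun z => ?_
  obtain ⟨S, hS, hzS⟩ := exists_compact_mem_nhds z
  set T : Set G := S * tsupport k with hT
  have hTc : IsCompact T := hS.mul hs
  have hz : z ∈ S := mem_of_mem_nhds hzS
  have hout : ∀ y ∈ S, ∀ x, x ∉ T → k (y⁻¹ * x) = 0 := fun y hy x hx => by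
    by_contra h
    exact hx ⟨y, hy, y⁻¹ * x, subset_tsupport k h, by simp⟩
  have hF := continuousOn_integral_of_compact_support
    (f := fun y x => ω x * ‖k (y⁻¹ * x) - k (z⁻¹ * x)‖) (μ := (Measure.haar : Measure G)) hTc (s := S)
    (by
      refine Continuous.continuousOn ?_
      have := ω.continuous'
      unfold Function.uncurry
      fun_prop)
    (fun y x hy hx => by simp [hout y hy x hx, hout z hz x hx])
  have hF' := hF.continuousAt hzS
  rw [ContinuousAt] at hF'
  rw [ContinuousAt, tendsto_iff_norm_sub_tendsto_zero]
  simp only [sub_self, norm_zero, mul_zero, integral_zero] at hF'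
  refine hF'.congr fun y => ?_
  rw [L1.norm_eq_integral]
  refine integral_congr_ae ?_
  have h0 := L1.coe_mk ω hk
  have h1 := L1.coe_sub (translate ω y (L1.mk ω k hk)) (translate ω z (L1.mk ω k hk))
  have h2 := coe_translate ω y (L1.mk ω k hk)
  have h3 := coe_translate ω z (L1.mk ω k hk)
  have h4 := (tendsto_translate_ae ω y).eventually h0
  have h5 := (tendsto_translate_ae ω z).eventually h0
  rw [← ae_wMeasure ω]
  filter_upwards [h1, h2, h3, h4, h5] with x h1 h2 h3 h4 h5
  rw [h1, Pi.sub_apply, h2, h3, h4, h5]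

theorem continuous_translate (ω : Weight G) (g : L1 ω) : Continuous fun y => translate ω y g := by
  refine continuous_iff_continuousAt.2 fun z => ?_
  have hb : ∀ᶠ y in 𝓝 z, ω y < ω z + 1 :=
    ω.continuous'.continuousAt.eventually_lt continuousAt_const (by linarith)
  rw [Metric.continuousAt_iff']
  intro ε hε
  have hM : 0 < ω z + 1 := by linarith [ω.pos z]
  obtain ⟨k, hk, hc, hs, hle⟩ := exists_compactSupport ω g (ε := ε / (4 * (ω z + 1))) (by positivity)
  have hkc := Metric.continuousAt_iff'.1
    ((continuous_translate_mk ω hk hc hs).continuousAt (x := z)) (ε / 2) (by positivity)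
  have key : ∀ y, ω y ≤ ω z + 1 → ‖translate ω y (g - L1.mk ω k hk)‖ ≤ ε / 4 := fun y hy => by
    refine (norm_translate_le ω y _).trans ?_
    refine (mul_le_mul hy hle (norm_nonneg _) hM.le).trans (le_of_eq ?_)
    field_simp
  filter_upwards [hb, hkc] with y hy hyk
  have h1 := key y hy.le
  have h2 := key z (by linarith)
  rw [dist_eq_norm] at hyk ⊢
  have : translate ω y g - translate ω z g = translate ω y (g - L1.mk ω k hk)
      + (translate ω y (L1.mk ω k hk) - translate ω z (L1.mk ω k hk))
      - translate ω z (g - L1.mk ω k hk) := by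
    simp only [map_sub]; abel
  rw [this]
  refine (norm_sub_le _ _).trans_lt ?_
  have := norm_add_le (translate ω y (g - L1.mk ω k hk))
    (translate ω y (L1.mk ω k hk) - translate ω z (L1.mk ω k hk))
  linarith

theorem integrable_smul_translate (ω : Weight G) (f g : L1 ω) :
    Integrable (fun y => f y • translate ω y g) (Measure.haar : Measure G) := by
  have hω := (memLp_iff ω f).1 f.memLp
  have hne : ∀ x, (ω x : ℂ) ≠ 0 := fun x => by exact_mod_cast (ω.pos x).ne'
  have hcont := continuous_translate ω g
  have hωc := ω.continuous'
  have hmeas : AEStronglyMeasurable (fun y => ((ω y : ℂ) * f y) • ((ω y : ℂ)⁻¹ • translate ω y g))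
      (Measure.haar : Measure G) := by
    have hq : Continuous fun y => (ω y : ℂ)⁻¹ • translate ω y g :=
      ((Complex.continuous_ofReal.comp ω.continuous').inv₀ hne).smul hcont
    obtain ⟨k, hkc, hks, hφ⟩ := exists_seq_compactSupport hω
    refine aestronglyMeasurable_of_tendsto_ae atTop
      (f := fun n y => k n y • ((ω y : ℂ)⁻¹ • translate ω y g)) (fun n => ?_) ?_
    · exact (((hkc _).smul hq).stronglyMeasurable_of_hasCompactSupport
        ((hks _).smul_right)).aestronglyMeasurable
    · filter_upwards [hφ] with y hy
      exact hy.smul_const _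
  have heq : (fun y => ((ω y : ℂ) * f y) • ((ω y : ℂ)⁻¹ • translate ω y g))
      = fun y => f y • translate ω y g := by
    funext y
    rw [smul_smul, mul_comm (ω y : ℂ), mul_assoc, mul_inv_cancel₀ (hne y), mul_one]
  rw [heq] at hmeas
  refine (hω.norm.mul_const ‖g‖).mono' hmeas (Eventually.of_forall fun y => ?_)
  rw [norm_smul, norm_mul, Complex.norm_real, Real.norm_eq_abs, abs_of_pos (ω.pos y)]
  nlinarith [norm_translate_le ω y g, norm_nonneg (f y)]

/-- Convolution `f * g = ∫ f(y) L_y g dy`, i.e. `(f * g)(x) = ∫ f(y) g(y⁻¹ x) dy`; the integral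
is an absolutely convergent Bochner integral in the Banach space `L^1(G, ω)`. -/
noncomputable def conv {ω : Weight G} (f g : L1 ω) : L1 ω :=
  ∫ y, f y • translate ω y g ∂(Measure.haar : Measure G)

theorem conv_add {ω : Weight G} (f g k : L1 ω) : conv f (g + k) = conv f g + conv f k := by
  unfold conv
  simp only [map_add, smul_add]
  exact integral_add (integrable_smul_translate ω f g) (integrable_smul_translate ω f k)

theorem add_conv {ω : Weight G} (f g k : L1 ω) : conv (f + g) k = conv f k + conv g k := by
  unfold conv
  rw [← integral_add (integrable_smul_translate ω f k) (integrable_smul_translate ω g k)]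
  refine integral_congr_ae ?_
  have h := L1.coe_add f g
  rw [EventuallyEq, ae_wMeasure] at h
  filter_upwards [h] with y hy
  rw [hy, Pi.add_apply, add_smul]

theorem conv_smul {ω : Weight G} (c : ℂ) (f g : L1 ω) : conv f (c • g) = c • conv f g := by
  unfold conv
  simp only [map_smul, smul_comm _ c]
  exact integral_smul c _

theorem smul_conv {ω : Weight G} (c : ℂ) (f g : L1 ω) : conv (c • f) g = c • conv f g := by
  unfold conv
  rw [← integral_smul]
  refine integral_congr_ae ?_
  have h := L1.coe_smul c f
  rw [EventuallyEq, ae_wMeasure] at h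
  filter_upwards [h] with y hy
  rw [hy, Pi.smul_apply, smul_assoc]

theorem norm_conv_le {ω : Weight G} (f g : L1 ω) : ‖conv f g‖ ≤ ‖f‖ * ‖g‖ := by
  unfold conv
  have hω := (memLp_iff ω f).1 f.memLp
  rw [L1.norm_eq_integral f, ← integral_mul_const]
  have h1 : Integrable (fun y => ω y * ‖f y‖) (Measure.haar : Measure G) := by
    refine hω.norm.congr (Eventually.of_forall fun y => ?_)
    simp [abs_of_pos (ω.pos y)]
  refine norm_integral_le_of_norm_le (h1.mul_const ‖g‖) (Eventually.of_forall fun y => ?_)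
  rw [norm_smul]
  nlinarith [norm_translate_le ω y g, norm_nonneg (f y)]

theorem translate_conv {ω : Weight G} (y : G) (f g : L1 ω) :
    translate ω y (conv f g) = conv (translate ω y f) g := by
  unfold conv
  rw [← ContinuousLinearMap.integral_comp_comm _ (integrable_smul_translate ω f g)]
  have h := coe_translate ω y f
  rw [EventuallyEq, ae_wMeasure] at h
  rw [integral_congr_ae (f := fun z => translate ω y f z • translate ω z g)
    (g := fun z => f (y⁻¹ * z) • translate ω z g)
    (by filter_upwards [h] with z hz; rw [hz])]
  rw [← integral_mul_left_eq_self (fun z => f (y⁻¹ * z) • translate ω z g) y]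
  simp only [map_smul, translate_mul, inv_mul_cancel_left]

/-- Right convolution by `g` as a bounded operator. -/
noncomputable def convRight {ω : Weight G} (g : L1 ω) : L1 ω →L[ℂ] L1 ω :=
  LinearMap.mkContinuous
    { toFun := fun f => conv f g
      map_add' := fun f k => add_conv f k g
      map_smul' := fun c f => smul_conv c f g }
    ‖g‖ (fun f => by rw [mul_comm]; exact norm_conv_le f g)

theorem conv_assoc {ω : Weight G} (f g k : L1 ω) : conv (conv f g) k = conv f (conv g k) := by
  change convRight k (conv f g) = _
  unfold conv
  rw [← ContinuousLinearMap.integral_comp_comm _ (integrable_smul_translate ω f g)]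
  refine integral_congr_ae (Eventually.of_forall fun y => ?_)
  change convRight k (f y • translate ω y g) = f y • translate ω y (conv g k)
  rw [map_smul, translate_conv]
  rfl

/-- The Banach algebra structure of `L^1(G, ω)`, with convolution as product. -/
noncomputable instance (ω : Weight G) : NonUnitalNormedRing (L1 ω) :=
  { (inferInstance : NormedAddCommGroup (L1 ω)) with
    mul := conv
    left_distrib := conv_add
    right_distrib := add_conv
    zero_mul := fun f => (convRight f).map_zero
    mul_zero := fun f => by
      have h := conv_smul 0 f 0
      rw [zero_smul, zero_smul] at h
      exact h
    mul_assoc := conv_assoc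
    norm_mul_le := norm_conv_le }

instance (ω : Weight G) : IsScalarTower ℂ (L1 ω) (L1 ω) := ⟨fun c f g => smul_conv c f g⟩

instance (ω : Weight G) : SMulCommClass ℂ (L1 ω) (L1 ω) := ⟨fun c f g => (conv_smul c f g).symm⟩

theorem integrable_mul_linf {ω : Weight G} (h : Linf ω) (f : L1 ω) :
    Integrable (fun x => f x * h x) (Measure.haar : Measure G) ∧
      ∀ᵐ x ∂(Measure.haar : Measure G), ‖f x * h x‖ ≤ ‖h‖ * (ω x * ‖f x‖) := by
  have hω := (memLp_iff ω f).1 f.memLp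
  have hb : ∀ᵐ x ∂(Measure.haar : Measure G), ‖f x * h x‖ ≤ ‖h‖ * (ω x * ‖f x‖) := by
    filter_upwards [f.ae_of_locallyAE h.bound] with x hx
    rcases eq_or_ne (f x) 0 with h0 | h0
    · simp [h0]
    · rw [norm_mul]
      nlinarith [hx h0, norm_nonneg (f x)]
  have h1 : Integrable (fun y => ω y * ‖f y‖) (Measure.haar : Measure G) := by
    refine hω.norm.congr (Eventually.of_forall fun y => ?_)
    simp [abs_of_pos (ω.pos y)]
  have hfm : AEStronglyMeasurable f.rep (Measure.haar : Measure G) := by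
    have hne : ∀ x, (ω x : ℂ) ≠ 0 := fun x => by exact_mod_cast (ω.pos x).ne'
    have hi : Continuous fun x => (ω x : ℂ)⁻¹ :=
      (Complex.continuous_ofReal.comp ω.continuous').inv₀ hne
    refine (hi.measurable.aestronglyMeasurable.mul hω.1).congr (Eventually.of_forall fun x => ?_)
    simp [inv_mul_cancel_left₀ (hne x)]
  have hhm : Measurable h.rep := by
    obtain rfl : ‹MeasurableSpace G› = borel G := BorelSpace.measurable_eq
    exact h.memLinf.1
  exact ⟨(h1.const_mul ‖h‖).mono' (hfm.mul hhm.aestronglyMeasurable) hb, hb⟩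

/-- The duality between `L^∞(G, 1/ω)` and `L^1(G, ω)`. -/
noncomputable def pairing {ω : Weight G} (h : Linf ω) (f : L1 ω) : ℂ :=
  ∫ x, f x * h x ∂(Measure.haar : Measure G)

theorem pairing_add {ω : Weight G} (h : Linf ω) (f g : L1 ω) :
    pairing h (f + g) = pairing h f + pairing h g := by
  unfold pairing
  rw [← integral_add (integrable_mul_linf h f).1 (integrable_mul_linf h g).1]
  refine integral_congr_ae ?_
  have e := L1.coe_add f g
  rw [EventuallyEq, ae_wMeasure] at e
  filter_upwards [e] with y hy
  rw [hy, Pi.add_apply, add_mul]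

theorem pairing_smul {ω : Weight G} (h : Linf ω) (c : ℂ) (f : L1 ω) :
    pairing h (c • f) = c • pairing h f := by
  rw [smul_eq_mul]
  unfold pairing
  rw [← integral_const_mul]
  refine integral_congr_ae ?_
  have e := L1.coe_smul c f
  rw [EventuallyEq, ae_wMeasure] at e
  filter_upwards [e] with y hy
  rw [hy, Pi.smul_apply, smul_eq_mul, mul_assoc]

theorem pairing_eq {ω : Weight G} {h : Linf ω} {k : G → ℂ} (e : h.rep =ᶠ[locallyAE G] k)
    (f : L1 ω) : pairing h f = ∫ x, f x * k x ∂(Measure.haar : Measure G) := by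
  refine integral_congr_ae ?_
  filter_upwards [f.ae_of_locallyAE e] with x hx
  rcases eq_or_ne (f x) 0 with h0 | h0
  · simp [h0]
  · rw [hx h0]

theorem add_pairing {ω : Weight G} (h k : Linf ω) (f : L1 ω) :
    pairing (h + k) f = pairing h f + pairing k f := by
  rw [pairing_eq (Linf.coe_add h k)]
  unfold pairing
  rw [← integral_add (integrable_mul_linf h f).1 (integrable_mul_linf k f).1]
  simp [mul_add]

theorem smul_pairing {ω : Weight G} (c : ℂ) (h : Linf ω) (f : L1 ω) :
    pairing (c • h) f = c • pairing h f := by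
  rw [pairing_eq (Linf.coe_smul c h), smul_eq_mul]
  unfold pairing
  rw [← integral_const_mul]
  simp [mul_left_comm]

theorem norm_pairing_le {ω : Weight G} (h : Linf ω) (f : L1 ω) :
    ‖pairing h f‖ ≤ ‖h‖ * ‖f‖ := by
  have hω := (memLp_iff ω f).1 f.memLp
  have h1 : Integrable (fun y => ω y * ‖f y‖) (Measure.haar : Measure G) := by
    refine hω.norm.congr (Eventually.of_forall fun y => ?_)
    simp [abs_of_pos (ω.pos y)]
  rw [L1.norm_eq_integral f, ← integral_const_mul]
  exact norm_integral_le_of_norm_le (h1.const_mul ‖h‖) (integrable_mul_linf h f).2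

/-- The canonical map `L^∞(G, 1/ω) → L^1(G, ω)^*`, `⟨h, f⟩ = ∫ f(x) h(x) dx`. -/
noncomputable def toDual (ω : Weight G) : Linf ω →L[ℂ] StrongDual ℂ (L1 ω) :=
  LinearMap.mkContinuous₂
    (LinearMap.mk₂ ℂ pairing add_pairing smul_pairing pairing_add
      fun c h f => pairing_smul h c f) 1
    (fun h f => by rw [one_mul]; exact norm_pairing_le h f)

theorem toDual_apply {ω : Weight G} (h : Linf ω) (f : L1 ω) :
    toDual ω h f = ∫ x, f x * h x ∂(Measure.haar : Measure G) := rfl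

/-- The product of `L^1(G, ω)` in terms of the duality: `⟨h, f * g⟩ = ∫∫ f(y) g(x) h(yx) dx dy`. -/
theorem toDual_mul {ω : Weight G} (h : Linf ω) (f g : L1 ω) :
    toDual ω h (f * g) = ∫ y, f y * ∫ x, g x * h (y * x) ∂(Measure.haar : Measure G)
      ∂(Measure.haar : Measure G) := by
  have h1 : f * g = ∫ y, f y • translate ω y g ∂(Measure.haar : Measure G) := rfl
  rw [h1, ← ContinuousLinearMap.integral_comp_comm _ (integrable_smul_translate ω f g)]
  refine integral_congr_ae (Eventually.of_forall fun y => ?_)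
  simp only [map_smul, smul_eq_mul, toDual_apply]
  congr 1
  have e := coe_translate ω y g
  rw [EventuallyEq, ae_wMeasure] at e
  rw [integral_congr_ae (g := fun x => g (y⁻¹ * x) * h x)
    (by filter_upwards [e] with x hx; rw [hx]),
    ← integral_mul_left_eq_self (fun x => g (y⁻¹ * x) * h x) y]
  simp only [inv_mul_cancel_left]

end Group

end Beurling

open scoped ProbabilityTheory

set_option linter.unusedSectionVars false

namespace Beurling

/-! A bounded operator B from L¹(G,ω) to its dual is a bounded bilinear form, and the theorem rests
on a dictionary between such forms and Borel functions p on G × G with |p(x,y)| ≤ C ω(x) ω(y). Each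
such p defines a form by integration against f ⊗ g (`exists_bilinear_of_wBounded`), and every form
arises in this way (`exists_wBounded_bilinear`). Elementary tensors separate bounded functions up to
locally null sets (`eventually_eq_zero_of_tensor`). Hence identities between forms become identities
between functions: B(f*k, g) = B(f, k*g) + B(k, g*f), tested on f ⊗ k ⊗ g, is quasi-additivity of p,
and B(f,g) = z(f*g) - z(g*f) is p(x,y) = h(xy) - h(yx), where h is the density of z up to a
constant. This is (a) ⇔ (c). Assertion (b) is (a) read through the duality of L¹ and L^∞, while (d)
and (e) reword (c). In (f) only classes can be compared: an inner p may be unbounded on a locally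
null set, but replacing h by an everywhere bounded representative puts its class into D(G,ω).

The function representing B is found by averaging. For E, E' concentrated near the identity, the
continuous function (x,y) ↦ B(L_x E, L_y E') pairs with f ⊗ g to a constant times B(f*E, g*E').
These functions are uniformly bounded relative to the weight, so they have a weak* limit point in
the dual of L¹(G × G, ω ⊗ ω), and by duality this limit point is a Borel function.

The analytic difficulty is that G need be neither second countable nor σ-compact: the Borel
σ-algebra of G × G may exceed the product σ-algebra, and Haar measure need not be σ-finite. Fubini's
theorem is therefore derived from the semicontinuity of section measures of open sets. Iterated
integration over compact rectangles yields a Haar measure on the product, known up to the factor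
`productConst`, and integrable functions live on countable unions of compact sets. The duality
L¹(G,ω)* = L^∞(G,1/ω) is obtained on σ-compact pieces from the Riesz theorem in L² of an equivalent
finite measure, and on G by gluing over the cosets of an open σ-compact subgroup. -/

/-- The product of two topological spaces, carrying the Borel σ-algebra of the product topology. -/
def BProd (G H : Type*) : Type _ := G × H

/-! ### The Borel product of two groups -/

section Instances

variable {G H : Type*}

instance [Group G] [Group H] : Group (BProd G H) := inferInstanceAs (Group (G × H))

instance [TopologicalSpace G] [TopologicalSpace H] : TopologicalSpace (BProd G H) :=
  inferInstanceAs (TopologicalSpace (G × H))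

instance [Group G] [TopologicalSpace G] [IsTopologicalGroup G] [Group H] [TopologicalSpace H]
    [IsTopologicalGroup H] : IsTopologicalGroup (BProd G H) :=
  inferInstanceAs (IsTopologicalGroup (G × H))

instance [TopologicalSpace G] [LocallyCompactSpace G] [TopologicalSpace H]
    [LocallyCompactSpace H] : LocallyCompactSpace (BProd G H) :=
  inferInstanceAs (LocallyCompactSpace (G × H))

instance [TopologicalSpace G] [T2Space G] [TopologicalSpace H] [T2Space H] :
    T2Space (BProd G H) := inferInstanceAs (T2Space (G × H))

instance [TopologicalSpace G] [TopologicalSpace H] : MeasurableSpace (BProd G H) :=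
  borel (BProd G H)

instance [TopologicalSpace G] [TopologicalSpace H] : BorelSpace (BProd G H) := ⟨rfl⟩

/-- The pair `(x, y)` as a point of the Borel product. -/
def BProd.mk (x : G) (y : H) : BProd G H := (x, y)

/-- The first coordinate of a point of the Borel product. -/
def BProd.fst (p : BProd G H) : G := Prod.fst p

/-- The second coordinate of a point of the Borel product. -/
def BProd.snd (p : BProd G H) : H := Prod.snd p

@[simp] theorem BProd.fst_mk (x : G) (y : H) : (BProd.mk x y).fst = x := rfl

@[simp] theorem BProd.snd_mk (x : G) (y : H) : (BProd.mk x y).snd = y := rfl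

theorem BProd.mk_mul_mk [Group G] [Group H] (a x : G) (b y : H) :
    BProd.mk a b * BProd.mk x y = BProd.mk (a * x) (b * y) := rfl

/-- The product of two subsets, as a subset of the Borel product. -/
def rect (S : Set G) (T : Set H) : Set (BProd G H) := {p | p.fst ∈ S ∧ p.snd ∈ T}

theorem mem_rect {S : Set G} {T : Set H} {p : BProd G H} :
    p ∈ rect S T ↔ p.fst ∈ S ∧ p.snd ∈ T := Iff.rfl

variable [TopologicalSpace G] [TopologicalSpace H]

theorem BProd.continuous_fst : Continuous (BProd.fst : BProd G H → G) :=
  _root_.continuous_fst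

theorem BProd.continuous_snd : Continuous (BProd.snd : BProd G H → H) :=
  _root_.continuous_snd

theorem BProd.continuous_mk {X : Type*} [TopologicalSpace X] {f : X → G} {g : X → H}
    (hf : Continuous f) (hg : Continuous g) : Continuous fun x => BProd.mk (f x) (g x) :=
  hf.prodMk hg

theorem isCompact_rect {S : Set G} {T : Set H} (hS : IsCompact S) (hT : IsCompact T) :
    IsCompact (rect S T) := hS.prod hT

theorem isOpen_rect {S : Set G} {T : Set H} (hS : IsOpen S) (hT : IsOpen T) :
    IsOpen (rect S T) := hS.prod hT

/-- The exchange of coordinates, as a homeomorphism of Borel products. -/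
def BProd.swap : BProd G H ≃ₜ BProd H G := Homeomorph.prodComm G H

theorem BProd.measurable_fst [MeasurableSpace G] [BorelSpace G] :
    Measurable (BProd.fst : BProd G H → G) :=
  BProd.continuous_fst.measurable

theorem BProd.measurable_snd [MeasurableSpace H] [BorelSpace H] :
    Measurable (BProd.snd : BProd G H → H) :=
  BProd.continuous_snd.measurable

theorem BProd.measurable_mk_left [MeasurableSpace H] [BorelSpace H] (x : G) :
    Measurable (BProd.mk x : H → BProd G H) :=
  (BProd.continuous_mk continuous_const continuous_id).measurable

theorem measurableSet_rect [MeasurableSpace G] [BorelSpace G] [MeasurableSpace H]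
    [BorelSpace H] {S : Set G} {T : Set H} (hS : MeasurableSet S) (hT : MeasurableSet T) :
    MeasurableSet (rect S T) :=
  (BProd.measurable_fst hS).inter (BProd.measurable_snd hT)

end Instances

/-! ### Measurability of section measures -/

section Kernel

variable {G H : Type*} [TopologicalSpace G] [MeasurableSpace G] [BorelSpace G]
  [TopologicalSpace H] [MeasurableSpace H] [BorelSpace H] [T2Space H]

/-- For an open set `U` of the product, the measure of the part of a section inside a compact set
is lower semicontinuous. -/
theorem lowerSemicontinuous_measure_section (ν : Measure H) [ν.InnerRegularCompactLTTop]
    [IsFiniteMeasureOnCompacts ν] {L : Set H} (hL : IsCompact L) {U : Set (BProd G H)}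
    (hU : IsOpen U) : LowerSemicontinuous fun x : G => ν (BProd.mk x ⁻¹' U ∩ L) := by
  intro x a ha
  have hm : MeasurableSet (BProd.mk x ⁻¹' U ∩ L) :=
    (BProd.measurable_mk_left x hU.measurableSet).inter hL.measurableSet
  have hfin : ν (BProd.mk x ⁻¹' U ∩ L) ≠ ∞ :=
    ((measure_mono Set.inter_subset_right).trans_lt hL.measure_lt_top).ne
  obtain ⟨C, hC, hCc, haC⟩ := hm.exists_lt_isCompact_of_ne_top hfin ha
  have hsub : ({x} : Set G) ×ˢ C ⊆ U := by
    rintro ⟨x', y⟩ ⟨hx', hy⟩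
    rw [Set.mem_singleton_iff] at hx'
    subst hx'
    exact (hC hy).1
  -- By the tube lemma the compact set C, chosen in the section at x with measure above a, stays
  -- inside the sections at all nearby points.
  obtain ⟨W, V, hW, hV, hxW, hCV, hWV⟩ :=
    generalized_tube_lemma (isCompact_singleton (x := x)) hCc hU hsub
  filter_upwards [hW.mem_nhds (hxW rfl)] with x' hx'
  refine haC.trans_le (measure_mono fun y hy => ⟨?_, (hC hy).2⟩)
  exact hWV (Set.mk_mem_prod hx' (hCV hy))

/-- A π-λ argument starting from open sets, where the function is lower semicontinuous. Cutting down
to the compact L keeps all measures finite, which the complement step needs. -/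
theorem measurable_measure_section_of_isCompact (ν : Measure H) [ν.InnerRegularCompactLTTop]
    [IsFiniteMeasureOnCompacts ν] {L : Set H} (hL : IsCompact L) {B : Set (BProd G H)}
    (hB : MeasurableSet B) : Measurable fun x : G => ν (BProd.mk x ⁻¹' B ∩ L) := by
  have hLm := hL.measurableSet
  induction B, hB using MeasurableSpace.induction_on_inter
    (s := {s : Set (BProd G H) | IsOpen s}) rfl isPiSystem_isOpen with
  | empty => simp
  | basic U hU => exact (lowerSemicontinuous_measure_section ν hL hU).measurable
  | compl B hB ih =>
    have h : ∀ x : G, ν (BProd.mk x ⁻¹' Bᶜ ∩ L) = ν L - ν (BProd.mk x ⁻¹' B ∩ L) := fun x => by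
      rw [← measure_sdiff Set.inter_subset_right
        ((BProd.measurable_mk_left x hB).inter hLm).nullMeasurableSet
        ((measure_mono Set.inter_subset_right).trans_lt hL.measure_lt_top).ne]
      congr 1
      ext y
      simp only [Set.mem_inter_iff, Set.mem_preimage, Set.mem_compl_iff, Set.mem_sdiff]
      tauto
    simp only [h]
    exact measurable_const.sub ih
  | iUnion f hd hf ih =>
    have h : ∀ x : G, ν (BProd.mk x ⁻¹' (⋃ i, f i) ∩ L)
        = ∑' i, ν (BProd.mk x ⁻¹' f i ∩ L) := fun x => by
      rw [Set.preimage_iUnion, Set.iUnion_inter, measure_iUnion]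
      · intro i j hij
        exact ((hd hij).preimage _).mono Set.inter_subset_left Set.inter_subset_left
      · exact fun i => (BProd.measurable_mk_left x (hf i)).inter hLm
    simp only [h]
    exact Measurable.tsum ih

/-- `T` is measurable and covered by countably many compact sets. -/
structure CompactlyCovered (T : Set H) : Prop where
  measurableSet : MeasurableSet T
  cover : ∃ K : ℕ → Set H, (∀ n, IsCompact (K n)) ∧ T ⊆ ⋃ n, K n

/-- The pieces of a decomposition of a set into countably many relatively compact ones. -/
theorem CompactlyCovered.exists_pieces {T : Set H} (hT : CompactlyCovered T) :
    ∃ D L : ℕ → Set H, (∀ n, MeasurableSet (D n)) ∧ (∀ n, IsCompact (L n)) ∧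
      (∀ n, D n ⊆ L n) ∧ Pairwise (Function.onFun Disjoint D) ∧ ⋃ n, D n = T := by
  obtain ⟨K, hK, hTK⟩ := hT.cover
  refine ⟨fun n => T ∩ disjointed K n, K, fun n => hT.measurableSet.inter
    (MeasurableSet.disjointed (fun n => (hK n).measurableSet) n), hK,
    fun n => Set.inter_subset_right.trans (disjointed_subset K n), fun i j hij =>
      (disjoint_disjointed K hij).mono Set.inter_subset_right Set.inter_subset_right, ?_⟩
  rw [← Set.inter_iUnion, iUnion_disjointed]
  exact Set.inter_eq_left.2 hTK

variable (G) in
/-- The kernel `x ↦ δ_x ⊗ ν|_D` on the Borel product, for relatively compact `D`. -/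
noncomputable def sectionKernelPiece (ν : Measure H) [ν.InnerRegularCompactLTTop]
    [IsFiniteMeasureOnCompacts ν] {D L : Set H} (hD : MeasurableSet D) (hL : IsCompact L)
    (hDL : D ⊆ L) : ProbabilityTheory.Kernel G (BProd G H) where
  toFun x := (ν.restrict D).map (BProd.mk x)
  measurable' := by
    refine Measure.measurable_of_measurable_coe _ fun B hB => ?_
    have h : ∀ x : G, (ν.restrict D).map (BProd.mk x) B
        = ν (BProd.mk x ⁻¹' (B ∩ rect Set.univ D) ∩ L) := fun x => by
      rw [Measure.map_apply (BProd.measurable_mk_left x) hB,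
        Measure.restrict_apply (BProd.measurable_mk_left x hB)]
      congr 1
      ext y
      simp only [Set.mem_inter_iff, Set.mem_preimage, mem_rect, Set.mem_univ, BProd.snd_mk]
      exact ⟨fun h => ⟨⟨h.1, trivial, h.2⟩, hDL h.2⟩, fun h => ⟨h.1.1, h.1.2.2⟩⟩
    simp only [h]
    exact measurable_measure_section_of_isCompact ν hL
      (hB.inter (measurableSet_rect MeasurableSet.univ hD))

-- Only relatively compact pieces are handled directly; the kernel for T is the countable sum of the
-- kernels of its pieces.
variable (G) in
theorem exists_sectionKernel (ν : Measure H) [ν.InnerRegularCompactLTTop]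
    [IsFiniteMeasureOnCompacts ν] {T : Set H} (hT : CompactlyCovered T) :
    ∃ κ : ProbabilityTheory.Kernel G (BProd G H),
      ∀ x, κ x = (ν.restrict T).map (BProd.mk x) := by
  obtain ⟨D, L, hD, hL, hDL, hdis, hU⟩ := hT.exists_pieces
  refine ⟨ProbabilityTheory.Kernel.sum fun n => sectionKernelPiece G ν (hD n) (hL n) (hDL n),
    fun x => ?_⟩
  rw [ProbabilityTheory.Kernel.sum_apply, ← hU, Measure.restrict_iUnion hdis hD,
    Measure.map_sum (BProd.measurable_mk_left x).aemeasurable]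
  rfl

variable (G) in
/-- The kernel `x ↦ δ_x ⊗ ν|_T` on the Borel product. -/
noncomputable def sectionKernel (ν : Measure H) [ν.InnerRegularCompactLTTop]
    [IsFiniteMeasureOnCompacts ν] {T : Set H} (hT : CompactlyCovered T) :
    ProbabilityTheory.Kernel G (BProd G H) := (exists_sectionKernel G ν hT).choose

theorem sectionKernel_apply (ν : Measure H) [ν.InnerRegularCompactLTTop]
    [IsFiniteMeasureOnCompacts ν] {T : Set H} (hT : CompactlyCovered T) (x : G) :
    sectionKernel G ν hT x = (ν.restrict T).map (BProd.mk x) :=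
  (exists_sectionKernel G ν hT).choose_spec x

end Kernel

/-! ### Haar measure on the product as iterated Haar measure -/

section ProductMeasure

open TopologicalSpace

variable {G H : Type*} [Group G] [TopologicalSpace G] [IsTopologicalGroup G]
  [LocallyCompactSpace G] [T2Space G] [MeasurableSpace G] [BorelSpace G]
  [Group H] [TopologicalSpace H] [IsTopologicalGroup H]
  [LocallyCompactSpace H] [T2Space H] [MeasurableSpace H] [BorelSpace H]

/-- The iterated measure of the part of `B` in a compact rectangle. -/
noncomputable def iteratedMeasure (B : Set (BProd G H)) (q : Compacts G × Compacts H) : ℝ≥0∞ :=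
  ∫⁻ x in (q.1 : Set G), (Measure.haar : Measure H) (BProd.mk x ⁻¹' B ∩ q.2)
    ∂(Measure.haar : Measure G)

theorem iteratedMeasure_mono (B : Set (BProd G H)) : Monotone (iteratedMeasure B) :=
  fun _ _ h => lintegral_mono' (Measure.restrict_mono h.1 le_rfl) fun _ =>
    measure_mono (Set.inter_subset_inter_right _ h.2)

theorem iteratedMeasure_iUnion {f : ℕ → Set (BProd G H)} (hf : ∀ i, MeasurableSet (f i))
    (hd : Pairwise (Function.onFun Disjoint f)) (q : Compacts G × Compacts H) :
    iteratedMeasure (⋃ i, f i) q = ∑' i, iteratedMeasure (f i) q := by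
  unfold iteratedMeasure
  rw [← lintegral_tsum fun i => (measurable_measure_section_of_isCompact _ q.2.isCompact
    (hf i)).aemeasurable]
  refine lintegral_congr fun x => ?_
  rw [Set.preimage_iUnion, Set.iUnion_inter, measure_iUnion]
  · intro i j hij
    exact ((hd hij).preimage _).mono Set.inter_subset_left Set.inter_subset_left
  · exact fun i => (BProd.measurable_mk_left x (hf i)).inter q.2.isCompact.measurableSet

variable (G H) in
/-- The Borel measure on the product obtained by iterated integration over compact rectangles. -/
noncomputable def productMeasure : Measure (BProd G H) :=
  Measure.ofMeasurable (fun B _ => ⨆ q, iteratedMeasure B q) (by simp [iteratedMeasure]) (by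
    intro f hf hd
    simp only [iteratedMeasure_iUnion hf hd]
    simp_rw [ENNReal.tsum_eq_iSup_sum]
    rw [iSup_comm]
    refine iSup_congr fun s => ?_
    -- The family of compact rectangles is directed, so the supremum commutes with finite sums; this
    -- is what makes it countably additive.
    rw [ENNReal.finsetSum_iSup]
    exact fun i j => ⟨i ⊔ j, fun a => ⟨iteratedMeasure_mono _ le_sup_left,
      iteratedMeasure_mono _ le_sup_right⟩⟩)

theorem productMeasure_apply {B : Set (BProd G H)} (hB : MeasurableSet B) :
    productMeasure G H B = ⨆ q, iteratedMeasure B q := Measure.ofMeasurable_apply B hB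

/-- Translation by (a, b) carries the rectangle q to another compact rectangle with the same
iterated measure, by left invariance in each variable. -/
theorem iteratedMeasure_preimage_mul_le (a : G) (b : H) {B : Set (BProd G H)}
    (hB : MeasurableSet B) (q : Compacts G × Compacts H) :
    iteratedMeasure ((BProd.mk a b * ·) ⁻¹' B) q ≤ productMeasure G H B := by
  rw [productMeasure_apply hB]
  refine le_iSup_of_le (q.1.map (a * ·) (continuous_const_mul a),
    q.2.map (b * ·) (continuous_const_mul b)) (le_of_eq ?_)
  unfold iteratedMeasure
  rw [← lintegral_indicator q.1.isCompact.measurableSet,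
    ← lintegral_indicator (Compacts.isCompact _).measurableSet, ← lintegral_mul_left_eq_self
      (((q.1.map (a * ·) (continuous_const_mul a) : Compacts G) : Set G).indicator _) a]
  refine lintegral_congr fun x => ?_
  have hx : a * x ∈ ((q.1.map (a * ·) (continuous_const_mul a) : Compacts G) : Set G) ↔
      x ∈ (q.1 : Set G) := by
    simp
  by_cases h : x ∈ (q.1 : Set G)
  · rw [Set.indicator_of_mem h, Set.indicator_of_mem (hx.2 h),
      ← measure_preimage_mul _ b (BProd.mk (a * x) ⁻¹' B ∩ _)]
    congr 1
    ext y
    simp [BProd.mk_mul_mk]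
  · rw [Set.indicator_of_notMem h, Set.indicator_of_notMem (fun h' => h (hx.1 h'))]

theorem measurable_mul_left_bprod (g : BProd G H) : Measurable (g * · : BProd G H → BProd G H) :=
  (continuous_const_mul g).measurable

theorem productMeasure_preimage_mul_le (g : BProd G H) {B : Set (BProd G H)}
    (hB : MeasurableSet B) : productMeasure G H ((g * ·) ⁻¹' B) ≤ productMeasure G H B := by
  rw [productMeasure_apply (measurable_mul_left_bprod g hB)]
  exact iSup_le fun q => iteratedMeasure_preimage_mul_le g.fst g.snd hB q

instance : (productMeasure G H).IsMulLeftInvariant := ⟨fun g => by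
  refine Measure.ext fun B hB => ?_
  rw [Measure.map_apply (measurable_mul_left_bprod g) hB]
  refine le_antisymm (productMeasure_preimage_mul_le g hB) ?_
  -- The reverse inequality is the same one for the inverse element.
  have h := productMeasure_preimage_mul_le g⁻¹ (measurable_mul_left_bprod g hB)
  rwa [← Set.preimage_comp, show (g * ·) ∘ (g⁻¹ * ·) = (id : BProd G H → BProd G H) from
    funext fun x => mul_inv_cancel_left g x, Set.preimage_id] at h⟩

/-- The product measure of a set inside a relatively compact rectangle. -/
theorem productMeasure_inter_rect {B : Set (BProd G H)} (hB : MeasurableSet B) {C K : Set G}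
    {D L : Set H} (hC : MeasurableSet C) (hD : MeasurableSet D) (hK : IsCompact K)
    (hL : IsCompact L) (hCK : C ⊆ K) (hDL : D ⊆ L) :
    productMeasure G H (B ∩ rect C D) = ∫⁻ x in C, (Measure.haar : Measure H)
      (BProd.mk x ⁻¹' B ∩ D) ∂(Measure.haar : Measure G) := by
  rw [productMeasure_apply (hB.inter (measurableSet_rect hC hD))]
  have key : ∀ q : Compacts G × Compacts H, iteratedMeasure (B ∩ rect C D) q =
      ∫⁻ x in (q.1 : Set G), C.indicator (fun x => (Measure.haar : Measure H)
      (BProd.mk x ⁻¹' B ∩ D ∩ q.2)) x ∂(Measure.haar : Measure G) := fun q => by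
    refine lintegral_congr fun x => ?_
    by_cases hx : x ∈ C
    · rw [Set.indicator_of_mem hx]
      congr 1
      ext y
      simp [mem_rect, hx]
    · rw [Set.indicator_of_notMem hx]
      convert measure_empty (μ := (Measure.haar : Measure H))
      ext y
      simp [mem_rect, hx]
  refine le_antisymm (iSup_le fun q => ?_) (le_iSup_of_le (⟨K, hK⟩, ⟨L, hL⟩) ?_)
  · rw [key, ← lintegral_indicator hC]
    refine (setLIntegral_le_lintegral _ _).trans (lintegral_mono fun x => ?_)
    exact Set.indicator_le_indicator (measure_mono Set.inter_subset_left)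
  · rw [key, lintegral_indicator hC, Measure.restrict_restrict hC, Compacts.coe_mk,
      Set.inter_eq_left.2 hCK]
    refine lintegral_mono fun x => measure_mono fun y hy => ⟨hy, hDL hy.2⟩

theorem productMeasure_rect {K : Set G} {L : Set H} (hK : IsCompact K) (hL : IsCompact L) :
    productMeasure G H (rect K L) =
      (Measure.haar : Measure G) K * (Measure.haar : Measure H) L := by
  have h := productMeasure_inter_rect (G := G) (H := H) MeasurableSet.univ hK.measurableSet
    hL.measurableSet hK hL le_rfl le_rfl
  simpa [mul_comm] using h

theorem subset_rect_image (Q : Set (BProd G H)) :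
    Q ⊆ rect (BProd.fst '' Q) (BProd.snd '' Q) :=
  fun p hp => ⟨⟨p, hp, rfl⟩, ⟨p, hp, rfl⟩⟩

/-- A compact set lies in the rectangle formed by its two projections. -/
instance : IsFiniteMeasureOnCompacts (productMeasure G H) := ⟨fun {Q} hQ => by
  have hK := hQ.image BProd.continuous_fst
  have hL := hQ.image BProd.continuous_snd
  refine (measure_mono (subset_rect_image Q)).trans_lt ?_
  rw [productMeasure_rect hK hL]
  exact ENNReal.mul_lt_top hK.measure_lt_top hL.measure_lt_top⟩

instance : (productMeasure G H).IsHaarMeasure := by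
  let K : PositiveCompacts G := Classical.arbitrary _
  let L : PositiveCompacts H := Classical.arbitrary _
  refine Measure.isHaarMeasure_of_isCompact_nonempty_interior _ (rect (K : Set G) (L : Set H))
    (isCompact_rect K.isCompact L.isCompact) ?_ ?_ ?_
  · obtain ⟨x, hx⟩ := K.interior_nonempty
    obtain ⟨y, hy⟩ := L.interior_nonempty
    refine ⟨BProd.mk x y, mem_interior.2 ⟨rect (interior K) (interior L), ?_,
      isOpen_rect isOpen_interior isOpen_interior, hx, hy⟩⟩
    exact fun p hp => ⟨interior_subset hp.1, interior_subset hp.2⟩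
  · rw [productMeasure_rect K.isCompact L.isCompact]
    exact mul_ne_zero (Measure.measure_pos_of_nonempty_interior _ K.interior_nonempty).ne'
      (Measure.measure_pos_of_nonempty_interior _ L.interior_nonempty).ne'
  · exact (isCompact_rect K.isCompact L.isCompact).measure_lt_top.ne

variable (G H) in
/-- The ratio of Haar measure on the product to the product measure. -/
noncomputable def productConst : NNReal :=
  (Measure.haarScalarFactor (productMeasure G H) Measure.haar)⁻¹

variable (G H) in
theorem productConst_pos : 0 < productConst G H :=
  inv_pos.2 (Measure.haarScalarFactor_pos_of_isHaarMeasure _ _)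

/-- Uniqueness of Haar measure. Regularity of `productMeasure` is not established, so the comparison
is made only on sets with compact closure; this is why the rectangle must be relatively compact. -/
theorem haar_bprod_inter_rect {B : Set (BProd G H)} (hB : MeasurableSet B) {C K : Set G}
    {D L : Set H} (hC : MeasurableSet C) (hD : MeasurableSet D) (hK : IsCompact K)
    (hL : IsCompact L) (hCK : C ⊆ K) (hDL : D ⊆ L) :
    (Measure.haar : Measure (BProd G H)) (B ∩ rect C D) =
      productConst G H * ∫⁻ x in C, (Measure.haar : Measure H)
      (BProd.mk x ⁻¹' B ∩ D) ∂(Measure.haar : Measure G) := by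
  have hc : IsCompact (closure (B ∩ rect C D)) :=
    (isCompact_rect hK hL).closure_of_subset fun p hp => ⟨hCK hp.2.1, hDL hp.2.2⟩
  have h := Measure.measure_isMulInvariant_eq_smul_of_isCompact_closure (productMeasure G H)
    Measure.haar hc
  rw [← productMeasure_inter_rect hB hC hD hK hL hCK hDL, h, ENNReal.smul_def, smul_eq_mul,
    ← mul_assoc, ← ENNReal.coe_mul, productConst, inv_mul_cancel₀, ENNReal.coe_one, one_mul]
  exact (Measure.haarScalarFactor_pos_of_isHaarMeasure _ _).ne'

/-- Disintegration of Haar measure on the product over a rectangle. -/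
theorem haar_bprod_restrict_rect {S : Set G} {T : Set H} (hS : CompactlyCovered S)
    (hT : CompactlyCovered T) :
    (Measure.haar : Measure (BProd G H)).restrict (rect S T) = productConst G H •
      (sectionKernel G Measure.haar hT ∘ₘ (Measure.haar : Measure G).restrict S) := by
  refine Measure.ext fun B hB => ?_
  obtain ⟨C, K, hC, hK, hCK, hCd, hCU⟩ := hS.exists_pieces
  obtain ⟨D, L, hD, hL, hDL, hDd, hDU⟩ := hT.exists_pieces
  have hsec : ∀ x : G, sectionKernel G Measure.haar hT x B =
      ∑' n, (Measure.haar : Measure H) (BProd.mk x ⁻¹' B ∩ D n) := fun x => by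
    have hBx := BProd.measurable_mk_left (H := H) x hB
    rw [sectionKernel_apply, Measure.map_apply (BProd.measurable_mk_left x) hB,
      Measure.restrict_apply hBx, ← hDU, Set.inter_iUnion, measure_iUnion]
    · exact fun i j hij => (hDd hij).mono Set.inter_subset_right Set.inter_subset_right
    · exact fun n => hBx.inter (hD n)
  have hmeas : ∀ n, Measurable fun x : G => (Measure.haar : Measure H)
      (BProd.mk x ⁻¹' B ∩ D n) := fun n => by
    have h := measurable_measure_section_of_isCompact (Measure.haar : Measure H) (hL n)
      (hB.inter (measurableSet_rect (S := (Set.univ : Set G)) MeasurableSet.univ (hD n)))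
    convert h using 3 with x
    ext y
    simp only [Set.mem_inter_iff, Set.mem_preimage, mem_rect, Set.mem_univ, BProd.snd_mk]
    exact ⟨fun h => ⟨⟨h.1, trivial, h.2⟩, hDL n h.2⟩, fun h => ⟨h.1.1, h.1.2.2⟩⟩
  -- Both sides are sums over the relatively compact rectangles formed from the pieces of S and T,
  -- where the comparison with iterated measure applies.
  have hrect : B ∩ rect S T = ⋃ i : ℕ × ℕ, B ∩ rect (C i.1) (D i.2) := by
    ext p
    simp only [← hCU, ← hDU, mem_rect, Set.mem_inter_iff, Set.mem_iUnion, Prod.exists]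
    tauto
  rw [Measure.restrict_apply hB, hrect, measure_iUnion, ENNReal.tsum_prod', Measure.smul_apply,
    Measure.bind_apply hB (ProbabilityTheory.Kernel.aemeasurable _), ← hCU,
    lintegral_iUnion hC hCd, ENNReal.smul_def, smul_eq_mul, ← ENNReal.tsum_mul_left]
  · refine tsum_congr fun m => ?_
    simp only [hsec]
    rw [lintegral_tsum fun n => (hmeas n).aemeasurable, ← ENNReal.tsum_mul_left]
    exact tsum_congr fun n =>
      haar_bprod_inter_rect hB (hC m) (hD n) (hK m) (hL n) (hCK m) (hDL n)
  · rintro ⟨m, n⟩ ⟨m', n'⟩ hne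
    refine Set.disjoint_left.2 fun p hp hp' => hne ?_
    have h1 : m = m' := by
      by_contra h
      exact Set.disjoint_left.1 (hCd h) hp.2.1 hp'.2.1
    have h2 : n = n' := by
      by_contra h
      exact Set.disjoint_left.1 (hDd h) hp.2.2 hp'.2.2
    rw [h1, h2]
  · exact fun i => hB.inter (measurableSet_rect (hC _) (hD _))

end ProductMeasure

/-! ### Tonelli and Fubini for Borel functions on the product -/

theorem setLIntegral_eq_of_forall_compl {X : Type*} [MeasurableSpace X] (μ : Measure X)
    {s : Set X} (hs : MeasurableSet s) {f : X → ℝ≥0∞} (hf : ∀ x, x ∉ s → f x = 0) :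
    ∫⁻ x in s, f x ∂μ = ∫⁻ x, f x ∂μ := by
  rw [← lintegral_indicator hs, Set.indicator_eq_self.2]
  exact Function.support_subset_iff'.2 hf

section Integrals

variable {G H : Type*} [Group G] [TopologicalSpace G] [IsTopologicalGroup G]
  [LocallyCompactSpace G] [T2Space G] [MeasurableSpace G] [BorelSpace G]
  [Group H] [TopologicalSpace H] [IsTopologicalGroup H]
  [LocallyCompactSpace H] [T2Space H] [MeasurableSpace H] [BorelSpace H]

theorem measurable_integral_section {T : Set H} (hT : CompactlyCovered T) {F : BProd G H → ℂ}
    (hF : Measurable F) (h0 : ∀ x y, y ∉ T → F (BProd.mk x y) = 0) :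
    Measurable fun x => ∫ y, F (BProd.mk x y) ∂(Measure.haar : Measure H) := by
  have h := hF.stronglyMeasurable.integral_kernel
    (κ := sectionKernel G (Measure.haar : Measure H) hT)
  convert h.measurable using 2 with x
  rw [sectionKernel_apply, integral_map (BProd.measurable_mk_left x).aemeasurable
    hF.aestronglyMeasurable, setIntegral_eq_integral_of_forall_compl_eq_zero (h0 x)]

/-- Vanishing outside a rectangle covered by countably many compact sets takes the place of
σ-finiteness. -/
theorem lintegral_haar_bprod {S : Set G} {T : Set H} (hS : CompactlyCovered S)
    (hT : CompactlyCovered T) {F : BProd G H → ℝ≥0∞} (hF : Measurable F)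
    (h0 : ∀ p, p ∉ rect S T → F p = 0) :
    ∫⁻ p, F p ∂Measure.haar = productConst G H * ∫⁻ x, ∫⁻ y, F (BProd.mk x y)
      ∂(Measure.haar : Measure H) ∂(Measure.haar : Measure G) := by
  rw [← setLIntegral_eq_of_forall_compl _ (measurableSet_rect hS.measurableSet hT.measurableSet) h0,
    haar_bprod_restrict_rect hS hT, lintegral_smul_measure,
    Measure.lintegral_bind (ProbabilityTheory.Kernel.aemeasurable _) hF.aemeasurable,
    ENNReal.smul_def, smul_eq_mul]
  congr 1
  rw [← setLIntegral_eq_of_forall_compl _ hS.measurableSet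
      (f := fun x => ∫⁻ y, F (BProd.mk x y) ∂(Measure.haar : Measure H))
    (fun x hx => by simp [h0 (BProd.mk x _) (fun hp => hx hp.1)])]
  refine lintegral_congr fun x => ?_
  rw [sectionKernel_apply, lintegral_map hF (BProd.measurable_mk_left x)]
  rw [setLIntegral_eq_of_forall_compl _ hT.measurableSet
    (fun y hy => h0 (BProd.mk x y) (fun hp => hy hp.2))]

theorem integral_haar_bprod {S : Set G} {T : Set H} (hS : CompactlyCovered S)
    (hT : CompactlyCovered T) {F : BProd G H → ℂ} (hF : Measurable F)
    (hi : Integrable F (Measure.haar : Measure (BProd G H)))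
    (h0 : ∀ p, p ∉ rect S T → F p = 0) :
    ∫ p, F p ∂Measure.haar = productConst G H * ∫ x, ∫ y, F (BProd.mk x y)
      ∂(Measure.haar : Measure H) ∂(Measure.haar : Measure G) := by
  have hi' := hi.restrict (s := rect S T)
  have hc : productConst G H ≠ 0 := (productConst_pos G H).ne'
  rw [haar_bprod_restrict_rect hS hT] at hi'
  replace hi' := (integrable_smul_measure (c := (productConst G H : ℝ≥0∞))
    (by exact_mod_cast hc) ENNReal.coe_ne_top).1 hi'
  -- The disintegrated measure is rewritten as a composition with a constant kernel, for which the
  -- Bochner integral formula is stated.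
  have hc' := Measure.comp_eq_comp_const_apply (μ := (Measure.haar : Measure G).restrict S)
    (κ := sectionKernel G Measure.haar hT)
  rw [← setIntegral_eq_integral_of_forall_compl_eq_zero h0,
    haar_bprod_restrict_rect hS hT, integral_smul_nnreal_measure, hc',
    ProbabilityTheory.Kernel.integral_comp (hc' ▸ hi'), ProbabilityTheory.Kernel.const_apply,
    NNReal.smul_def, Complex.real_smul]
  congr 1
  rw [← setIntegral_eq_integral_of_forall_compl_eq_zero (s := S)
    (f := fun x => ∫ y, F (BProd.mk x y) ∂(Measure.haar : Measure H))
    (fun x hx => by simp [h0 (BProd.mk x _) (fun hp => hx hp.1)])]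
  refine integral_congr_ae (Eventually.of_forall fun x => ?_)
  simp only
  rw [sectionKernel_apply, integral_map (BProd.measurable_mk_left x).aemeasurable
    hF.aestronglyMeasurable, setIntegral_eq_integral_of_forall_compl_eq_zero
      (fun y hy => h0 (BProd.mk x y) (fun hp => hy hp.2))]

theorem haar_rect {K : Set G} {L : Set H} (hK : IsCompact K) (hL : IsCompact L) :
    (Measure.haar : Measure (BProd G H)) (rect K L) = productConst G H *
      ((Measure.haar : Measure G) K * (Measure.haar : Measure H) L) := by
  have h := haar_bprod_inter_rect (G := G) (H := H) MeasurableSet.univ hK.measurableSet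
    hL.measurableSet hK hL le_rfl le_rfl
  simpa [mul_comm, mul_left_comm] using h

/-- Haar measure on the product does not depend on the order of the factors, up to the constants
relating it to iterated integration. -/
theorem map_swap_haar : ∃ e : NNReal, productConst H G = e * productConst G H ∧
    (Measure.haar : Measure (BProd H G)).map BProd.swap =
      e • (Measure.haar : Measure (BProd G H)) := by
  have hm : Measurable (BProd.swap : BProd H G → BProd G H) := BProd.swap.continuous.measurable
  let E : BProd H G ≃* BProd G H := MulEquiv.prodComm
  have : ((Measure.haar : Measure (BProd H G)).map BProd.swap).IsHaarMeasure :=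
    MulEquiv.isHaarMeasure_map (Measure.haar : Measure (BProd H G)) E BProd.swap.continuous
      BProd.swap.symm.continuous
  have : ((Measure.haar : Measure (BProd H G)).map BProd.swap).Regular :=
    Measure.Regular.map BProd.swap
  have h := Measure.isMulLeftInvariant_eq_smul_of_regular
    ((Measure.haar : Measure (BProd H G)).map BProd.swap) (Measure.haar : Measure (BProd G H))
  refine ⟨_, ?_, h⟩
  set e := Measure.haarScalarFactor ((Measure.haar : Measure (BProd H G)).map BProd.swap)
    (Measure.haar : Measure (BProd G H))
  let K : TopologicalSpace.PositiveCompacts G := Classical.arbitrary _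
  let L : TopologicalSpace.PositiveCompacts H := Classical.arbitrary _
  -- The factor e is found by evaluating on one rectangle whose measure is finite and positive.
  have h1 := Measure.ext_iff'.1 h (rect (K : Set G) (L : Set H))
  have h2 : BProd.swap ⁻¹' (rect (K : Set G) (L : Set H)) = rect (L : Set H) (K : Set G) := by
    ext p
    exact And.comm
  rw [Measure.map_apply hm (isCompact_rect K.isCompact L.isCompact).measurableSet, h2,
    haar_rect L.isCompact K.isCompact, Measure.smul_apply, haar_rect K.isCompact L.isCompact,
    ENNReal.smul_def, smul_eq_mul, ← mul_assoc (e : ℝ≥0∞), mul_comm (Measure.haar (L : Set H)),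
    ENNReal.mul_left_inj] at h1
  · exact_mod_cast h1
  · exact mul_ne_zero (Measure.measure_pos_of_nonempty_interior _ K.interior_nonempty).ne'
      (Measure.measure_pos_of_nonempty_interior _ L.interior_nonempty).ne'
  · exact ENNReal.mul_ne_top K.isCompact.measure_lt_top.ne L.isCompact.measure_lt_top.ne

/-- This is Fubini on H × G for the function with exchanged coordinates; the factor e between the
two Haar measures cancels, so the constant is the same as for the other order. -/
theorem integral_haar_bprod_swap {S : Set G} {T : Set H} (hS : CompactlyCovered S)
    (hT : CompactlyCovered T) {F : BProd G H → ℂ} (hF : Measurable F)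
    (hi : Integrable F (Measure.haar : Measure (BProd G H)))
    (h0 : ∀ p, p ∉ rect S T → F p = 0) :
    ∫ p, F p ∂Measure.haar = productConst G H * ∫ y, ∫ x, F (BProd.mk x y)
      ∂(Measure.haar : Measure G) ∂(Measure.haar : Measure H) := by
  obtain ⟨e, he, hmap⟩ := map_swap_haar (G := G) (H := H)
  have hm : Measurable (BProd.swap : BProd H G → BProd G H) := BProd.swap.continuous.measurable
  have hi1 : Integrable (F ∘ BProd.swap) (Measure.haar : Measure (BProd H G)) := by
    rw [← integrable_map_measure hF.aestronglyMeasurable hm.aemeasurable, hmap]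
    exact hi.smul_measure ENNReal.coe_ne_top
  have h1 := integral_haar_bprod hT hS (hF.comp hm) hi1 (fun p hp => h0 _ fun hp' => hp hp'.symm)
  have h2 := integral_map hm.aemeasurable (f := F) hF.aestronglyMeasurable
    (μ := (Measure.haar : Measure (BProd H G)))
  rw [hmap, integral_smul_nnreal_measure, NNReal.smul_def, Complex.real_smul] at h2
  have he0 : (e : ℂ) ≠ 0 := by
    rintro h
    have : e = 0 := by exact_mod_cast h
    exact (productConst_pos H G).ne' (by rw [he, this, zero_mul])
  have h3 := h2.trans h1
  rw [he] at h3
  refine mul_left_cancel₀ he0 ?_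
  rw [show ((e : ℝ) : ℂ) = (e : ℂ) from rfl] at h3
  rw [h3]
  push_cast
  rw [mul_assoc]
  rfl

end Integrals

/-! ### Everywhere bounded representatives and the pairing -/

section Pair

variable {G : Type*} [Group G] [TopologicalSpace G] [IsTopologicalGroup G]
  [LocallyCompactSpace G] [MeasurableSpace G] [BorelSpace G] {ω : Weight G}

/-- Borel functions bounded everywhere by a multiple of the weight. -/
structure WBounded (ω : Weight G) (h : G → ℂ) : Prop where
  measurable : Measurable h
  bound : ∃ C, ∀ x, ‖h x‖ ≤ C * ω x

theorem WBounded.exists_nonneg {h : G → ℂ} (hh : WBounded ω h) :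
    ∃ C, 0 ≤ C ∧ ∀ x, ‖h x‖ ≤ C * ω x := by
  obtain ⟨C, hC⟩ := hh.bound
  have h1 := (norm_nonneg _).trans (hC 1)
  rw [ω.map_one', mul_one] at h1
  exact ⟨C, h1, hC⟩

theorem borelFun_iff {h : G → ℂ} : BorelFun h ↔ Measurable h := by
  obtain rfl : ‹MeasurableSpace G› = borel G := BorelSpace.measurable_eq
  obtain h2 : (inferInstance : MeasurableSpace ℂ) = borel ℂ := BorelSpace.measurable_eq
  unfold BorelFun
  rw [← h2]

theorem WBounded.memLinf {h : G → ℂ} (hh : WBounded ω h) : MemLinf ω h :=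
  ⟨borelFun_iff.2 hh.measurable, hh.bound.imp fun _ hC => Eventually.of_forall hC⟩

theorem WBounded.add {h k : G → ℂ} (hh : WBounded ω h) (hk : WBounded ω k) :
    WBounded ω fun x => h x + k x := by
  obtain ⟨C, hC⟩ := hh.bound
  obtain ⟨D, hD⟩ := hk.bound
  refine ⟨hh.measurable.add hk.measurable, C + D, fun x => ?_⟩
  rw [add_mul]
  exact norm_add_le_of_le (hC x) (hD x)

theorem WBounded.const_mul {h : G → ℂ} (hh : WBounded ω h) (c : ℂ) :
    WBounded ω fun x => c * h x := by
  obtain ⟨C, hC⟩ := hh.bound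
  refine ⟨hh.measurable.const_mul c, ‖c‖ * C, fun x => ?_⟩
  rw [norm_mul, mul_assoc]
  exact mul_le_mul_of_nonneg_left (hC x) (norm_nonneg _)

theorem WBounded.sub {h k : G → ℂ} (hh : WBounded ω h) (hk : WBounded ω k) :
    WBounded ω fun x => h x - k x := by
  have := hh.add (hk.const_mul (-1))
  simpa [sub_eq_add_neg] using this

theorem WBounded.comp_mul_left {h : G → ℂ} (hh : WBounded ω h) (y : G) :
    WBounded ω fun x => h (y * x) := by
  obtain ⟨C, hC0, hC⟩ := hh.exists_nonneg
  refine ⟨hh.measurable.comp (continuous_const_mul y).measurable, C * ω y, fun x => ?_⟩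
  rw [mul_assoc]
  exact (hC _).trans (mul_le_mul_of_nonneg_left (ω.mul_le' y x) hC0)

theorem WBounded.comp_mul_right {h : G → ℂ} (hh : WBounded ω h) (y : G) :
    WBounded ω fun x => h (x * y) := by
  obtain ⟨C, hC0, hC⟩ := hh.exists_nonneg
  refine ⟨hh.measurable.comp (continuous_mul_const y).measurable, C * ω y, fun x => ?_⟩
  rw [mul_assoc, mul_comm (ω y)]
  exact (hC _).trans (mul_le_mul_of_nonneg_left (ω.mul_le' x y) hC0)

/-- The function is cut off to zero on the Borel, locally null set where the bound fails. -/
theorem exists_bounded_rep {h : G → ℂ} (hm : Measurable h) {C : ℝ} (hC0 : 0 ≤ C)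
    (hC : ∀ᶠ x in locallyAE G, ‖h x‖ ≤ C * ω x) :
    ∃ k, Measurable k ∧ (∀ x, ‖k x‖ ≤ C * ω x) ∧ h =ᶠ[locallyAE G] k := by
  have hs : MeasurableSet {x | ‖h x‖ ≤ C * ω x} :=
    measurableSet_le hm.norm (ω.continuous'.measurable.const_mul C)
  refine ⟨{x | ‖h x‖ ≤ C * ω x}.indicator h, hm.indicator hs, fun x => ?_, ?_⟩
  · by_cases hx : x ∈ {x | ‖h x‖ ≤ C * ω x}
    · rw [Set.indicator_of_mem hx]
      exact hx
    · rw [Set.indicator_of_notMem hx, norm_zero]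
      exact mul_nonneg hC0 (ω.pos x).le
  · filter_upwards [hC] with x hx
    rw [Set.indicator_of_mem]
    exact hx

/-- Every element of `L^∞(G, 1/ω)` has an everywhere bounded representative. -/
theorem MemLinf.exists_wBounded {h : G → ℂ} (hh : MemLinf ω h) :
    ∃ k, WBounded ω k ∧ h =ᶠ[locallyAE G] k := by
  obtain ⟨hm, C, hC⟩ := hh
  obtain ⟨k, hk, hkb, he⟩ := exists_bounded_rep (borelFun_iff.1 hm) (le_max_right C 0)
    (hC.mono fun x hx => hx.trans (mul_le_mul_of_nonneg_right (le_max_left _ _) (ω.pos x).le))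
  exact ⟨k, ⟨hk, _, hkb⟩, he⟩

/-- The bilinear form `∫ f(x) h(x) dx`. -/
noncomputable def pair (h : G → ℂ) (f : L1 ω) : ℂ :=
  ∫ x, f x * h x ∂(Measure.haar : Measure G)

theorem toDual_mk {h : G → ℂ} (hh : MemLinf ω h) (f : L1 ω) :
    toDual ω (Linf.mk ω h hh) f = pair h f := pairing_eq (Linf.coe_mk ω hh) f

theorem toDual_eq_pair {h : Linf ω} {k : G → ℂ} (e : h.rep =ᶠ[locallyAE G] k) (f : L1 ω) :
    toDual ω h f = pair k f := pairing_eq e f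

theorem pair_congr {h k : G → ℂ} (e : h =ᶠ[locallyAE G] k) (f : L1 ω) :
    pair h f = pair k f := by
  refine integral_congr_ae ?_
  filter_upwards [f.ae_of_locallyAE e] with x hx
  rcases eq_or_ne (f x) 0 with h0 | h0
  · simp [h0]
  · rw [hx h0]

theorem L1.aestronglyMeasurable (f : L1 ω) :
    AEStronglyMeasurable f.rep (Measure.haar : Measure G) := by
  have hω := (memLp_iff ω f).1 f.memLp
  have hne : ∀ x, (ω x : ℂ) ≠ 0 := fun x => by exact_mod_cast (ω.pos x).ne'
  have hi : Continuous fun x => (ω x : ℂ)⁻¹ :=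
    (Complex.continuous_ofReal.comp ω.continuous').inv₀ hne
  refine (hi.measurable.aestronglyMeasurable.mul hω.1).congr (Eventually.of_forall fun x => ?_)
  simp [inv_mul_cancel_left₀ (hne x)]

theorem L1.integrable_weight_mul_norm (f : L1 ω) :
    Integrable (fun y => ω y * ‖f y‖) (Measure.haar : Measure G) := by
  refine ((memLp_iff ω f).1 f.memLp).norm.congr (Eventually.of_forall fun y => ?_)
  simp [abs_of_pos (ω.pos y)]

theorem WBounded.integrable_mul {h : G → ℂ} (hh : WBounded ω h) (f : L1 ω) :
    Integrable (fun x => f x * h x) (Measure.haar : Measure G) := by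
  obtain ⟨C, hC⟩ := hh.bound
  refine (f.integrable_weight_mul_norm.const_mul C).mono'
    (f.aestronglyMeasurable.mul hh.measurable.aestronglyMeasurable)
    (Eventually.of_forall fun x => ?_)
  rw [norm_mul]
  nlinarith [hC x, norm_nonneg (f x)]

theorem norm_pair_le {h : G → ℂ} {C : ℝ} (hC : ∀ x, ‖h x‖ ≤ C * ω x) (f : L1 ω) :
    ‖pair h f‖ ≤ C * ‖f‖ := by
  rw [L1.norm_eq_integral, ← integral_const_mul]
  refine norm_integral_le_of_norm_le (f.integrable_weight_mul_norm.const_mul C)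
    (Eventually.of_forall fun x => ?_)
  rw [norm_mul]
  nlinarith [hC x, norm_nonneg (f x)]

theorem pair_add {h : G → ℂ} (hh : WBounded ω h) (f g : L1 ω) :
    pair h (f + g) = pair h f + pair h g := by
  rw [← toDual_mk hh.memLinf, ← toDual_mk hh.memLinf, ← toDual_mk hh.memLinf, map_add]

theorem pair_smul {h : G → ℂ} (hh : WBounded ω h) (c : ℂ) (f : L1 ω) :
    pair h (c • f) = c * pair h f := by
  rw [← toDual_mk hh.memLinf, ← toDual_mk hh.memLinf, map_smul, smul_eq_mul]

theorem sub_pair {h k : G → ℂ} (hh : WBounded ω h) (hk : WBounded ω k) (f : L1 ω) :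
    pair (fun x => h x - k x) f = pair h f - pair k f := by
  unfold pair
  rw [← integral_sub (hh.integrable_mul f) (hk.integrable_mul f)]
  simp only [mul_sub]

theorem const_mul_pair (c : ℂ) (h : G → ℂ) (f : L1 ω) :
    pair (fun x => c * h x) f = c * pair h f := by
  unfold pair
  rw [← integral_const_mul]
  simp only [mul_left_comm]

theorem pair_translate (h : G → ℂ) (y : G) (g : L1 ω) :
    pair h (translate ω y g) = pair (fun x => h (y * x)) g := by
  unfold pair
  have e := coe_translate ω y g
  rw [EventuallyEq, ae_wMeasure] at e
  rw [integral_congr_ae (g := fun x => g (y⁻¹ * x) * h x)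
    (by filter_upwards [e] with x hx; rw [hx]),
    ← integral_mul_left_eq_self (fun x => g (y⁻¹ * x) * h x) y]
  simp only [inv_mul_cancel_left]

/-- A bounded functional passes inside the Bochner integral that defines convolution. -/
theorem apply_mul_eq (z : StrongDual ℂ (L1 ω)) (f g : L1 ω) :
    z (f * g) = pair (fun y => z (translate ω y g)) f := by
  have h1 : f * g = ∫ y, f y • translate ω y g ∂(Measure.haar : Measure G) := rfl
  rw [h1, ← ContinuousLinearMap.integral_comp_comm _ (integrable_smul_translate ω f g)]
  simp only [map_smul, smul_eq_mul, pair]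

/-- The pairing with a convolution product. -/
theorem pair_mul {h : G → ℂ} (hh : WBounded ω h) (f g : L1 ω) :
    pair h (f * g) = pair (fun y => pair (fun x => h (y * x)) g) f := by
  rw [← toDual_mk hh.memLinf, apply_mul_eq]
  simp only [toDual_mk, pair_translate]

end Pair

/-! ### Elementary tensors and Fubini for weighted functions -/

section Tensor

variable {G H : Type*} [Group G] [TopologicalSpace G] [IsTopologicalGroup G]
  [LocallyCompactSpace G] [T2Space G] [MeasurableSpace G] [BorelSpace G]
  [Group H] [TopologicalSpace H] [IsTopologicalGroup H]
  [LocallyCompactSpace H] [T2Space H] [MeasurableSpace H] [BorelSpace H]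
  {ω : Weight G} {ω' : Weight H}

/-- The product weight `(x, y) ↦ ω(x) ω'(y)`. -/
def Weight.prod {G H : Type*} [Group G] [TopologicalSpace G] [Group H] [TopologicalSpace H]
    (ω : Weight G) (ω' : Weight H) : Weight (BProd G H) where
  toFun p := ω p.fst * ω' p.snd
  continuous' := (ω.continuous'.comp BProd.continuous_fst).mul
    (ω'.continuous'.comp BProd.continuous_snd)
  one_le' p := one_le_mul_of_one_le_of_one_le (ω.one_le' _) (ω'.one_le' _)
  mul_le' p q := by
    refine (mul_le_mul (ω.mul_le' p.fst q.fst) (ω'.mul_le' p.snd q.snd) (ω'.pos _).le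
      (mul_pos (ω.pos _) (ω.pos _)).le).trans (le_of_eq ?_)
    ring
  map_one' := by
    change ω 1 * ω' 1 = 1
    rw [ω.map_one', ω'.map_one', one_mul]

theorem Weight.prod_mk (x : G) (y : H) : ω.prod ω' (BProd.mk x y) = ω x * ω' y := rfl

/-- Elements of `L^1(G, ω)` have Borel representatives living on a countable union of compact
sets. -/
theorem L1.exists_measurable_rep (f : L1 ω) : ∃ f₀ : G → ℂ, Measurable f₀ ∧
    f.rep =ᵐ[Measure.haar] f₀ ∧ ∃ S, CompactlyCovered S ∧ ∀ x, x ∉ S → f₀ x = 0 := by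
  obtain ⟨k, -, hks, hk⟩ := exists_seq_compactSupport ((memLp_iff ω f).1 f.memLp)
  have hS : MeasurableSet (⋃ n, tsupport (k n)) :=
    MeasurableSet.iUnion fun n => (isClosed_tsupport _).measurableSet
  have hf : Measurable f.rep := (Lp.stronglyMeasurable (show Lp ℂ 1 (wMeasure ω) from f)).measurable
  refine ⟨(⋃ n, tsupport (k n)).indicator f.rep, hf.indicator hS, ?_, ⋃ n, tsupport (k n),
    ⟨hS, fun n => tsupport (k n), hks, le_rfl⟩, fun x hx => Set.indicator_of_notMem hx _⟩
  filter_upwards [hk] with x hx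
  by_cases h : x ∈ ⋃ n, tsupport (k n)
  · rw [Set.indicator_of_mem h]
  · rw [Set.indicator_of_notMem h]
    -- Outside the supports every approximant is zero, hence so is the limit.
    have h0 : ∀ n, k n x = 0 := fun n => by
      by_contra hn
      exact h (Set.mem_iUnion.2 ⟨n, subset_tsupport _ hn⟩)
    simp only [h0] at hx
    have hne : (ω x : ℂ) ≠ 0 := by exact_mod_cast (ω.pos x).ne'
    exact (mul_eq_zero.1 (tendsto_nhds_unique hx tendsto_const_nhds)).resolve_left hne

/-- A Borel representative living on a countable union of compact sets. -/
noncomputable def L1.brep (f : L1 ω) : G → ℂ := f.exists_measurable_rep.choose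

theorem L1.measurable_brep (f : L1 ω) : Measurable f.brep :=
  f.exists_measurable_rep.choose_spec.1

theorem L1.ae_eq_brep (f : L1 ω) : f.rep =ᵐ[Measure.haar] f.brep :=
  f.exists_measurable_rep.choose_spec.2.1

theorem L1.exists_brep_support (f : L1 ω) :
    ∃ S, CompactlyCovered S ∧ ∀ x, x ∉ S → f.brep x = 0 :=
  f.exists_measurable_rep.choose_spec.2.2

theorem L1.pair_eq_brep (f : L1 ω) (h : G → ℂ) :
    pair h f = ∫ x, f.brep x * h x ∂Measure.haar := by
  refine integral_congr_ae ?_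
  filter_upwards [f.ae_eq_brep] with x hx
  rw [hx]

theorem L1.integrable_brep (f : L1 ω) :
    Integrable (fun x => (ω x : ℂ) * f.brep x) (Measure.haar : Measure G) := by
  refine ((memLp_iff ω f).1 f.memLp).congr ?_
  filter_upwards [f.ae_eq_brep] with x hx
  rw [hx]

theorem memLp_tensor (f : L1 ω) (g : L1 ω') :
    MemLp (fun p : BProd G H => f.brep p.fst * g.brep p.snd) 1 (wMeasure (ω.prod ω')) := by
  obtain ⟨S, hS, hfS⟩ := f.exists_brep_support
  obtain ⟨T, hT, hgT⟩ := g.exists_brep_support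
  have hm : Measurable fun p : BProd G H => ((ω.prod ω' p : ℝ) : ℂ) *
      (f.brep p.fst * g.brep p.snd) :=
    (Complex.measurable_ofReal.comp (ω.prod ω').continuous'.measurable).mul
      ((f.measurable_brep.comp BProd.measurable_fst).mul
        (g.measurable_brep.comp BProd.measurable_snd))
  rw [memLp_iff]
  refine ⟨hm.aestronglyMeasurable, ?_⟩
  rw [hasFiniteIntegral_iff_enorm, lintegral_haar_bprod hS hT hm.enorm]
  · have e : ∀ (x : G) (y : H), ‖((ω.prod ω' (BProd.mk x y) : ℝ) : ℂ) *
        (f.brep (BProd.mk x y).fst * g.brep (BProd.mk x y).snd)‖ₑ =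
        ‖(ω x : ℂ) * f.brep x‖ₑ * ‖(ω' y : ℂ) * g.brep y‖ₑ := fun x y => by
      rw [← enorm_mul, Weight.prod_mk, BProd.fst_mk, BProd.snd_mk]
      push_cast
      congr 1
      ring
    simp only [e]
    have hf := f.integrable_brep
    have hg := g.integrable_brep
    simp_rw [lintegral_const_mul'' _ hg.1.enorm]
    rw [lintegral_mul_const'' _ hf.1.enorm]
    exact ENNReal.mul_lt_top ENNReal.coe_lt_top (ENNReal.mul_lt_top hf.2 hg.2)
  · intro p hp
    rw [mem_rect, not_and_or] at hp
    rcases hp with hp | hp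
    · simp [hfS _ hp]
    · simp [hgT _ hp]

/-- The tensor product `(f ⊗ g)(x, y) = f(x) g(y)`. -/
noncomputable def tensor (f : L1 ω) (g : L1 ω') : L1 (ω.prod ω') :=
  L1.mk (ω.prod ω') _ (memLp_tensor f g)

theorem coe_tensor (f : L1 ω) (g : L1 ω') : (tensor f g).rep =ᵐ[Measure.haar]
    fun p : BProd G H => f.brep p.fst * g.brep p.snd := by
  have h := L1.coe_mk (ω.prod ω') (memLp_tensor f g)
  rwa [EventuallyEq, ae_wMeasure] at h

theorem pair_tensor_eq_integral (P : BProd G H → ℂ) (f : L1 ω) (g : L1 ω') :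
    pair P (tensor f g) = ∫ p, f.brep p.fst * g.brep p.snd * P p ∂Measure.haar := by
  refine integral_congr_ae ?_
  filter_upwards [coe_tensor f g] with p hp
  rw [hp]

theorem integrable_tensor_mul {P : BProd G H → ℂ} (hP : WBounded (ω.prod ω') P) (f : L1 ω)
    (g : L1 ω') : Integrable (fun p => f.brep p.fst * g.brep p.snd * P p)
      (Measure.haar : Measure (BProd G H)) := by
  refine (hP.integrable_mul (tensor f g)).congr ?_
  filter_upwards [coe_tensor f g] with p hp
  rw [hp]

theorem measurable_tensor_mul {P : BProd G H → ℂ} (hP : Measurable P) (f : L1 ω)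
    (g : L1 ω') : Measurable (fun p : BProd G H => f.brep p.fst * g.brep p.snd * P p) :=
  ((f.measurable_brep.comp BProd.measurable_fst).mul
    (g.measurable_brep.comp BProd.measurable_snd)).mul hP

theorem WBounded.section {P : BProd G H → ℂ} (hP : WBounded (ω.prod ω') P) (x : G) :
    WBounded ω' fun y => P (BProd.mk x y) := by
  obtain ⟨C, hC⟩ := hP.bound
  exact ⟨hP.measurable.comp (BProd.measurable_mk_left x), C * ω x, fun y =>
    (hC _).trans (le_of_eq (by rw [Weight.prod_mk, mul_assoc]))⟩

theorem WBounded.comp_swap {P : BProd G H → ℂ} (hP : WBounded (ω.prod ω') P) :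
    WBounded (ω'.prod ω) fun q => P (BProd.swap q) := by
  obtain ⟨C, hC⟩ := hP.bound
  refine ⟨hP.measurable.comp BProd.swap.continuous.measurable, C, fun q => ?_⟩
  refine (hC _).trans (le_of_eq ?_)
  change C * (ω q.snd * ω' q.fst) = C * (ω' q.fst * ω q.snd)
  rw [mul_comm (ω q.snd)]

/-- Integrating out the second variable. -/
theorem WBounded.pair_section {P : BProd G H → ℂ} (hP : WBounded (ω.prod ω') P) (g : L1 ω') :
    WBounded ω fun x => pair (fun y => P (BProd.mk x y)) g := by
  obtain ⟨C, hC⟩ := hP.bound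
  refine ⟨?_, C * ‖g‖, fun x => ?_⟩
  · obtain ⟨T, hT, hgT⟩ := g.exists_brep_support
    simp only [L1.pair_eq_brep]
    exact measurable_integral_section hT (F := fun p : BProd G H => g.brep p.snd * P p)
      ((g.measurable_brep.comp BProd.measurable_snd).mul hP.measurable)
      (fun x y hy => by simp [hgT y hy])
  · refine (norm_pair_le (C := C * ω x) (fun y => ?_) g).trans (le_of_eq (by ring))
    exact (hC _).trans (le_of_eq (by rw [Weight.prod_mk, mul_assoc]))

theorem WBounded.pair_section_left {P : BProd G H → ℂ} (hP : WBounded (ω.prod ω') P) (f : L1 ω) :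
    WBounded ω' fun y => pair (fun x => P (BProd.mk x y)) f := hP.comp_swap.pair_section f

/-- Iterated integration against a tensor product. -/
theorem pair_tensor {P : BProd G H → ℂ} (hP : WBounded (ω.prod ω') P) (f : L1 ω) (g : L1 ω') :
    pair P (tensor f g) =
      productConst G H * pair (fun x => pair (fun y => P (BProd.mk x y)) g) f := by
  obtain ⟨S, hS, hfS⟩ := f.exists_brep_support
  obtain ⟨T, hT, hgT⟩ := g.exists_brep_support
  rw [pair_tensor_eq_integral, integral_haar_bprod hS hT (measurable_tensor_mul hP.measurable f g)
    (integrable_tensor_mul hP f g)]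
  · simp only [L1.pair_eq_brep, ← integral_const_mul, BProd.fst_mk, BProd.snd_mk, mul_assoc]
  · intro p hp
    rw [mem_rect, not_and_or] at hp
    rcases hp with hp | hp
    · simp [hfS _ hp]
    · simp [hgT _ hp]

/-- Iterated integration against a tensor product, in the other order. -/
theorem pair_tensor' {P : BProd G H → ℂ} (hP : WBounded (ω.prod ω') P) (f : L1 ω) (g : L1 ω') :
    pair P (tensor f g) =
      productConst G H * pair (fun y => pair (fun x => P (BProd.mk x y)) f) g := by
  obtain ⟨S, hS, hfS⟩ := f.exists_brep_support
  obtain ⟨T, hT, hgT⟩ := g.exists_brep_support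
  rw [pair_tensor_eq_integral, integral_haar_bprod_swap hS hT
    (measurable_tensor_mul hP.measurable f g) (integrable_tensor_mul hP f g)]
  · simp only [L1.pair_eq_brep, ← integral_const_mul, BProd.fst_mk, BProd.snd_mk, mul_assoc,
      mul_left_comm (g.brep _)]
  · intro p hp
    rw [mem_rect, not_and_or] at hp
    rcases hp with hp | hp
    · simp [hfS _ hp]
    · simp [hgT _ hp]

/-- Fubini's theorem for Borel functions on the product. -/
theorem pair_pair_comm {P : BProd G H → ℂ} (hP : WBounded (ω.prod ω') P) (f : L1 ω) (g : L1 ω') :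
    pair (fun x => pair (fun y => P (BProd.mk x y)) g) f =
      pair (fun y => pair (fun x => P (BProd.mk x y)) f) g := by
  have hc : (productConst G H : ℂ) ≠ 0 := by exact_mod_cast (productConst_pos G H).ne'
  -- Both orders of integration carry the same nonzero constant.
  exact mul_left_cancel₀ hc ((pair_tensor hP f g).symm.trans (pair_tensor' hP f g))

end Tensor

/-! ### The kernel h(xy) - h(yx) -/

section Mul

variable {G : Type*} [Group G] [TopologicalSpace G] [IsTopologicalGroup G]
  [LocallyCompactSpace G] [T2Space G] [MeasurableSpace G] [BorelSpace G] {ω : Weight G}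

theorem WBounded.comp_mul {h : G → ℂ} (hh : WBounded ω h) :
    WBounded (ω.prod ω) fun p : BProd G G => h (p.fst * p.snd) := by
  obtain ⟨C, hC0, hC⟩ := hh.exists_nonneg
  exact ⟨hh.measurable.comp (BProd.continuous_fst.mul BProd.continuous_snd).measurable, C,
    fun p => (hC _).trans (mul_le_mul_of_nonneg_left (ω.mul_le' _ _) hC0)⟩

theorem WBounded.comp_mul_swap {h : G → ℂ} (hh : WBounded ω h) :
    WBounded (ω.prod ω) fun p : BProd G G => h (p.snd * p.fst) := hh.comp_mul.comp_swap

theorem WBounded.pair_mul_left {h : G → ℂ} (hh : WBounded ω h) (f : L1 ω) :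
    WBounded ω fun x => pair (fun y => h (y * x)) f := hh.comp_mul.pair_section_left f

theorem WBounded.pair_mul_right {h : G → ℂ} (hh : WBounded ω h) (f : L1 ω) :
    WBounded ω fun x => pair (fun y => h (x * y)) f := hh.comp_mul.pair_section f

/-- The pairing with a convolution product, integrating the first factor first. -/
theorem pair_mul' {h : G → ℂ} (hh : WBounded ω h) (f g : L1 ω) :
    pair h (f * g) = pair (fun x => pair (fun y => h (y * x)) f) g :=
  (pair_mul hh f g).trans (pair_pair_comm hh.comp_mul f g)

/-- The kernel form of the inner derivation given by `h`. -/
theorem integral_integral_kernel {h : G → ℂ} (hh : WBounded ω h) (f g : L1 ω) :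
    ∫ y, ∫ x, f x * g y * (h (x * y) - h (y * x)) ∂(Measure.haar : Measure G)
      ∂(Measure.haar : Measure G) = pair h (f * g) - pair h (g * f) := by
  -- Each convolution is expanded with the variable of g outermost, so that the difference can be
  -- taken under the outer integral.
  rw [pair_mul' hh f g, pair_mul hh g f, ← sub_pair (hh.pair_mul_left f) (hh.pair_mul_right f)]
  refine integral_congr_ae (Eventually.of_forall fun y => ?_)
  simp only
  rw [← sub_pair (hh.comp_mul_right y) (hh.comp_mul_left y), pair, ← integral_const_mul]
  refine integral_congr_ae (Eventually.of_forall fun x => ?_)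
  simp only
  ring

end Mul

/-! ### The dual of L¹ of a finite measure -/

section FiniteDuality

variable {X : Type*} [MeasurableSpace X] {m : Measure X}

/-- A function whose integrals against bounded functions are dominated by those of `W` is
dominated by `W`. -/
theorem ae_norm_le_of_norm_integral_mul_le {v : X → ℂ} {W : X → ℝ} (hv : Measurable v)
    (hW : Measurable W) (hvi : Integrable v m) (hWi : Integrable W m)
    (h : ∀ u : X → ℂ, Measurable u → (∀ x, ‖u x‖ ≤ 1) →
      ‖∫ x, u x * v x ∂m‖ ≤ ∫ x, ‖u x‖ * W x ∂m) (hW0 : ∀ x, 0 ≤ W x) :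
    ∀ᵐ x ∂m, ‖v x‖ ≤ W x := by
  set E : Set X := {x | W x < ‖v x‖} with hE
  have hEm : MeasurableSet E := measurableSet_lt hW hv.norm
  have hne : ∀ x ∈ E, (‖v x‖ : ℂ) ≠ 0 := fun x hx => by
    exact_mod_cast ((hW0 x).trans_lt hx).ne'
  -- The test function rotates v to |v| on the bad set E and vanishes elsewhere.
  let u : X → ℂ := E.indicator fun x => (starRingEnd ℂ) (v x) / (‖v x‖ : ℂ)
  have hum : Measurable u :=
    ((Complex.continuous_conj.measurable.comp hv).div
      (Complex.measurable_ofReal.comp hv.norm)).indicator hEm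
  have hun : ∀ x, ‖u x‖ = E.indicator (fun _ => (1 : ℝ)) x := fun x => by
    by_cases hx : x ∈ E
    · simp only [u, Set.indicator_of_mem hx]
      rw [norm_div, RCLike.norm_conj, Complex.norm_real, norm_norm, div_self]
      exact_mod_cast hne x hx
    · simp [u, Set.indicator_of_notMem hx]
  have huv : ∀ x, u x * v x = E.indicator (fun x => (‖v x‖ : ℂ)) x := fun x => by
    by_cases hx : x ∈ E
    · simp only [u, Set.indicator_of_mem hx]
      rw [div_mul_eq_mul_div, Complex.conj_mul', sq, mul_div_assoc, div_self (hne x hx), mul_one]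
    · simp [u, Set.indicator_of_notMem hx]
  have h1 := h u hum fun x => by
    rw [hun]
    exact Set.indicator_le' (fun _ _ => le_rfl) (fun _ _ => zero_le_one) x
  have h2 : ∀ x, ‖u x‖ * W x = E.indicator W x := fun x => by
    rw [hun]
    by_cases hx : x ∈ E <;> simp [hx]
  simp only [huv, h2] at h1
  rw [integral_indicator hEm, integral_indicator hEm, integral_complex_ofReal, Complex.norm_real,
    Real.norm_eq_abs] at h1
  replace h1 := (le_abs_self _).trans h1
  -- The integrand is positive on E by definition of E, while the test makes the integral
  -- nonpositive; hence E is null.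
  have h3 : ∫ x in E, (‖v x‖ - W x) ∂m = 0 := by
    refine le_antisymm ?_ (setIntegral_nonneg hEm fun x hx => sub_nonneg.2 (le_of_lt hx))
    rw [integral_sub hvi.norm.restrict hWi.restrict]
    linarith
  have h4 := (setIntegral_eq_zero_iff_of_nonneg_ae
    ((ae_restrict_iff' hEm).2 (Eventually.of_forall fun x (hx : x ∈ E) =>
      sub_nonneg.2 (le_of_lt hx))) (hvi.norm.restrict.sub hWi.restrict)).1 h3
  rw [EventuallyEq, ae_restrict_iff' hEm] at h4
  filter_upwards [h4] with x hx
  by_contra hlt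
  have hxE : x ∈ E := not_le.1 hlt
  have := hx hxE
  simp only [Pi.zero_apply] at this
  exact absurd this (sub_pos.2 hxE).ne'

/-- For a finite measure `m`, the inclusion of `L²(m)` into `L¹(m)`. -/
theorem exists_lp_inclusion (m : Measure X) [IsFiniteMeasure m] :
    ∃ ι : Lp ℂ 2 m →L[ℂ] Lp ℂ 1 m, ∀ u, ι u =ᵐ[m] u := by
  have hmem : ∀ u : Lp ℂ 2 m, MemLp u 1 m := fun u =>
    (Lp.memLp u).mono_exponent (by norm_num)
  let L : Lp ℂ 2 m →ₗ[ℂ] Lp ℂ 1 m :=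
    { toFun := fun u => (hmem u).toLp u
      map_add' := fun u v => by
        rw [← MemLp.toLp_add]
        exact MemLp.toLp_congr _ _ (Lp.coeFn_add u v)
      map_smul' := fun c u => by
        rw [RingHom.id_apply, ← MemLp.toLp_const_smul]
        exact MemLp.toLp_congr _ _ (Lp.coeFn_smul c u) }
  -- The constant of the Cauchy–Schwarz inequality, m(X) to the power 1/2, with the exponent written
  -- as 1/p - 1/q.
  refine ⟨L.mkContinuous ((m Set.univ) ^ (1 - 1 / 2 : ℝ)).toReal fun u => ?_, fun u =>
    (hmem u).coeFn_toLp⟩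
  change ‖(hmem u).toLp u‖ ≤ _
  rw [Lp.norm_toLp, Lp.norm_def, ← ENNReal.toReal_mul]
  refine ENNReal.toReal_mono (ENNReal.mul_ne_top (ENNReal.rpow_ne_top_of_nonneg (by norm_num)
    (measure_ne_top _ _)) (Lp.eLpNorm_ne_top u)) ?_
  have := eLpNorm_le_eLpNorm_mul_rpow_measure_univ (μ := m) (p := 1) (q := 2) (by norm_num)
    (Lp.aestronglyMeasurable u)
  rw [mul_comm]
  convert this using 3
  norm_num

/-- Bounded functionals on `L¹` of a finite measure are given by bounded functions. -/
theorem exists_density_of_isFiniteMeasure (m : Measure X) [IsFiniteMeasure m]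
    (z : StrongDual ℂ (Lp ℂ 1 m)) :
    ∃ v : X → ℂ, Measurable v ∧ (∀ x, ‖v x‖ ≤ ‖z‖) ∧ ∀ u : Lp ℂ 1 m, z u = ∫ x, u x * v x ∂m := by
  obtain ⟨ι, hι⟩ := exists_lp_inclusion m
  -- The functional, restricted to the Hilbert space L², is represented by a vector; its conjugate
  -- is the candidate density.
  let w : Lp ℂ 2 m := (InnerProductSpace.toDual ℂ (Lp ℂ 2 m)).symm (z.comp ι)
  have hw : ∀ u : Lp ℂ 2 m, z (ι u) = ∫ x, u x * (starRingEnd ℂ) (w x) ∂m := fun u => by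
    have h := InnerProductSpace.toDual_symm_apply (𝕜 := ℂ) (x := u) (y := z.comp ι)
    change inner ℂ w u = z (ι u) at h
    rw [← h, L2.inner_def]
    rfl
  let v₀ : X → ℂ := fun x => (starRingEnd ℂ) (w x)
  have hv₀ : Measurable v₀ :=
    Complex.continuous_conj.measurable.comp (Lp.stronglyMeasurable w).measurable
  have hv₀i : Integrable v₀ m := by
    have hw1 : Integrable w m := memLp_one_iff_integrable.1
      ((Lp.memLp w).mono_exponent (by norm_num))
    refine hw1.norm.mono' hv₀.aestronglyMeasurable (Eventually.of_forall fun x => ?_)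
    simp [v₀]
  have key : ∀ u : X → ℂ, Measurable u → ∀ C : ℝ, (∀ x, ‖u x‖ ≤ C) → ∃ hu : MemLp u 1 m,
      z (hu.toLp u) = ∫ x, u x * v₀ x ∂m := fun u hum C huC => by
    have h2 : MemLp u 2 m := MemLp.of_bound hum.aestronglyMeasurable C (Eventually.of_forall huC)
    have h1 : MemLp u 1 m := MemLp.of_bound hum.aestronglyMeasurable C (Eventually.of_forall huC)
    refine ⟨h1, ?_⟩
    have e : ι (h2.toLp u) = h1.toLp u := by
      refine Lp.ext ?_
      filter_upwards [hι (h2.toLp u), h2.coeFn_toLp, h1.coeFn_toLp] with x e1 e2 e3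
      rw [e1, e2, e3]
    rw [← e, hw]
    refine integral_congr_ae ?_
    filter_upwards [h2.coeFn_toLp] with x e2
    rw [e2]
  -- On bounded u, |∫ u v₀| = |z(u)| ≤ ‖z‖ ∫ |u|, which is the domination hypothesis for the
  -- constant ‖z‖.
  have hb : ∀ᵐ x ∂m, ‖v₀ x‖ ≤ ‖z‖ := by
    refine ae_norm_le_of_norm_integral_mul_le (W := fun _ => ‖z‖) hv₀ measurable_const hv₀i
      (integrable_const _) (fun u hu hu1 => ?_) fun _ => norm_nonneg z
    obtain ⟨h1, h2⟩ := key u hu 1 hu1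
    rw [← h2, integral_mul_const, mul_comm]
    refine (z.le_opNorm _).trans (le_of_eq ?_)
    rw [Lp.norm_toLp, eLpNorm_one_eq_lintegral_enorm, integral_norm_eq_lintegral_enorm h1.1]
  have hE : MeasurableSet {x | ‖v₀ x‖ ≤ ‖z‖} := measurableSet_le hv₀.norm measurable_const
  let v : X → ℂ := {x | ‖v₀ x‖ ≤ ‖z‖}.indicator v₀
  have hvb : ∀ x, ‖v x‖ ≤ ‖z‖ := fun x => by
    by_cases hx : x ∈ {x | ‖v₀ x‖ ≤ ‖z‖}
    · rw [show v x = v₀ x from Set.indicator_of_mem hx v₀]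
      exact hx
    · simp only [v, Set.indicator_of_notMem hx, norm_zero, norm_nonneg]
  have hvv : v₀ =ᵐ[m] v := by
    filter_upwards [hb] with x hx
    exact (Set.indicator_of_mem (s := {x | ‖v₀ x‖ ≤ ‖z‖}) hx v₀).symm
  have hvm : Measurable v := hv₀.indicator hE
  have hint : ∀ u : Lp ℂ 1 m, Integrable (fun x => u x * v x) m := fun u =>
    (L1.integrable_coeFn u).mul_bdd hvm.aestronglyMeasurable (Eventually.of_forall hvb)
  refine ⟨v, hvm, hvb, fun u => ?_⟩
  have hcont : Continuous fun u : Lp ℂ 1 m => ∫ x, u x * v x ∂m := by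
    let M : Lp ℂ 1 m →ₗ[ℂ] ℂ :=
      { toFun := fun u => ∫ x, u x * v x ∂m
        map_add' := fun f g => by
          rw [← integral_add (hint f) (hint g)]
          refine integral_congr_ae ?_
          filter_upwards [Lp.coeFn_add f g] with x hx
          rw [hx, Pi.add_apply, add_mul]
        map_smul' := fun c f => by
          rw [RingHom.id_apply, smul_eq_mul, ← integral_const_mul]
          refine integral_congr_ae ?_
          filter_upwards [Lp.coeFn_smul c f] with x hx
          rw [hx, Pi.smul_apply, smul_eq_mul, mul_assoc] }
    refine (M.mkContinuous ‖z‖ fun f => ?_).continuous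
    rw [L1.norm_eq_integral_norm, ← integral_const_mul]
    refine norm_integral_le_of_norm_le ((L1.integrable_coeFn f).norm.const_mul _)
      (Eventually.of_forall fun x => ?_)
    rw [norm_mul, mul_comm]
    exact mul_le_mul_of_nonneg_right (hvb x) (norm_nonneg _)
  -- Both sides are continuous on L¹, so it is enough to compare them on indicators and disjoint
  -- sums.
  induction u using Lp.induction ENNReal.one_ne_top with
  | indicatorConst c hs hμs =>
    rename_i s
    obtain ⟨h1, h2⟩ := key (s.indicator fun _ => c) (measurable_const.indicator hs) ‖c‖
      (fun x => norm_indicator_le_norm_self (fun _ => c) x)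
    have e : ((Lp.simpleFunc.indicatorConst 1 hs hμs.ne c : Lp.simpleFunc ℂ 1 m) : Lp ℂ 1 m) =
        h1.toLp _ := by
      rw [Lp.simpleFunc.coe_indicatorConst]
      rfl
    rw [e, h2]
    refine integral_congr_ae ?_
    filter_upwards [hvv, h1.coeFn_toLp] with x e1 e2
    rw [e1, e2]
  | add hf hg hd h1 h2 =>
    rename_i f g
    rw [map_add, h1, h2, ← integral_add (hint _) (hint _)]
    refine integral_congr_ae ?_
    filter_upwards [Lp.coeFn_add (hf.toLp f) (hg.toLp g)] with x hx
    rw [hx, Pi.add_apply, add_mul]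
  | isClosed => exact isClosed_eq z.continuous hcont

end FiniteDuality

/-! ### Densities on countable unions of compact sets -/

section LocalDuality

variable {G : Type*} [Group G] [TopologicalSpace G] [IsTopologicalGroup G]
  [LocallyCompactSpace G] [T2Space G] [MeasurableSpace G] [BorelSpace G] {ω : Weight G}

/-- The norm of a functional bounds its density. -/
theorem WBounded.eventually_norm_le {h : G → ℂ} (hh : WBounded ω h) {M : ℝ} (hM : 0 ≤ M)
    (hp : ∀ f : L1 ω, ‖pair h f‖ ≤ M * ‖f‖) : ∀ᶠ x in locallyAE G, ‖h x‖ ≤ M * ω x := by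
  rw [eventually_locallyAE]
  intro K hK
  have hωi : IntegrableOn (fun x => ω x) K (Measure.haar : Measure G) :=
    ω.continuous'.continuousOn.integrableOn_compact hK
  have hhi : IntegrableOn h K (Measure.haar : Measure G) := by
    obtain ⟨C, hC⟩ := hh.bound
    exact (hωi.const_mul C).mono' hh.measurable.aestronglyMeasurable (Eventually.of_forall hC)
  refine ae_norm_le_of_norm_integral_mul_le (W := fun x => M * ω x) hh.measurable
    (ω.continuous'.measurable.const_mul M) hhi (hωi.const_mul M) (fun u hu hu1 => ?_)
    fun x => mul_nonneg hM (ω.pos x).le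
  -- Local almost everywhere statements are tested on one compact K, with a bounded function cut off
  -- outside it.
  have hum : MemLp (K.indicator u) 1 (wMeasure ω) := by
    have e : (fun x => (ω x : ℂ) * K.indicator u x) = K.indicator fun x => (ω x : ℂ) * u x := by
      ext x
      by_cases hx : x ∈ K <;> simp [hx]
    rw [memLp_iff, e, integrable_indicator_iff hK.measurableSet]
    refine hωi.mono' ((Complex.measurable_ofReal.comp ω.continuous'.measurable).mul
      hu).aestronglyMeasurable (Eventually.of_forall fun x => ?_)
    rw [norm_mul, Complex.norm_real, Real.norm_eq_abs, abs_of_pos (ω.pos x)]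
    exact mul_le_of_le_one_right (ω.pos x).le (hu1 x)
  have hc := L1.coe_mk ω hum
  rw [EventuallyEq, ae_wMeasure] at hc
  have h1 := hp (L1.mk ω _ hum)
  have e1 : pair h (L1.mk ω _ hum) = ∫ x in K, u x * h x ∂(Measure.haar : Measure G) := by
    rw [← integral_indicator hK.measurableSet]
    refine integral_congr_ae ?_
    filter_upwards [hc] with x hx
    rw [hx]
    by_cases hxK : x ∈ K <;> simp [hxK]
  have e2 : ‖L1.mk ω _ hum‖ = ∫ x in K, ‖u x‖ * ω x ∂(Measure.haar : Measure G) := by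
    rw [L1.norm_eq_integral, ← integral_indicator hK.measurableSet]
    refine integral_congr_ae ?_
    filter_upwards [hc] with x hx
    rw [hx]
    by_cases hxK : x ∈ K <;> simp [hxK, mul_comm]
  rw [e1, e2, ← integral_const_mul] at h1
  refine h1.trans (le_of_eq (integral_congr_ae (Eventually.of_forall fun x => ?_)))
  simp only
  ring

/-- A bounded function that annihilates `L^1(G, ω)` vanishes locally almost everywhere. -/
theorem WBounded.eventually_eq_zero {h : G → ℂ} (hh : WBounded ω h)
    (hp : ∀ f : L1 ω, pair h f = 0) : ∀ᶠ x in locallyAE G, h x = 0 := by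
  filter_upwards [hh.eventually_norm_le le_rfl fun f => by rw [hp f, norm_zero, zero_mul]]
    with x hx
  rw [zero_mul] at hx
  exact norm_le_zero_iff.1 hx

theorem CompactlyCovered.sigmaFinite {T : Set G} (hT : CompactlyCovered T) :
    SigmaFinite ((Measure.haar : Measure G).restrict T) := by
  obtain ⟨K, hK, hTK⟩ := hT.cover
  -- The complement of T is null for the restricted measure; adding it makes the pieces cover all of
  -- G.
  refine ⟨⟨⟨fun n => K n ∪ Tᶜ, fun _ => trivial, fun n => ?_, ?_⟩⟩⟩
  · rw [Measure.restrict_apply ((hK n).measurableSet.union hT.measurableSet.compl)]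
    refine (measure_mono ?_).trans_lt (hK n).measure_lt_top
    rintro x ⟨hx | hx, hxT⟩
    · exact hx
    · exact absurd hxT hx
  · refine Set.eq_univ_of_forall fun x => ?_
    by_cases hx : x ∈ T
    · obtain ⟨n, hn⟩ := Set.mem_iUnion.1 (hTK hx)
      exact Set.mem_iUnion.2 ⟨n, Or.inl hn⟩
    · exact Set.mem_iUnion.2 ⟨0, Or.inr hx⟩

/-- Bounded functionals on `L^1(G, ω)` have densities on countable unions of compact sets. -/
theorem exists_density_on {T : Set G} (hT : CompactlyCovered T) (z : StrongDual ℂ (L1 ω)) :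
    ∃ a b : G → ℂ, Integrable a (Measure.haar : Measure G) ∧
      Integrable b (Measure.haar : Measure G) ∧ (∀ x ∈ T, ‖a x / b x‖ ≤ ‖z‖) ∧
      ∀ f : L1 ω, (∀ᵐ x ∂(Measure.haar : Measure G), x ∉ T → f x = 0) →
        z f = ∫ x, f x * (ω x * (a x / b x)) ∂(Measure.haar : Measure G) := by
  have := hT.sigmaFinite
  -- A positive integrable θ on T gives the finite measure m = θ dx, with the same null sets in T as
  -- Haar measure.
  obtain ⟨θ, θpos, hθ, hθint⟩ := exists_pos_lintegral_lt_of_sigmaFinite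
    ((Measure.haar : Measure G).restrict T) one_ne_zero
  set m := ((Measure.haar : Measure G).restrict T).withDensity fun x => (θ x : ℝ≥0∞) with hm
  have hmfin : IsFiniteMeasure m := isFiniteMeasure_withDensity (hθint.trans ENNReal.one_lt_top).ne
  have hae : ∀ {p : G → Prop}, (∀ᵐ x ∂m, p x) → ∀ᵐ x ∂(Measure.haar : Measure G), x ∈ T → p x := by
    intro p hp
    rw [hm, ae_withDensity_iff hθ.coe_nnreal_ennreal, ae_restrict_iff' hT.measurableSet] at hp
    filter_upwards [hp] with x hx hxT
    exact hx hxT (by exact_mod_cast (θpos x).ne')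
  have hω0 : ∀ x, (ω x : ℂ) ≠ 0 := fun x => by exact_mod_cast (ω.pos x).ne'
  have hθ0 : ∀ x, ((θ x : ℝ) : ℂ) ≠ 0 := fun x => by exact_mod_cast (θpos x).ne'
  have hmem : ∀ u : Lp ℂ 1 m,
      MemLp (T.indicator fun x => ((θ x : ℝ) : ℂ) / ω x * u x) 1 (wMeasure ω) := fun u => by
    have e : (fun x => (ω x : ℂ) * T.indicator (fun x => ((θ x : ℝ) : ℂ) / ω x * u x) x) =
        T.indicator fun x => θ x • u x := by
      ext x
      by_cases hx : x ∈ T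
      · simp only [Set.indicator_of_mem hx, NNReal.smul_def, Complex.real_smul]
        field_simp [hω0 x]
      · simp [hx]
    rw [memLp_iff, e, integrable_indicator_iff hT.measurableSet, IntegrableOn,
      ← integrable_withDensity_iff_integrable_smul hθ]
    exact L1.integrable_coeFn u
  have hcoe : ∀ u, (L1.mk ω _ (hmem u)).rep =ᵐ[Measure.haar]
      T.indicator fun x => ((θ x : ℝ) : ℂ) / ω x * u x := fun u => by
    have h := L1.coe_mk ω (hmem u)
    rwa [EventuallyEq, ae_wMeasure] at h
  -- Multiplication by θ/ω maps L¹(m) isometrically onto the functions of L¹(G,ω) that vanish off T.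
  let J₀ : Lp ℂ 1 m →ₗ[ℂ] L1 ω :=
    { toFun := fun u => L1.mk ω _ (hmem u)
      map_add' := fun u v => by
        refine L1.ext ?_
        have h1 := L1.coe_add (L1.mk ω _ (hmem u)) (L1.mk ω _ (hmem v))
        rw [EventuallyEq, ae_wMeasure] at h1 ⊢
        filter_upwards [h1, hcoe u, hcoe v, hcoe (u + v), hae (Lp.coeFn_add u v)]
          with x h1 h2 h3 h4 h5
        rw [h1, h4, Pi.add_apply, h2, h3]
        by_cases hx : x ∈ T
        · simp only [Set.indicator_of_mem hx, h5 hx, Pi.add_apply, mul_add]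
        · simp [hx]
      map_smul' := fun c u => by
        refine L1.ext ?_
        have h1 := L1.coe_smul c (L1.mk ω _ (hmem u))
        rw [EventuallyEq, ae_wMeasure] at h1 ⊢
        filter_upwards [h1, hcoe u, hcoe (c • u), hae (Lp.coeFn_smul c u)] with x h1 h2 h4 h5
        rw [RingHom.id_apply, h1, h4, Pi.smul_apply, h2]
        by_cases hx : x ∈ T
        · simp only [Set.indicator_of_mem hx, h5 hx, Pi.smul_apply, smul_eq_mul]
          ring
        · simp [hx] }
  have hJ : ∀ u, ‖J₀ u‖ ≤ 1 * ‖u‖ := fun u => by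
    have hint : ∫ x, ‖u x‖ ∂m = ∫ x in T, θ x • ‖u x‖ ∂(Measure.haar : Measure G) :=
      integral_withDensity_eq_integral_smul hθ fun x => ‖u x‖
    rw [one_mul, L1.norm_eq_integral, L1.norm_eq_integral_norm, hint,
      ← integral_indicator hT.measurableSet]
    refine le_of_eq (integral_congr_ae ?_)
    filter_upwards [hcoe u] with x hx
    change ω x * ‖(L1.mk ω _ (hmem u)).rep x‖ = _
    rw [hx]
    by_cases hxT : x ∈ T
    · simp only [Set.indicator_of_mem hxT, NNReal.smul_def, smul_eq_mul, norm_mul, norm_div,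
        Complex.norm_real, Real.norm_eq_abs, abs_of_pos (ω.pos x), NNReal.abs_eq]
      field_simp [(ω.pos x).ne']
    · simp [hxT]
  let J : Lp ℂ 1 m →L[ℂ] L1 ω := J₀.mkContinuous 1 hJ
  have hJn : ‖J‖ ≤ 1 := LinearMap.mkContinuous_norm_le _ zero_le_one _
  obtain ⟨v, hvm, hvb, hv⟩ := exists_density_of_isFiniteMeasure m (z.comp J)
  have hvb' : ∀ x, ‖v x‖ ≤ ‖z‖ := fun x => (hvb x).trans
    ((ContinuousLinearMap.opNorm_comp_le z J).trans (mul_le_of_le_one_right (norm_nonneg _) hJn))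
  have hbi : Integrable (T.indicator fun x => ((θ x : ℝ) : ℂ)) (Measure.haar : Measure G) := by
    rw [integrable_indicator_iff hT.measurableSet, IntegrableOn]
    have h1 : Integrable (fun _ : G => (1 : ℂ)) m := integrable_const _
    rw [hm, integrable_withDensity_iff_integrable_smul hθ] at h1
    refine h1.congr (Eventually.of_forall fun x => ?_)
    simp [NNReal.smul_def]
  have hab : ∀ x ∈ T, (T.indicator (fun x => ((θ x : ℝ) : ℂ)) x * v x) /
      T.indicator (fun x => ((θ x : ℝ) : ℂ)) x = v x := fun x hx => by
    rw [Set.indicator_of_mem hx, mul_div_cancel_left₀ _ (hθ0 x)]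
  -- The density v is only bounded and need not be integrable on T. As the quotient of θv and θ it
  -- is described by two integrable functions, which is the form that can be glued over uncountably
  -- many pieces.
  refine ⟨fun x => T.indicator (fun x => ((θ x : ℝ) : ℂ)) x * v x,
    T.indicator fun x => ((θ x : ℝ) : ℂ), hbi.mul_bdd hvm.aestronglyMeasurable
      (Eventually.of_forall hvb'), hbi, fun x hx => by rw [hab x hx]; exact hvb' x,
    fun f hf => ?_⟩
  have hui : Integrable (fun x => (ω x : ℂ) / ((θ x : ℝ) : ℂ) * f x) m := by
    rw [hm, integrable_withDensity_iff_integrable_smul hθ]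
    refine (((memLp_iff ω f).1 f.memLp).restrict (s := T)).congr (Eventually.of_forall fun x => ?_)
    simp only [NNReal.smul_def, Complex.real_smul]
    field_simp [hθ0 x]
  have hu1 := memLp_one_iff_integrable.2 hui
  have hfJ : J (hu1.toLp _) = f := by
    refine L1.ext ?_
    rw [EventuallyEq, ae_wMeasure]
    filter_upwards [hcoe (hu1.toLp _), hae hu1.coeFn_toLp, hf] with x h1 h2 h3
    change (L1.mk ω _ (hmem _)).rep x = _
    rw [h1]
    by_cases hx : x ∈ T
    · rw [Set.indicator_of_mem hx, h2 hx]
      have := hω0 x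
      have := hθ0 x
      field_simp
    · rw [Set.indicator_of_notMem hx, h3 hx]
  have h1 := hv (hu1.toLp _)
  rw [ContinuousLinearMap.comp_apply, hfJ] at h1
  rw [h1, integral_congr_ae (g := fun x => (ω x : ℂ) / ((θ x : ℝ) : ℂ) * f x * v x)
    (by filter_upwards [hu1.coeFn_toLp] with x hx; rw [hx]), hm,
    integral_withDensity_eq_integral_smul hθ, ← integral_indicator hT.measurableSet]
  refine integral_congr_ae ?_
  filter_upwards [hf] with x hx
  by_cases hxT : x ∈ T
  · rw [hab x hxT]
    simp only [Set.indicator_of_mem hxT, NNReal.smul_def, Complex.real_smul]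
    have := hθ0 x
    field_simp
  · simp [hxT, hx hxT]

end LocalDuality

/-! ### The dual of L¹(G,ω) for arbitrary G -/

section Duality

variable {G : Type*} [Group G] [TopologicalSpace G] [IsTopologicalGroup G]
  [LocallyCompactSpace G] [T2Space G] [MeasurableSpace G] [BorelSpace G] {ω : Weight G}

variable (G) in
/-- A locally compact group has a σ-compact open subgroup. -/
theorem exists_open_sigmaCompact_subgroup : ∃ N : Subgroup G, IsOpen (N : Set G) ∧
    ∃ K : ℕ → Set G, (∀ n, IsCompact (K n)) ∧ (N : Set G) ⊆ ⋃ n, K n := by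
  obtain ⟨V, hV, hV1⟩ := exists_compact_mem_nhds (1 : G)
  have hinv : (V ∪ V⁻¹)⁻¹ = V ∪ V⁻¹ := by
    rw [Set.union_inv, inv_inv, Set.union_comm]
  -- The subgroup generated by a compact neighbourhood V of the identity is open and is covered by
  -- the powers of V ∪ V⁻¹.
  refine ⟨Subgroup.closure V, Subgroup.isOpen_of_mem_nhds _
    (mem_of_superset hV1 Subgroup.subset_closure), fun n => (V ∪ V⁻¹) ^ n, fun n => ?_, ?_⟩
  · induction n with
    | zero => simp
    | succ n ih =>
      change IsCompact ((V ∪ V⁻¹) ^ (n + 1))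
      rw [pow_succ]
      exact ih.mul (hV.union hV.inv)
  · intro x hx
    rw [Set.mem_iUnion]
    induction hx using Subgroup.closure_induction with
    | mem x hx => exact ⟨1, by rw [pow_one]; exact Or.inl hx⟩
    | one => exact ⟨0, by simp⟩
    | mul x y _ _ hx hy =>
      obtain ⟨n, hn⟩ := hx
      obtain ⟨k, hk⟩ := hy
      exact ⟨n + k, by rw [pow_add]; exact Set.mul_mem_mul hn hk⟩
    | inv x _ hx =>
      obtain ⟨n, hn⟩ := hx
      refine ⟨n, ?_⟩
      rw [← hinv, inv_pow]
      exact Set.inv_mem_inv.2 hn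

variable (G) in
/-- A locally compact group is partitioned into open sets that are countable unions of compact
sets. -/
theorem exists_open_partition : ∃ N : Subgroup G,
    (∀ x : G, ∀ᶠ y : G in 𝓝 x, (y : G ⧸ N) = x) ∧
      ∀ q : G ⧸ N, CompactlyCovered {x : G | (x : G ⧸ N) = q} := by
  obtain ⟨N, hN, K, hK, hNK⟩ := exists_open_sigmaCompact_subgroup G
  have := QuotientGroup.discreteTopology hN
  have hopen : ∀ q : G ⧸ N, IsOpen {x : G | (x : G ⧸ N) = q} := fun q =>
    (isOpen_discrete ({q} : Set (G ⧸ N))).preimage continuous_quotient_mk'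
  refine ⟨N, fun x => (hopen _).mem_nhds rfl, fun q =>
    ⟨(hopen q).measurableSet, ?_⟩⟩
  obtain ⟨a, rfl⟩ := QuotientGroup.mk_surjective q
  refine ⟨fun n => (a * ·) '' K n, fun n => (hK n).image (continuous_const_mul a), fun x hx => ?_⟩
  have hx' : a⁻¹ * x ∈ N := QuotientGroup.eq.1 (Eq.symm hx)
  obtain ⟨n, hn⟩ := Set.mem_iUnion.1 (hNK hx')
  exact Set.mem_iUnion.2 ⟨n, a⁻¹ * x, hn, by simp⟩

theorem IsCompact.finite_image_of_locally_const {X ι : Type*} [TopologicalSpace X] {π : X → ι}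
    (hπ : ∀ x, ∀ᶠ y in 𝓝 x, π y = π x) {K : Set X} (hK : IsCompact K) : (π '' K).Finite := by
  obtain ⟨t, -, ht⟩ := hK.elim_nhds_subcover (fun x => {y | π y = π x}) fun x _ => hπ x
  refine (t.finite_toSet.image π).subset ?_
  rintro _ ⟨x, hx, rfl⟩
  obtain ⟨y, hy, hxy⟩ := Set.mem_iUnion₂.1 (ht hx)
  exact ⟨y, hy, Eq.symm hxy⟩

/-- A compact set meets only finitely many pieces of an open partition, so null exceptional sets in
the pieces add up to a null set on it. -/
theorem eventually_locallyAE_of_partition {ι : Type*} {π : G → ι}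
    (hπ : ∀ x, ∀ᶠ y in 𝓝 x, π y = π x) {P : G → Prop}
    (h : ∀ q, ∀ᵐ x ∂(Measure.haar : Measure G), π x = q → P x) : ∀ᶠ x in locallyAE G, P x := by
  rw [eventually_locallyAE]
  intro K hK
  rw [ae_restrict_iff' hK.measurableSet]
  have hfin := IsCompact.finite_image_of_locally_const hπ hK
  have h1 := (ae_ball_iff hfin.countable (μ := (Measure.haar : Measure G))
    (p := fun x q _ => π x = q → P x)).2 fun q _ => h q
  filter_upwards [h1] with x hx hxK
  exact hx (π x) ⟨x, hxK, rfl⟩ rfl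

/-- Integrable functions given on the pieces of an open partition are restrictions of one Borel
function, up to null sets. -/
theorem exists_measurable_glue {ι : Type*} {π : G → ι} (hπ : ∀ x, ∀ᶠ y in 𝓝 x, π y = π x)
    (a : ι → G → ℂ) (ha : ∀ q, Integrable (a q) (Measure.haar : Measure G)) :
    ∃ A : G → ℂ, Measurable A ∧
      ∀ q, ∀ᵐ x ∂(Measure.haar : Measure G), π x = q → A x = a q x := by
  choose k hkc _ hk using fun q => exists_seq_compactSupport (ha q)
  -- A union of uncountably many Borel sets, one in each piece, has no evident reason to be Borel.
  -- Continuous functions on open pieces do glue to a continuous function, and the pointwise limit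
  -- of the glued approximants is Borel.
  have hcont : ∀ n, Continuous fun x => k (π x) n x := fun n => by
    refine continuous_iff_continuousAt.2 fun x => ?_
    refine ((hkc (π x) n).continuousAt (x := x)).congr ?_
    filter_upwards [hπ x] with y hy
    rw [hy]
  refine ⟨fun x => limUnder atTop fun n => k (π x) n x,
    (StronglyMeasurable.limUnder fun n =>
      (hcont n).measurable.stronglyMeasurable).measurable, fun q => ?_⟩
  filter_upwards [hk q] with x hx hxq
  subst hxq
  exact hx.limUnder_eq

/-- A bounded functional is determined by its values on compactly supported continuous functions. -/
theorem eq_zero_of_compactSupport (w : StrongDual ℂ (L1 ω))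
    (hw : ∀ (k : G → ℂ) (hk : MemLp k 1 (wMeasure ω)), Continuous k → HasCompactSupport k →
      w (L1.mk ω k hk) = 0) (f : L1 ω) : w f = 0 := by
  have hle : ∀ ε > 0, ‖w f‖ ≤ ‖w‖ * ε := fun ε hε => by
    obtain ⟨k, hk, hkc, hks, hle⟩ := exists_compactSupport ω f hε
    have e : w f = w (f - L1.mk ω k hk) := by rw [map_sub, hw k hk hkc hks, sub_zero]
    rw [e]
    exact (w.le_opNorm _).trans (mul_le_mul_of_nonneg_left hle (norm_nonneg _))
  by_contra hne
  have hpos : 0 < ‖w f‖ := norm_pos_iff.2 hne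
  -- With this ε, ‖w‖ ε is smaller than ‖w f‖.
  have h1 := hle (‖w f‖ / (2 * (‖w‖ + 1))) (by positivity)
  have h2 : ‖w‖ * (‖w f‖ / (2 * (‖w‖ + 1))) < ‖w f‖ := by
    rw [← mul_div_assoc, div_lt_iff₀ (by positivity)]
    nlinarith [norm_nonneg w]
  linarith

/-- Every bounded functional on `L^1(G, ω)` is given by a function in `L^∞(G, 1/ω)`. -/
theorem exists_wBounded_density (z : StrongDual ℂ (L1 ω)) :
    ∃ h : G → ℂ, Measurable h ∧ (∀ x, ‖h x‖ ≤ ‖z‖ * ω x) ∧ ∀ f, z f = pair h f := by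
  obtain ⟨N, hN, hcov'⟩ := exists_open_partition G
  obtain ⟨ι, π, hπ, hcov⟩ : ∃ (ι : Type _) (π : G → ι), (∀ x, ∀ᶠ y in 𝓝 x, π y = π x) ∧
    ∀ q, CompactlyCovered {x | π x = q} := ⟨G ⧸ N, fun x => (x : G ⧸ N), hN, hcov'⟩
  choose a b ha hb hab hz using fun q => exists_density_on (hcov q) z
  obtain ⟨A, hAm, hA⟩ := exists_measurable_glue hπ a ha
  obtain ⟨B, hBm, hB⟩ := exists_measurable_glue hπ b hb
  have hh₀ : ∀ᶠ x in locallyAE G, ‖(ω x : ℂ) * (A x / B x)‖ ≤ ‖z‖ * ω x := by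
    refine eventually_locallyAE_of_partition hπ fun q => ?_
    filter_upwards [hA q, hB q] with x h1 h2 hx
    rw [h1 hx, h2 hx, norm_mul, Complex.norm_real, Real.norm_eq_abs, abs_of_pos (ω.pos x), mul_comm]
    exact mul_le_mul_of_nonneg_right (hab q x hx) (ω.pos x).le
  obtain ⟨h, hhm, hhb, heq⟩ := exists_bounded_rep
    (h := fun x => (ω x : ℂ) * (A x / B x))
    ((Complex.measurable_ofReal.comp ω.continuous'.measurable).mul (hAm.div hBm))
    (norm_nonneg z) hh₀
  have hh : WBounded ω h := ⟨hhm, _, hhb⟩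
  refine ⟨h, hhm, hhb, ?_⟩
  set w : StrongDual ℂ (L1 ω) := z - toDual ω (Linf.mk ω h hh.memLinf) with hw
  have hpiece : ∀ (q : ι) (f : L1 ω),
      (∀ᵐ x ∂(Measure.haar : Measure G), π x ≠ q → f x = 0) → w f = 0 := fun q f hf => by
    rw [hw, _root_.sub_apply, toDual_mk, ← pair_congr heq, hz q f hf, sub_eq_zero]
    refine integral_congr_ae ?_
    filter_upwards [hA q, hB q, hf] with x h1 h2 h3
    by_cases hx : π x = q
    · rw [h1 hx, h2 hx]
    · rw [h3 hx, zero_mul, zero_mul]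
  suffices hw0 : ∀ f, w f = 0 by
    intro f
    have := hw0 f
    rwa [hw, _root_.sub_apply, toDual_mk, sub_eq_zero] at this
  -- A compactly supported function is a finite sum of its restrictions to pieces, and w vanishes on
  -- each of these.
  have hcpt : ∀ (k : G → ℂ) (hk : MemLp k 1 (wMeasure ω)), HasCompactSupport k →
      w (L1.mk ω k hk) = 0 := fun k hk hks => by
    have hfin := IsCompact.finite_image_of_locally_const hπ hks
    have hm : ∀ q, MemLp ({x | π x = q}.indicator k) 1 (wMeasure ω) := fun q =>
      hk.indicator (hcov q).measurableSet
    have hsum : L1.mk ω k hk = ∑ q ∈ hfin.toFinset, L1.mk ω _ (hm q) := by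
      refine L1.ext ?_
      have h1 : ∀ s : Finset ι, (∑ q ∈ s, L1.mk ω _ (hm q)).rep =ᵐ[wMeasure ω]
          fun x => ∑ q ∈ s, {x | π x = q}.indicator k x := fun s => by
        classical
        induction s using Finset.induction_on with
        | empty =>
          have h0 := L1.coe_smul (ω := ω) 0 0
          rw [zero_smul] at h0
          filter_upwards [h0] with x hx
          rw [Finset.sum_empty, Finset.sum_empty, hx]
          simp
        | insert q s hq ih =>
          rw [Finset.sum_insert hq]
          filter_upwards [L1.coe_add (L1.mk ω _ (hm q)) (∑ q ∈ s, L1.mk ω _ (hm q)),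
            L1.coe_mk ω (hm q), ih] with x h1 h2 h3
          rw [h1, Pi.add_apply, h2, h3, Finset.sum_insert hq]
      filter_upwards [L1.coe_mk ω hk, h1 hfin.toFinset] with x h2 h3
      rw [h2, h3]
      by_cases hx : k x = 0
      · rw [hx, Finset.sum_eq_zero]
        intro q _
        by_cases hq : x ∈ {x | π x = q}
        · rw [Set.indicator_of_mem hq, hx]
        · rw [Set.indicator_of_notMem hq]
      · rw [Finset.sum_eq_single (π x)]
        · exact (Set.indicator_of_mem (s := {y | π y = π x}) rfl k).symm
        · intro q _ hq
          exact Set.indicator_of_notMem (s := {y | π y = q}) (fun h => hq (Eq.symm h)) k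
        · intro hnot
          exact absurd (hfin.mem_toFinset.2 ⟨x, subset_tsupport k hx, rfl⟩) hnot
    rw [hsum, map_sum]
    refine Finset.sum_eq_zero fun q _ => hpiece q _ ?_
    have h2 := L1.coe_mk ω (hm q)
    rw [EventuallyEq, ae_wMeasure] at h2
    filter_upwards [h2] with x hx hxq
    rw [hx, Set.indicator_of_notMem]
    exact hxq
  exact eq_zero_of_compactSupport w fun k hk _ hks => hcpt k hk hks

end Duality

/-! ### Right translations and the modular function -/

section RightTranslation

variable {G : Type*} [Group G] [TopologicalSpace G] [IsTopologicalGroup G]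
  [LocallyCompactSpace G] [T2Space G] [MeasurableSpace G] [BorelSpace G] {ω : Weight G}

/-- Right translation multiplies Haar measure by the modular function. -/
theorem map_mul_right_haar (x : G) : (Measure.haar : Measure G).map (· * x) =
    Measure.modularCharacterFun x • (Measure.haar : Measure G) := by
  have : ((Measure.haar : Measure G).map (· * x)).Regular :=
    Measure.Regular.map (Homeomorph.mulRight x)
  rw [Measure.modularCharacterFun_eq_haarScalarFactor (Measure.haar : Measure G)]
  exact Measure.isMulLeftInvariant_eq_smul_of_regular _ _

theorem integral_comp_mul_right {F : G → ℂ} (hF : Measurable F) (x : G) :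
    ∫ y, F (y * x) ∂(Measure.haar : Measure G) =
      (Measure.modularCharacterFun x : ℂ) * ∫ y, F y ∂(Measure.haar : Measure G) := by
  rw [← integral_map (μ := (Measure.haar : Measure G)) (φ := (· * x)) (f := F)
    (continuous_mul_const x).measurable.aemeasurable hF.aestronglyMeasurable,
    map_mul_right_haar, integral_smul_nnreal_measure]
  rfl

theorem continuous_integral_comp_mul_right {f : G → ℂ} (hf : Continuous f)
    (hs : HasCompactSupport f) :
    Continuous fun x => ∫ y, f (y * x) ∂(Measure.haar : Measure G) := by
  refine continuous_iff_continuousAt.2 fun x₀ => ?_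
  obtain ⟨S, hS, hxS⟩ := exists_compact_mem_nhds x₀
  have hT : IsCompact (tsupport f * S⁻¹) := hs.isCompact.mul hS.inv
  refine (continuousOn_integral_of_compact_support (f := fun x y => f (y * x)) hT
    (Continuous.continuousOn ?_) fun x y hx hy => ?_).continuousAt hxS
  · unfold Function.uncurry
    fun_prop
  · by_contra h
    exact hy ⟨y * x, subset_tsupport f h, x⁻¹, Set.inv_mem_inv.2 hx, by simp⟩

/-- For a bump function f, the modular function is the quotient of ∫ f(yx) dy, continuous in x, by
the nonzero constant ∫ f. -/
theorem continuous_modularCharacterFun :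
    Continuous fun x : G => (Measure.modularCharacterFun x : ℂ) := by
  obtain ⟨f, hfs, hf0, hf1⟩ := exists_continuous_nonneg_pos (1 : G)
  have hpos : 0 < ∫ y, f y ∂(Measure.haar : Measure G) :=
    f.continuous.integral_pos_of_hasCompactSupport_nonneg_nonzero hfs hf0 hf1
  have hc : Continuous fun y => (f y : ℂ) := Complex.continuous_ofReal.comp f.continuous
  have hs : HasCompactSupport fun y => (f y : ℂ) :=
    hfs.comp_left (g := fun t : ℝ => (t : ℂ)) Complex.ofReal_zero
  have hne : ∫ y, (f y : ℂ) ∂(Measure.haar : Measure G) ≠ 0 := by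
    rw [integral_complex_ofReal]
    exact_mod_cast hpos.ne'
  have h := (continuous_integral_comp_mul_right hc hs).div_const
    (∫ y, (f y : ℂ) ∂(Measure.haar : Measure G))
  refine h.congr fun x => ?_
  rw [integral_comp_mul_right hc.measurable, mul_div_cancel_right₀ _ hne]

/-- The distance in `L^1(G, ω)` from a continuous function with compact support to its right
translates. -/
noncomputable def rightModulus (ω : Weight G) (k : G → ℂ) (x : G) : ℝ :=
  ∫ y, ‖(Measure.modularCharacterFun x : ℂ) * k (y * x⁻¹) - k y‖ * ω y ∂(Measure.haar : Measure G)

/-- For x in a compact neighbourhood S of 1, all integrands vanish off one compact set, so the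
integral is continuous in x; at x = 1 it is zero. -/
theorem tendsto_rightModulus (ω : Weight G) {k : G → ℂ} (hk : Continuous k)
    (hs : HasCompactSupport k) : Tendsto (rightModulus ω k) (𝓝 1) (𝓝 0) := by
  obtain ⟨S, hS, h1S⟩ := exists_compact_mem_nhds (1 : G)
  have hT : IsCompact (tsupport k * S ∪ tsupport k) := (hs.isCompact.mul hS).union hs.isCompact
  have hc := continuous_modularCharacterFun (G := G)
  have hω := ω.continuous'
  have h0 : rightModulus ω k 1 = 0 := by
    simp [rightModulus, Measure.modularCharacterFun_map_one]
  rw [← h0]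
  refine (continuousOn_integral_of_compact_support (f := fun x y =>
    ‖(Measure.modularCharacterFun x : ℂ) * k (y * x⁻¹) - k y‖ * ω y) hT
    (Continuous.continuousOn ?_) fun x y hx hy => ?_).continuousAt h1S
  · unfold Function.uncurry
    have := hc.comp (continuous_fst (X := G) (Y := G))
    simp only [Function.comp_def] at this
    fun_prop
  · have h1 : k y = 0 := by
      by_contra h
      exact hy (Or.inr (subset_tsupport k h))
    have h2 : k (y * x⁻¹) = 0 := by
      by_contra h
      exact hy (Or.inl ⟨y * x⁻¹, subset_tsupport k h, x, hx, by simp⟩)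
    simp [h1, h2]

/-- Substituting y x⁻¹ for y moves the translation from h, which is merely Borel, to the continuous
k, at the cost of the modular factor. -/
theorem norm_pair_mul_left_sub_le {h : G → ℂ} (hm : Measurable h) {C : ℝ}
    (hC : ∀ x, ‖h x‖ ≤ C * ω x) {k : G → ℂ} (hk : MemLp k 1 (wMeasure ω)) (hkc : Continuous k)
    (hks : HasCompactSupport k) (x : G) :
    ‖pair (fun y => h (y * x)) (L1.mk ω k hk) - pair h (L1.mk ω k hk)‖ ≤
      C * rightModulus ω k x := by
  have hcoe := L1.coe_mk ω hk
  rw [EventuallyEq, ae_wMeasure] at hcoe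
  have e : ∀ u : G → ℂ, pair u (L1.mk ω k hk) = ∫ y, k y * u y ∂(Measure.haar : Measure G) :=
    fun u => integral_congr_ae (by filter_upwards [hcoe] with y hy; rw [hy])
  have hh : WBounded ω h := ⟨hm, C, hC⟩
  have hωi : ∀ u : G → ℂ, Continuous u → HasCompactSupport u →
      Integrable (fun y => u y * h y) (Measure.haar : Measure G) := fun u hu hus => by
    have h1 : Integrable (fun y => C * (‖u y‖ * ω y)) (Measure.haar : Measure G) :=
      ((hu.norm.mul ω.continuous').integrable_of_hasCompactSupport
        (hus.norm.mul_right)).const_mul C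
    refine h1.mono' (hu.measurable.mul hm).aestronglyMeasurable (Eventually.of_forall fun y => ?_)
    rw [norm_mul]
    nlinarith [hC y, norm_nonneg (u y)]
  have hkx : Continuous fun y => k (y * x⁻¹) := hkc.comp (continuous_mul_const _)
  have hkxs : HasCompactSupport fun y => k (y * x⁻¹) :=
    hks.comp_homeomorph (Homeomorph.mulRight x⁻¹)
  have h1 := integral_comp_mul_right (F := fun y => k (y * x⁻¹) * h y)
    (hkx.measurable.mul hm) x
  simp only [mul_inv_cancel_right] at h1
  rw [e, e, h1, ← integral_const_mul, ← integral_sub ((hωi _ hkx hkxs).const_mul _)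
    (hωi k hkc hks), rightModulus, ← integral_const_mul]
  refine norm_integral_le_of_norm_le ?_ (Eventually.of_forall fun y => ?_)
  · have hd : Continuous fun y => (Measure.modularCharacterFun x : ℂ) * k (y * x⁻¹) - k y :=
      (continuous_const.mul hkx).sub hkc
    have hds : HasCompactSupport fun y =>
        (Measure.modularCharacterFun x : ℂ) * k (y * x⁻¹) - k y := hkxs.mul_left.sub hks
    exact ((hd.norm.mul ω.continuous').integrable_of_hasCompactSupport
      hds.norm.mul_right).const_mul C
  · rw [← mul_assoc, ← sub_mul, norm_mul]
    have := hC y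
    nlinarith [norm_nonneg ((Measure.modularCharacterFun x : ℂ) * k (y * x⁻¹) - k y)]

/-- Right translation preserves locally null sets. -/
theorem tendsto_mul_right_locallyAE (y : G) :
    Tendsto (· * y) (locallyAE G) (locallyAE G) := by
  intro s hs
  have hs' : ∀ᶠ x in locallyAE G, x ∈ s := hs
  rw [eventually_locallyAE] at hs'
  change ∀ᶠ x in locallyAE G, x * y ∈ s
  rw [eventually_locallyAE]
  intro K hK
  have hK' := hK.image (continuous_mul_const y)
  have h1 := (ae_restrict_iff' hK'.measurableSet).1 (hs' _ hK')
  rw [ae_restrict_iff' hK.measurableSet]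
  have h2 : ∀ᵐ x ∂(Measure.haar : Measure G).map (· * y), x ∈ (· * y) '' K → x ∈ s := by
    rw [map_mul_right_haar]
    exact Measure.ae_smul_measure h1 _
  filter_upwards [ae_of_ae_map (continuous_mul_const y).measurable.aemeasurable h2] with x hx hxK
  exact hx ⟨x, hxK, rfl⟩

/-- Left translation preserves locally null sets. -/
theorem tendsto_mul_left_locallyAE (y : G) :
    Tendsto (y * ·) (locallyAE G) (locallyAE G) := by
  intro s hs
  have hs' : ∀ᶠ x in locallyAE G, x ∈ s := hs
  rw [eventually_locallyAE] at hs'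
  change ∀ᶠ x in locallyAE G, y * x ∈ s
  rw [eventually_locallyAE]
  intro K hK
  have hK' := hK.image (continuous_const_mul y)
  have h1 := (ae_restrict_iff' hK'.measurableSet).1 (hs' _ hK')
  rw [ae_restrict_iff' hK.measurableSet]
  have h2 := (measurePreserving_mul_left (Measure.haar : Measure G) y).quasiMeasurePreserving.ae h1
  filter_upwards [h2] with x hx hxK
  exact hx ⟨x, hxK, rfl⟩

end RightTranslation

/-! ### Averages near the identity and density of tensors -/

section Approximation

variable {G H : Type*} [Group G] [TopologicalSpace G] [IsTopologicalGroup G]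
  [LocallyCompactSpace G] [T2Space G] [MeasurableSpace G] [BorelSpace G]
  [Group H] [TopologicalSpace H] [IsTopologicalGroup H]
  [LocallyCompactSpace H] [T2Space H] [MeasurableSpace H] [BorelSpace H]
  {ω : Weight G} {ω' : Weight H}

/-- `E` averages over `U`: functions that are `ε`-close to `c` on `U` pair with `E` to a number
`ε`-close to `c`. -/
def IsAverage (U : Set G) (E : L1 ω) : Prop :=
  ∀ q : G → ℂ, WBounded ω q → ∀ (c : ℂ) (ε : ℝ), (∀ x ∈ U, ‖q x - c‖ ≤ ε) → ‖pair q E - c‖ ≤ ε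

/-- The indicator of a compact neighbourhood K inside U, divided by the measure of K. Its norm is
the mean of ω over K. -/
theorem exists_isAverage (ω : Weight G) {U : Set G} (hU : U ∈ 𝓝 (1 : G)) :
    ∃ E : L1 ω, IsAverage U E ∧ ∀ C, (∀ x ∈ U, ω x ≤ C) → ‖E‖ ≤ C := by
  obtain ⟨K, hK1, hKU, hK⟩ := local_compact_nhds hU
  have hμ0 : (Measure.haar : Measure G) K ≠ 0 :=
    (Measure.measure_pos_of_mem_nhds _ hK1).ne'
  have hμ1 : (Measure.haar : Measure G) K ≠ ∞ := hK.measure_lt_top.ne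
  set t : ℝ := (Measure.haar : Measure G).real K with ht
  have ht0 : 0 < t := ENNReal.toReal_pos hμ0 hμ1
  have htc : (t : ℂ) ≠ 0 := by exact_mod_cast ht0.ne'
  have hm : MemLp (K.indicator fun _ => (t : ℂ)⁻¹) 1 (wMeasure ω) := by
    have e : (fun x => (ω x : ℂ) * K.indicator (fun _ => (t : ℂ)⁻¹) x) =
        K.indicator fun x => (ω x : ℂ) * (t : ℂ)⁻¹ := by
      ext x
      by_cases hx : x ∈ K <;> simp [hx]
    rw [memLp_iff, e, integrable_indicator_iff hK.measurableSet]
    exact ((Complex.continuous_ofReal.comp ω.continuous').mul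
      continuous_const).continuousOn.integrableOn_compact hK
  have hcoe := L1.coe_mk ω hm
  rw [EventuallyEq, ae_wMeasure] at hcoe
  refine ⟨L1.mk ω _ hm, fun q hq c ε hε => ?_, fun C hC => ?_⟩
  · have e : pair q (L1.mk ω _ hm) = (t : ℂ)⁻¹ * ∫ x in K, q x ∂(Measure.haar : Measure G) := by
      rw [← integral_const_mul, ← integral_indicator hK.measurableSet]
      refine integral_congr_ae ?_
      filter_upwards [hcoe] with x hx
      rw [hx]
      by_cases hxK : x ∈ K <;> simp [hxK]
    have hqi : IntegrableOn q K (Measure.haar : Measure G) := by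
      obtain ⟨D, hD⟩ := hq.bound
      exact ((ω.continuous'.continuousOn.integrableOn_compact hK).const_mul D).mono'
        hq.measurable.aestronglyMeasurable (Eventually.of_forall hD)
    have e2 : ∫ x in K, (q x - c) ∂(Measure.haar : Measure G) =
        ∫ x in K, q x ∂(Measure.haar : Measure G) - t * c := by
      rw [integral_sub hqi (integrableOn_const hμ1), setIntegral_const, ← ht,
        Complex.real_smul]
    have h1 := norm_setIntegral_le_of_norm_le_const (μ := (Measure.haar : Measure G))
      (f := fun x => q x - c) (C := ε) hK.measure_lt_top fun x hx => hε x (hKU hx)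
    rw [e2] at h1
    have e3 : pair q (L1.mk ω _ hm) - c =
        (t : ℂ)⁻¹ * (∫ x in K, q x ∂(Measure.haar : Measure G) - t * c) := by
      rw [e, mul_sub, inv_mul_cancel_left₀ htc]
    rw [e3, norm_mul, norm_inv, Complex.norm_real, Real.norm_eq_abs, abs_of_pos ht0,
      inv_mul_le_iff₀ ht0, mul_comm t]
    exact h1
  · rw [L1.norm_eq_integral]
    have e : ∫ x, ω x * ‖(L1.mk ω _ hm).rep x‖ ∂(Measure.haar : Measure G) =
        t⁻¹ * ∫ x in K, ω x ∂(Measure.haar : Measure G) := by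
      rw [← integral_const_mul, ← integral_indicator hK.measurableSet]
      refine integral_congr_ae ?_
      filter_upwards [hcoe] with x hx
      rw [hx]
      by_cases hxK : x ∈ K <;> simp [hxK, abs_of_pos ht0, mul_comm]
    rw [e, inv_mul_le_iff₀ ht0]
    have h1 := norm_setIntegral_le_of_norm_le_const (μ := (Measure.haar : Measure G))
      (f := fun x => ω x) (C := C) hK.measure_lt_top fun x hx => by
        rw [Real.norm_eq_abs, abs_of_pos (ω.pos x)]
        exact hC x (hKU hx)
    rw [← ht, mul_comm C] at h1
    exact (le_abs_self _).trans h1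

theorem IsAverage.mono {U V : Set G} {E : L1 ω} (hE : IsAverage V E) (h : V ⊆ U) :
    IsAverage U E := fun q hq c ε hε => hE q hq c ε fun x hx => hε x (h hx)

/-- The inverse of `productConst` corrects the independent normalisation of Haar measure on the
product, so the tensor again has total mass one. -/
theorem IsAverage.tensor {U : Set G} {V : Set H} {E : L1 ω} {F : L1 ω'} (hE : IsAverage U E)
    (hF : IsAverage V F) :
    IsAverage (rect U V) ((productConst G H : ℂ)⁻¹ • tensor E F) := by
  intro q hq c ε hε
  have hc : (productConst G H : ℂ) ≠ 0 := by exact_mod_cast (productConst_pos G H).ne'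
  rw [pair_smul hq, pair_tensor hq, inv_mul_cancel_left₀ hc]
  refine hE _ (hq.pair_section F) c ε fun x hx => ?_
  exact hF _ (hq.section x) c ε fun y hy => hε (BProd.mk x y) ⟨hx, hy⟩

/-- Convolution by averages over small neighbourhoods of the identity approximates the identity. -/
theorem exists_nhds_norm_mul_sub_le {k : G → ℂ} (hk : MemLp k 1 (wMeasure ω))
    (hkc : Continuous k) (hks : HasCompactSupport k) {ε : ℝ} (hε : 0 < ε) :
    ∃ U ∈ 𝓝 (1 : G), ∀ E : L1 ω, IsAverage U E →
      ‖L1.mk ω k hk * E - L1.mk ω k hk‖ ≤ ε := by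
  refine ⟨{x | rightModulus ω k x < ε},
    (tendsto_rightModulus ω hkc hks).eventually_lt_const hε, fun E hE => ?_⟩
  -- The norm is tested on functionals, which have densities h. Then ⟨h, k * E⟩ averages x ↦ ⟨h(·
  -- x), k⟩ against E, and on U this function is close to its value ⟨h, k⟩ at x = 1.
  refine NormedSpace.norm_le_dual_bound ℂ _ hε.le fun z => ?_
  obtain ⟨h, hm, hb, hz⟩ := exists_wBounded_density z
  have hh : WBounded ω h := ⟨hm, _, hb⟩
  rw [map_sub, hz, hz, pair_mul' hh, mul_comm ε]
  refine hE _ (hh.pair_mul_left _) _ _ fun x hx => ?_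
  refine (norm_pair_mul_left_sub_le hm hb hk hkc hks x).trans ?_
  exact mul_le_mul_of_nonneg_left (le_of_lt hx) (norm_nonneg z)

/-- A bounded function on the product that annihilates all tensor products vanishes locally almost
everywhere. -/
theorem eventually_eq_zero_of_tensor {P : BProd G H → ℂ} (hP : WBounded (ω.prod ω') P)
    (h : ∀ (f : L1 ω) (g : L1 ω'), pair P (tensor f g) = 0) :
    ∀ᶠ p in locallyAE (BProd G H), P p = 0 := by
  refine hP.eventually_eq_zero fun F => ?_
  have hpair : ∀ F, toDual _ (Linf.mk _ P hP.memLinf) F = pair P F := toDual_mk hP.memLinf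
  rw [← hpair]
  refine eq_zero_of_compactSupport _ (fun k hk hkc hks => ?_) F
  rw [hpair]
  -- Convolution with a tensor integrates its translates, which pair with P like tensors of
  -- translated factors; so P annihilates these products, and they approximate every compactly
  -- supported continuous k.
  have hmul : ∀ (K : L1 (ω.prod ω')) (c : ℂ) (f : L1 ω) (g : L1 ω'),
      pair P (K * (c • tensor f g)) = 0 := fun K c f g => by
    rw [pair_mul hP]
    have h0 : ∀ p : BProd G H, pair (fun q => P (p * q)) (c • tensor f g) = 0 := fun p => by
      have h1 := h (translate ω p.fst f) (translate ω' p.snd g)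
      rw [pair_tensor hP, pair_translate] at h1
      simp only [pair_translate] at h1
      rw [pair_smul (hP.comp_mul_left p), pair_tensor (hP.comp_mul_left p)]
      exact mul_eq_zero_of_right _ h1
    simp only [h0]
    simp [pair]
  obtain ⟨C, hC0, hC⟩ := hP.exists_nonneg
  by_contra hne
  have hpos : 0 < ‖pair P (L1.mk _ k hk)‖ := norm_pos_iff.2 hne
  obtain ⟨U, hU, hUE⟩ := exists_nhds_norm_mul_sub_le hk hkc hks
    (ε := ‖pair P (L1.mk _ k hk)‖ / (2 * (C + 1))) (by positivity)
  obtain ⟨V, hV, W, hW, hVW⟩ : ∃ V ∈ 𝓝 (1 : G), ∃ W ∈ 𝓝 (1 : H), rect V W ⊆ U :=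
    mem_nhds_prod_iff.1 hU
  obtain ⟨E, hE, -⟩ := exists_isAverage ω hV
  obtain ⟨E', hE', -⟩ := exists_isAverage ω' hW
  have h1 := hUE _ ((hE.tensor hE').mono hVW)
  have h2 : ‖pair P (L1.mk _ k hk)‖ ≤ C * (‖pair P (L1.mk _ k hk)‖ / (2 * (C + 1))) := by
    have h3 := (norm_pair_le hC (L1.mk _ k hk * ((productConst G H : ℂ)⁻¹ • tensor E E') -
      L1.mk _ k hk)).trans (mul_le_mul_of_nonneg_left h1 hC0)
    rwa [← hpair, map_sub, hpair, hpair, hmul, zero_sub, norm_neg] at h3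
  have h3 : C * (‖pair P (L1.mk _ k hk)‖ / (2 * (C + 1))) < ‖pair P (L1.mk _ k hk)‖ := by
    rw [← mul_div_assoc, div_lt_iff₀ (by positivity)]
    nlinarith
  linarith

/-- Locally null sets pull back to locally null sets under `(x, y) ↦ x y` and `(x, y) ↦ y x`. -/
theorem eventually_locallyAE_mul (ω : Weight G) {N : Set G} (hN : MeasurableSet N)
    (h : ∀ᶠ x in locallyAE G, x ∉ N) : ∀ᶠ p in locallyAE (BProd G G),
      p.fst * p.snd ∉ N ∧ p.snd * p.fst ∉ N := by
  -- The indicator of N is treated as a bounded function; all its translates annihilate L¹, so its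
  -- composites with the two products annihilate every tensor.
  have hb : WBounded ω (N.indicator fun _ => (1 : ℂ)) := by
    refine ⟨measurable_const.indicator hN, 1, fun x => ?_⟩
    rw [one_mul]
    refine (norm_indicator_le_norm_self _ _).trans ?_
    rw [norm_one]
    exact ω.one_le' x
  have h0 : (N.indicator fun _ => (1 : ℂ)) =ᶠ[locallyAE G] fun _ => 0 := by
    filter_upwards [h] with x hx
    exact Set.indicator_of_notMem hx _
  have hx0 : ∀ (x : G) (f : L1 ω), pair (fun y => N.indicator (fun _ => (1 : ℂ)) (x * y)) f = 0 :=
    fun x f => by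
      rw [← pair_translate, pair_congr h0]
      simp [pair]
  have h1 := eventually_eq_zero_of_tensor hb.comp_mul fun f g => by
    rw [pair_tensor hb.comp_mul]
    simp only [BProd.fst_mk, BProd.snd_mk, hx0]
    simp [pair]
  have h2 := eventually_eq_zero_of_tensor hb.comp_mul_swap fun f g => by
    rw [pair_tensor' hb.comp_mul_swap]
    simp only [BProd.fst_mk, BProd.snd_mk, hx0]
    simp [pair]
  have hmem : ∀ x, N.indicator (fun _ => (1 : ℂ)) x = 0 → x ∉ N := fun x hx hxN => by
    rw [Set.indicator_of_mem hxN] at hx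
    exact one_ne_zero hx
  filter_upwards [h1, h2] with p h1 h2
  exact ⟨hmem _ h1, hmem _ h2⟩

end Approximation

/-! ### Representation of bounded bilinear forms -/

section Bilinear

variable {G H : Type*} [Group G] [TopologicalSpace G] [IsTopologicalGroup G]
  [LocallyCompactSpace G] [T2Space G] [MeasurableSpace G] [BorelSpace G]
  [Group H] [TopologicalSpace H] [IsTopologicalGroup H]
  [LocallyCompactSpace H] [T2Space H] [MeasurableSpace H] [BorelSpace H]
  {ω : Weight G} {ω' : Weight H}

/-- `L^1(G, ω)` has a bounded right approximate identity. -/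
theorem exists_approximateUnit (ω : Weight G) : ∃ F : Filter (L1 ω), F.NeBot ∧
    (∀ᶠ E in F, ‖E‖ ≤ 2) ∧ ∀ f : L1 ω, Tendsto (fun E => f * E) F (𝓝 f) := by
  -- The approximate unit is indexed by neighbourhoods of 1. The bound 2 is available because ω < 2
  -- near the identity.
  let S : Set G → Set (L1 ω) := fun U => {E | IsAverage U E ∧ ‖E‖ ≤ 2}
  have hS : Monotone S := fun U V h E hE => ⟨hE.1.mono h, hE.2⟩
  have hW : {x | ω x < 2} ∈ 𝓝 (1 : G) :=
    ω.continuous'.continuousAt.eventually_lt_const (by rw [ω.map_one']; norm_num)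
  have hb : ∀ᶠ E in (𝓝 (1 : G)).lift' S, ‖E‖ ≤ 2 :=
    mem_of_superset (mem_lift' univ_mem) fun E hE => hE.2
  refine ⟨(𝓝 1).lift' S, (lift'_neBot_iff hS).2 fun U hU => ?_, hb, fun f => ?_⟩
  · obtain ⟨E, hE, hEb⟩ := exists_isAverage ω (inter_mem hU hW)
    exact ⟨E, hE.mono Set.inter_subset_left, hEb 2 fun x hx => hx.2.le⟩
  · rw [Metric.tendsto_nhds]
    intro ε hε
    obtain ⟨k, hk, hkc, hks, hle⟩ := exists_compactSupport ω f (ε := ε / 8) (by positivity)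
    obtain ⟨U, hU, hUE⟩ := exists_nhds_norm_mul_sub_le hk hkc hks (ε := ε / 8) (by positivity)
    filter_upwards [hb, mem_lift' hU] with E hE hEU
    have e : f * E - f = (f - L1.mk ω k hk) * E + (L1.mk ω k hk * E - L1.mk ω k hk)
        - (f - L1.mk ω k hk) := by
      rw [sub_mul]; abel
    rw [dist_eq_norm, e]
    have h1 := norm_sub_le ((f - L1.mk ω k hk) * E + (L1.mk ω k hk * E - L1.mk ω k hk))
      (f - L1.mk ω k hk)
    have h2 := norm_add_le ((f - L1.mk ω k hk) * E) (L1.mk ω k hk * E - L1.mk ω k hk)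
    have h3 := norm_mul_le (f - L1.mk ω k hk) E
    have h4 := hUE E hEU.1
    have h5 : ‖f - L1.mk ω k hk‖ * ‖E‖ ≤ ε / 8 * 2 :=
      mul_le_mul hle hE (norm_nonneg _) (by positivity)
    linarith

theorem norm_apply_translate_le (B : L1 ω →L[ℂ] StrongDual ℂ (L1 ω')) (E : L1 ω) (E' : L1 ω')
    (p : BProd G H) : ‖B (translate ω p.fst E) (translate ω' p.snd E')‖ ≤
      ‖B‖ * ‖E‖ * ‖E'‖ * ω.prod ω' p := by
  have h1 := norm_translate_le ω p.fst E
  have h2 := norm_translate_le ω' p.snd E'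
  have h3 := ω.pos p.fst
  calc _ ≤ ‖B‖ * ‖translate ω p.fst E‖ * ‖translate ω' p.snd E'‖ := B.le_opNorm₂ _ _
    _ ≤ ‖B‖ * (ω p.fst * ‖E‖) * (ω' p.snd * ‖E'‖) := by gcongr
    _ = ‖B‖ * ‖E‖ * ‖E'‖ * (ω p.fst * ω' p.snd) := by ring

theorem wBounded_translate (B : L1 ω →L[ℂ] StrongDual ℂ (L1 ω')) (E : L1 ω) (E' : L1 ω') :
    WBounded (ω.prod ω') fun p => B (translate ω p.fst E) (translate ω' p.snd E') := by
  have hc : Continuous fun p : BProd G H => B (translate ω p.fst E) (translate ω' p.snd E') :=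
    (B.continuous.comp ((continuous_translate ω E).comp BProd.continuous_fst)).clm_apply
      ((continuous_translate ω' E').comp BProd.continuous_snd)
  exact ⟨hc.measurable, _, norm_apply_translate_le B E E'⟩

/-- In each variable the integral of the translates of E against f is f * E, and B passes through
it. -/
theorem pair_translate_tensor (B : L1 ω →L[ℂ] StrongDual ℂ (L1 ω')) (E : L1 ω) (E' : L1 ω')
    (f : L1 ω) (g : L1 ω') :
    pair (fun p : BProd G H => B (translate ω p.fst E) (translate ω' p.snd E')) (tensor f g) =
      productConst G H * B (f * E) (g * E') := by
  rw [pair_tensor (wBounded_translate B E E')]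
  simp only [BProd.fst_mk, BProd.snd_mk, ← apply_mul_eq]
  exact congrArg _ (apply_mul_eq (B.flip (g * E')) f E).symm

/-- Bounded bilinear forms on weighted `L^1` spaces are given by bounded Borel functions. -/
theorem exists_wBounded_bilinear (B : L1 ω →L[ℂ] StrongDual ℂ (L1 ω')) :
    ∃ P : BProd G H → ℂ, WBounded (ω.prod ω') P ∧ ∀ f g, pair P (tensor f g) = B f g := by
  obtain ⟨F, hF, hFb, hFt⟩ := exists_approximateUnit ω
  obtain ⟨F', hF', hFb', hFt'⟩ := exists_approximateUnit ω'
  let U : Ultrafilter (L1 ω × L1 ω') := Ultrafilter.of (F ×ˢ F')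
  have hU : (U : Filter (L1 ω × L1 ω')) ≤ F ×ˢ F' := Ultrafilter.of_le _
  let Z : L1 ω × L1 ω' → StrongDual ℂ (L1 (ω.prod ω')) := fun E =>
    toDual _ (Linf.mk _ _ (wBounded_translate B E.1 E.2).memLinf)
  have hZ : ∀ E K, Z E K =
      pair (fun p : BProd G H => B (translate ω p.fst E.1) (translate ω' p.snd E.2)) K :=
    fun E K => toDual_mk (wBounded_translate B E.1 E.2).memLinf K
  have hZb : ∀ᶠ E in (U : Filter (L1 ω × L1 ω')), ‖Z E‖ ≤ ‖B‖ * 2 * 2 := by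
    refine hU ((hFb.prod_mk hFb').mono fun E hE => ?_)
    refine ContinuousLinearMap.opNorm_le_bound _ (by positivity) fun K => ?_
    rw [hZ]
    refine norm_pair_le (fun p => ?_) K
    refine (norm_apply_translate_le B E.1 E.2 p).trans
      (mul_le_mul_of_nonneg_right ?_ ((ω.prod ω').pos p).le)
    gcongr
    · exact hE.1
    · exact hE.2
  -- Banach–Alaoglu: along the ultrafilter the functionals given by the averaged kernels converge
  -- weak*, being uniformly bounded.
  obtain ⟨z, -, hz⟩ := (WeakDual.isCompact_closedBall (𝕜 := ℂ)
    (0 : StrongDual ℂ (L1 (ω.prod ω'))) (‖B‖ * 2 * 2)).ultrafilter_le_nhds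
    (U.map fun E => StrongDual.toWeakDual (Z E)) (le_principal_iff.2 (by
      refine hZb.mono fun E hE => ?_
      exact mem_closedBall_zero_iff.2 hE))
  obtain ⟨P, hPm, hPb, hP⟩ := exists_wBounded_density (WeakDual.toStrongDual z)
  have hc : (productConst G H : ℂ) ≠ 0 := by exact_mod_cast (productConst_pos G H).ne'
  have hPw : WBounded (ω.prod ω') P := ⟨hPm, _, hPb⟩
  -- The limit represents B multiplied by `productConst`, so this factor is divided out.
  refine ⟨fun p => (productConst G H : ℂ)⁻¹ * P p, hPw.const_mul _, fun f g => ?_⟩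
  have h1 : Tendsto (fun E => Z E (tensor f g)) U (𝓝 (pair P (tensor f g))) := by
    rw [← hP]
    exact ((WeakDual.eval_continuous (tensor f g)).tendsto z).comp hz
  have h2 : Tendsto (fun E => Z E (tensor f g)) U (𝓝 (productConst G H * B f g)) := by
    simp only [hZ, pair_translate_tensor]
    have h3 : Tendsto (fun E : L1 ω × L1 ω' => f * E.1) U (𝓝 f) :=
      (hFt f).comp (tendsto_fst.mono_left hU)
    have h4 : Tendsto (fun E : L1 ω × L1 ω' => g * E.2) U (𝓝 g) :=
      (hFt' g).comp (tendsto_snd.mono_left hU)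
    exact ((isBoundedBilinearMap_apply.continuous.tendsto (B f, g)).comp
      (((B.continuous.tendsto f).comp h3).prodMk_nhds h4)).const_mul _
  rw [const_mul_pair, tendsto_nhds_unique h1 h2, inv_mul_cancel_left₀ hc]

end Bilinear

/-! ### Quasi-additivity and kernels as identities of bilinear forms -/

section QuasiAdditive

variable {G : Type*} [Group G] [TopologicalSpace G] [IsTopologicalGroup G]
  [LocallyCompactSpace G] [T2Space G] [MeasurableSpace G] [BorelSpace G] {ω : Weight G}
  {p : BProd G G → ℂ}

/-- Submultiplicativity of ω keeps each of the three terms of the quasi-additivity identity bounded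
by the product weight on the triple product. -/
theorem WBounded.comp_mul_fst (hp : WBounded (ω.prod ω) p) : WBounded (ω.prod (ω.prod ω))
    fun t : BProd G (BProd G G) => p (BProd.mk (t.fst * t.snd.fst) t.snd.snd) := by
  obtain ⟨C, hC0, hC⟩ := hp.exists_nonneg
  refine ⟨hp.measurable.comp (BProd.continuous_mk (BProd.continuous_fst.mul
    (BProd.continuous_fst.comp BProd.continuous_snd))
    (BProd.continuous_snd.comp BProd.continuous_snd)).measurable, C, fun t => (hC _).trans ?_⟩
  refine mul_le_mul_of_nonneg_left ?_ hC0
  change ω (t.fst * t.snd.fst) * ω t.snd.snd ≤ ω t.fst * (ω t.snd.fst * ω t.snd.snd)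
  rw [← mul_assoc]
  exact mul_le_mul_of_nonneg_right (ω.mul_le' _ _) (ω.pos _).le

theorem WBounded.comp_mul_snd (hp : WBounded (ω.prod ω) p) : WBounded (ω.prod (ω.prod ω))
    fun t : BProd G (BProd G G) => p (BProd.mk t.fst (t.snd.fst * t.snd.snd)) := by
  obtain ⟨C, hC0, hC⟩ := hp.exists_nonneg
  refine ⟨hp.measurable.comp (BProd.continuous_mk BProd.continuous_fst
    ((BProd.continuous_fst.comp BProd.continuous_snd).mul
    (BProd.continuous_snd.comp BProd.continuous_snd))).measurable, C, fun t => (hC _).trans ?_⟩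
  refine mul_le_mul_of_nonneg_left ?_ hC0
  exact mul_le_mul_of_nonneg_left (ω.mul_le' _ _) (ω.pos _).le

theorem WBounded.comp_mul_rotate (hp : WBounded (ω.prod ω) p) : WBounded (ω.prod (ω.prod ω))
    fun t : BProd G (BProd G G) => p (BProd.mk t.snd.fst (t.snd.snd * t.fst)) := by
  obtain ⟨C, hC0, hC⟩ := hp.exists_nonneg
  refine ⟨hp.measurable.comp (BProd.continuous_mk
    (BProd.continuous_fst.comp BProd.continuous_snd)
    ((BProd.continuous_snd.comp BProd.continuous_snd).mul BProd.continuous_fst)).measurable, C,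
    fun t => (hC _).trans ?_⟩
  refine mul_le_mul_of_nonneg_left ?_ hC0
  change ω t.snd.fst * ω (t.snd.snd * t.fst) ≤ ω t.fst * (ω t.snd.fst * ω t.snd.snd)
  calc _ ≤ ω t.snd.fst * (ω t.snd.snd * ω t.fst) :=
        mul_le_mul_of_nonneg_left (ω.mul_le' _ _) (ω.pos _).le
    _ = _ := by ring

theorem pair_comp_mul_fst (hp : WBounded (ω.prod ω) p) (f k g : L1 ω) :
    pair (fun t : BProd G (BProd G G) => p (BProd.mk (t.fst * t.snd.fst) t.snd.snd))
      (tensor f (tensor k g)) = productConst G (BProd G G) * pair p (tensor (f * k) g) := by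
  have hx := fun x => pair_tensor (hp.comp_mul_fst.section x) k g
  simp only [BProd.fst_mk, BProd.snd_mk] at hx
  rw [pair_tensor hp.comp_mul_fst, pair_tensor hp, pair_mul (hp.pair_section g)]
  simp only [BProd.fst_mk, BProd.snd_mk, hx, const_mul_pair]

theorem pair_comp_mul_snd (hp : WBounded (ω.prod ω) p) (f k g : L1 ω) :
    pair (fun t : BProd G (BProd G G) => p (BProd.mk t.fst (t.snd.fst * t.snd.snd)))
      (tensor f (tensor k g)) = productConst G (BProd G G) * pair p (tensor f (k * g)) := by
  have hx := fun x => pair_tensor (hp.comp_mul_snd.section x) k g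
  simp only [BProd.fst_mk, BProd.snd_mk] at hx
  have hm := fun x => pair_mul (hp.section x) k g
  rw [pair_tensor hp.comp_mul_snd, pair_tensor hp]
  simp only [BProd.fst_mk, BProd.snd_mk, hx, const_mul_pair, hm]

/-- Here the first variable is integrated innermost, hence the other order of Fubini; the product zx
then produces g * f. -/
theorem pair_comp_mul_rotate (hp : WBounded (ω.prod ω) p) (f k g : L1 ω) :
    pair (fun t : BProd G (BProd G G) => p (BProd.mk t.snd.fst (t.snd.snd * t.fst)))
      (tensor f (tensor k g)) = productConst G (BProd G G) * pair p (tensor k (g * f)) := by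
  have hm := fun x => pair_mul (hp.section x) g f
  rw [pair_tensor' hp.comp_mul_rotate, pair_tensor (hp.comp_mul_rotate.pair_section_left f),
    pair_tensor hp]
  simp only [BProd.fst_mk, BProd.snd_mk, hm]

/-- A bounded function on a triple product that annihilates all elementary tensors vanishes locally
almost everywhere. -/
theorem eventually_eq_zero_of_tensor_tensor {Q : BProd G (BProd G G) → ℂ}
    (hQ : WBounded (ω.prod (ω.prod ω)) Q) (h : ∀ f k g : L1 ω, pair Q (tensor f (tensor k g)) = 0) :
    ∀ᶠ t in locallyAE (BProd G (BProd G G)), Q t = 0 := by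
  have hc : (productConst G (BProd G G) : ℂ) ≠ 0 := by
    exact_mod_cast (productConst_pos G (BProd G G)).ne'
  refine eventually_eq_zero_of_tensor hQ fun f F => ?_
  -- For fixed f, integrating out the first variable leaves a function annihilating all k ⊗ g, hence
  -- locally null. So Q annihilates f ⊗ F for every F, not only for tensors.
  have h1 := eventually_eq_zero_of_tensor (hQ.pair_section_left f) fun k g => by
    have h2 := h f k g
    rw [pair_tensor' hQ] at h2
    exact (mul_eq_zero.1 h2).resolve_left hc
  rw [pair_tensor' hQ, pair_congr (k := fun _ => 0) h1]
  simp [pair]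

/-- Quasi-additivity in terms of the associated bilinear form. -/
theorem quasiAdditive_iff (hp : WBounded (ω.prod ω) p) : QuasiAdditive (G := G) p ↔
    ∀ f k g : L1 ω, pair p (tensor (f * k) g) =
      pair p (tensor f (k * g)) + pair p (tensor k (g * f)) := by
  have hc : (productConst G (BProd G G) : ℂ) ≠ 0 := by
    exact_mod_cast (productConst_pos G (BProd G G)).ne'
  -- The defect of quasi-additivity is bounded by the product weight, so it vanishes locally almost
  -- everywhere exactly when it annihilates elementary tensors.
  have hb := (hp.comp_mul_fst.sub hp.comp_mul_snd).sub hp.comp_mul_rotate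
  have hpair : ∀ f k g : L1 ω, pair (fun t : BProd G (BProd G G) =>
      p (BProd.mk (t.fst * t.snd.fst) t.snd.snd) - p (BProd.mk t.fst (t.snd.fst * t.snd.snd)) -
        p (BProd.mk t.snd.fst (t.snd.snd * t.fst))) (tensor f (tensor k g)) =
      productConst G (BProd G G) * (pair p (tensor (f * k) g) - pair p (tensor f (k * g)) -
        pair p (tensor k (g * f))) := fun f k g => by
    rw [sub_pair (hp.comp_mul_fst.sub hp.comp_mul_snd) hp.comp_mul_rotate,
      sub_pair hp.comp_mul_fst hp.comp_mul_snd, pair_comp_mul_fst hp, pair_comp_mul_snd hp,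
      pair_comp_mul_rotate hp]
    ring
  constructor
  · rintro ⟨-, h⟩ f k g
    have h0 : (fun t : BProd G (BProd G G) =>
        p (BProd.mk (t.fst * t.snd.fst) t.snd.snd) - p (BProd.mk t.fst (t.snd.fst * t.snd.snd)) -
        p (BProd.mk t.snd.fst (t.snd.snd * t.fst))) =ᶠ[locallyAE (BProd G (BProd G G))]
        fun _ => 0 := by
      refine Eventually.mono h fun t ht => ?_
      have ht' : p (BProd.mk (t.fst * t.snd.fst) t.snd.snd) =
        p (BProd.mk t.fst (t.snd.fst * t.snd.snd)) +
        p (BProd.mk t.snd.fst (t.snd.snd * t.fst)) := ht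
      simp only [ht']
      ring
    have h1 := hpair f k g
    rw [pair_congr h0] at h1
    have h2 : pair (fun _ : BProd G (BProd G G) => (0 : ℂ)) (tensor f (tensor k g)) = 0 := by
      simp [pair]
    rw [h2] at h1
    linear_combination (mul_eq_zero.1 h1.symm).resolve_left hc
  · intro h
    refine ⟨borelFun_iff (G := BProd G G) |>.2 hp.measurable, ?_⟩
    have h1 := eventually_eq_zero_of_tensor_tensor hb fun f k g => by
      rw [hpair, h]
      ring
    refine Eventually.mono h1 fun t ht => ?_
    exact sub_eq_iff_eq_add'.1 (sub_eq_zero.1 ht)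

/-- The kernel identity in terms of the associated bilinear form. -/
theorem hasKernel_iff (hp : WBounded (ω.prod ω) p) {h : G → ℂ} (hh : WBounded ω h) :
    HasKernel (G := G) p h ↔ ∀ f g : L1 ω, pair p (tensor f g) =
      productConst G G * (pair h (f * g) - pair h (g * f)) := by
  have hk := hh.comp_mul.sub hh.comp_mul_swap
  have hpair : ∀ f g : L1 ω, pair (fun t : BProd G G => h (t.fst * t.snd) - h (t.snd * t.fst))
      (tensor f g) = productConst G G * (pair h (f * g) - pair h (g * f)) := fun f g => by
    rw [sub_pair hh.comp_mul hh.comp_mul_swap, pair_tensor hh.comp_mul,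
      pair_tensor hh.comp_mul_swap, pair_mul hh, pair_mul' hh]
    simp only [BProd.fst_mk, BProd.snd_mk]
    ring
  constructor
  · intro H f g
    have H' : p =ᶠ[locallyAE (BProd G G)]
        fun t => h (t.fst * t.snd) - h (t.snd * t.fst) := H
    rw [← hpair, pair_congr H']
  · intro H
    have h1 := eventually_eq_zero_of_tensor (hp.sub hk) fun f g => by
      rw [sub_pair hp hk, H, hpair, sub_self]
    exact Eventually.mono h1 fun t ht => sub_eq_zero.1 ht

/-- The set where h and k differ is Borel and locally null, and so are its preimages under both
products. -/
theorem HasKernel.congr (ω : Weight G) {p : G × G → ℂ} {h k : G → ℂ} (hh : Measurable h)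
    (hk : Measurable k) (e : h =ᶠ[locallyAE G] k) (H : HasKernel p h) : HasKernel p k := by
  have hN := eventually_locallyAE_mul ω (measurableSet_eq_fun hh hk).compl
    (e.mono fun x hx hx' => hx' hx)
  refine (Eventually.and H hN).mono fun t ht => ?_
  have h1 : h (t.1 * t.2) = k (t.1 * t.2) := not_not.1 ht.2.1
  have h2 : h (t.2 * t.1) = k (t.2 * t.1) := not_not.1 ht.2.2
  rw [ht.1, h1, h2]

/-- The kernel form of inner derivations does not depend on the representative. -/
theorem integral_integral_kernel_congr {h k : G → ℂ} (e : h =ᶠ[locallyAE G] k) (f g : L1 ω) :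
    ∫ y, ∫ x, f x * g y * (h (x * y) - h (y * x)) ∂(Measure.haar : Measure G)
      ∂(Measure.haar : Measure G) =
    ∫ y, ∫ x, f x * g y * (k (x * y) - k (y * x)) ∂(Measure.haar : Measure G)
      ∂(Measure.haar : Measure G) := by
  congr 1
  funext y
  refine integral_congr_ae ?_
  filter_upwards [f.ae_of_locallyAE ((tendsto_mul_right_locallyAE y).eventually e),
    f.ae_of_locallyAE ((tendsto_mul_left_locallyAE y).eventually e)] with x h1 h2
  rcases eq_or_ne (f x) 0 with h0 | h0
  · simp [h0]
  · rw [h1 h0, h2 h0]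

theorem wBounded_of_supConst_lt_top {p : G × G → ℂ} (hp : BorelFun p) (h : supConst ω p < ∞) :
    WBounded (G := BProd G G) (ω.prod ω) p := by
  refine ⟨borelFun_iff (G := BProd G G) |>.1 hp, (supConst ω p).toReal, fun t => ?_⟩
  have h1 : ENNReal.ofReal (‖p (t.1, t.2)‖ / (ω t.1 * ω t.2)) ≤ supConst ω p :=
    le_iSup₂ (f := fun x y => ENNReal.ofReal (‖p (x, y)‖ / (ω x * ω y))) t.1 t.2
  have h2 := (ENNReal.ofReal_le_iff_le_toReal h.ne).1 h1
  exact (div_le_iff₀ (mul_pos (ω.pos _) (ω.pos _))).1 h2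

theorem WBounded.supConst_lt_top (hp : WBounded (ω.prod ω) p) : supConst (G := G) ω p < ∞ := by
  obtain ⟨C, hC⟩ := hp.bound
  refine lt_of_le_of_lt (iSup₂_le fun x y => ?_) (ENNReal.ofReal_lt_top (r := C))
  refine ENNReal.ofReal_le_ofReal ((div_le_iff₀ (mul_pos (ω.pos _) (ω.pos _))).2 ?_)
  exact hC (BProd.mk x y)

end QuasiAdditive

/-! ### Derivations and quasi-additive functions -/

section Dual

variable {G : Type*} [Group G] [TopologicalSpace G] [IsTopologicalGroup G]
  [LocallyCompactSpace G] [T2Space G] [MeasurableSpace G] [BorelSpace G] {ω : Weight G}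

/-- The norm of a functional bounds its density locally almost everywhere. This gives injectivity of
`toDual` and continuity of its inverse. -/
theorem Linf.norm_le_norm_toDual (h : Linf ω) : ‖h‖ ≤ ‖toDual ω h‖ := by
  obtain ⟨k, hk, e⟩ := h.memLinf.exists_wBounded
  refine h.norm_le (norm_nonneg _) ?_
  have h1 := hk.eventually_norm_le (norm_nonneg (toDual ω h)) fun f => by
    rw [← toDual_eq_pair e]
    exact (toDual ω h).le_opNorm f
  filter_upwards [e, h1] with x hx h1
  rwa [hx]

variable (ω) in
theorem toDual_bijective : Function.Bijective (toDual ω) := by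
  constructor
  · refine (injective_iff_map_eq_zero _).2 fun h h0 => ?_
    have h1 := h.norm_le_norm_toDual
    rw [h0, norm_zero] at h1
    exact norm_le_zero_iff.1 h1
  · intro z
    obtain ⟨h, hm, hb, hz⟩ := exists_wBounded_density z
    have hh : WBounded ω h := ⟨hm, _, hb⟩
    exact ⟨Linf.mk ω h hh.memLinf, ContinuousLinearMap.ext fun f => by rw [toDual_mk, hz]⟩

variable (ω) in
/-- The identification of `L^∞(G, 1/ω)` with the dual of `L^1(G, ω)`. -/
noncomputable def dualEquiv : Linf ω ≃L[ℂ] StrongDual ℂ (L1 ω) :=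
  LinearEquiv.toContinuousLinearEquivOfBounds
    (LinearEquiv.ofBijective (toDual ω).toLinearMap (toDual_bijective ω))
    ‖toDual ω‖ 1 (fun h => (toDual ω).le_opNorm h) fun z => by
      obtain ⟨h, rfl⟩ := (toDual_bijective ω).2 z
      rw [one_mul]
      refine le_trans (le_of_eq (congrArg _ ?_)) h.norm_le_norm_toDual
      exact (LinearEquiv.ofBijective (toDual ω).toLinearMap (toDual_bijective ω)).symm_apply_apply h

theorem toDual_dualEquiv_symm (z : StrongDual ℂ (L1 ω)) : toDual ω ((dualEquiv ω).symm z) = z :=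
  (dualEquiv ω).apply_symm_apply z

theorem isDerivation_iff {B : L1 ω →L[ℂ] StrongDual ℂ (L1 ω)} : IsDerivation B ↔
    ∀ f k g : L1 ω, B (f * k) g = B f (k * g) + B k (g * f) :=
  forall₂_congr fun _ _ => ContinuousLinearMap.ext_iff

theorem isInnerDerivation_iff {B : L1 ω →L[ℂ] StrongDual ℂ (L1 ω)} : IsInnerDerivation B ↔
    ∃ h, WBounded ω h ∧ ∀ f g : L1 ω, B f g = pair h (f * g) - pair h (g * f) := by
  constructor
  · rintro ⟨z, hz⟩
    obtain ⟨h, hm, hb, hzh⟩ := exists_wBounded_density z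
    refine ⟨h, ⟨hm, _, hb⟩, fun f g => ?_⟩
    rw [hz, ← hzh, ← hzh]
    rfl
  · rintro ⟨h, hh, hB⟩
    refine ⟨toDual ω (Linf.mk ω h hh.memLinf), fun f => ContinuousLinearMap.ext fun g => ?_⟩
    rw [hB, ← toDual_mk hh.memLinf, ← toDual_mk hh.memLinf]
    rfl

/-- The bounded bilinear form given by a bounded function on the product. -/
theorem exists_bilinear_of_wBounded {p : BProd G G → ℂ} (hp : WBounded (ω.prod ω) p) :
    ∃ B : L1 ω →L[ℂ] StrongDual ℂ (L1 ω), ∀ f g, pair p (tensor f g) = B f g := by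
  obtain ⟨C, hC⟩ := hp.bound
  refine ⟨LinearMap.mkContinuous₂ (LinearMap.mk₂ ℂ (fun f g => pair p (tensor f g)) ?_ ?_ ?_ ?_)
    (productConst G G * C) ?_, fun f g => rfl⟩
  · intro f f' g
    simp only [pair_tensor hp, pair_add (hp.pair_section g), mul_add]
  · intro c f g
    simp only [pair_tensor hp, pair_smul (hp.pair_section g), smul_eq_mul, mul_left_comm]
  · intro f g g'
    simp only [pair_tensor' hp, pair_add (hp.pair_section_left f), mul_add]
  · intro c f g
    simp only [pair_tensor' hp, pair_smul (hp.pair_section_left f), smul_eq_mul, mul_left_comm]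
  · intro f g
    simp only [LinearMap.mk₂_apply, pair_tensor hp, norm_mul, mul_assoc]
    have e : ‖(productConst G G : ℂ)‖ = productConst G G := by simp
    rw [e]
    refine mul_le_mul_of_nonneg_left ?_ NNReal.zero_le_coe
    refine (norm_pair_le (C := C * ‖g‖) (fun x => ?_) f).trans (le_of_eq (by ring))
    refine (norm_pair_le (C := C * ω x) (fun y => ?_) g).trans (le_of_eq (by ring))
    exact (hC _).trans (le_of_eq (by rw [Weight.prod_mk, mul_assoc]))

theorem MemLinf.exists_wBounded_hasKernel {p : G × G → ℂ} {h : G → ℂ} (hh : MemLinf ω h)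
    (H : HasKernel p h) : ∃ k, WBounded ω k ∧ HasKernel p k := by
  obtain ⟨k, hk, e⟩ := hh.exists_wBounded
  exact ⟨k, hk, H.congr ω (borelFun_iff.1 hh.1) hk.measurable e⟩

theorem isDerivation_iff_quasiAdditive {p : BProd G G → ℂ} (hp : WBounded (ω.prod ω) p)
    {B : L1 ω →L[ℂ] StrongDual ℂ (L1 ω)} (hB : ∀ f g, pair p (tensor f g) = B f g) :
    IsDerivation B ↔ QuasiAdditive (G := G) p := by
  simp only [isDerivation_iff, quasiAdditive_iff hp, hB]

/-- The function implementing the derivation and the one giving the kernel differ by the factor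
`productConst`, because p is integrated against Haar measure of the product while convolutions use
that of G. -/
theorem isInnerDerivation_iff_hasKernel {p : BProd G G → ℂ} (hp : WBounded (ω.prod ω) p)
    {B : L1 ω →L[ℂ] StrongDual ℂ (L1 ω)} (hB : ∀ f g, pair p (tensor f g) = B f g) :
    IsInnerDerivation B ↔ ∃ h : G → ℂ, MemLinf ω h ∧ HasKernel (G := G) p h := by
  have hc : (productConst G G : ℂ) ≠ 0 := by exact_mod_cast (productConst_pos G G).ne'
  rw [isInnerDerivation_iff]
  constructor
  · rintro ⟨h, hh, hBh⟩
    refine ⟨_, (hh.const_mul (productConst G G : ℂ)⁻¹).memLinf,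
      (hasKernel_iff hp (hh.const_mul _)).2 fun f g => ?_⟩
    rw [hB, hBh, const_mul_pair, const_mul_pair, ← mul_sub, mul_inv_cancel_left₀ hc]
  · rintro ⟨h, hh, H⟩
    obtain ⟨k, hk, Hk⟩ := hh.exists_wBounded_hasKernel H
    refine ⟨_, hk.const_mul (productConst G G : ℂ), fun f g => ?_⟩
    rw [← hB, (hasKernel_iff hp hk).1 Hk, const_mul_pair, const_mul_pair, mul_sub]

/-- The dictionary in both directions: a bounded p yields a form, and a derivation is represented by
some bounded p; either way derivations match quasi-additive functions and inner ones match kernels.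
-/
theorem weaklyAmenable_iff_forall_hasKernel : WeaklyAmenable (L1 ω) ↔
    ∀ p ∈ boundedQA ω, ∃ h : G → ℂ, MemLinf ω h ∧ HasKernel p h := by
  constructor
  · rintro ha p ⟨hp, hpb⟩
    have hw := wBounded_of_supConst_lt_top hp.1 hpb
    obtain ⟨B, hB⟩ := exists_bilinear_of_wBounded hw
    exact (isInnerDerivation_iff_hasKernel hw hB).1
      (ha B ((isDerivation_iff_quasiAdditive hw hB).2 hp))
  · intro hc B hBd
    obtain ⟨p, hw, hB⟩ := exists_wBounded_bilinear B
    exact (isInnerDerivation_iff_hasKernel hw hB).2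
      (hc p ⟨(isDerivation_iff_quasiAdditive hw hB).1 hBd, hw.supConst_lt_top⟩)

/-- For an everywhere bounded h the iterated integral equals ⟨h, f*g⟩ - ⟨h, g*f⟩, and it depends
only on the class of h. -/
theorem isInnerDerivation_iff_integral {D : L1 ω →L[ℂ] Linf ω} :
    IsInnerDerivation ((toDual ω).comp D) ↔ ∃ h : G → ℂ, MemLinf ω h ∧ ∀ f g : L1 ω,
      toDual ω (D f) g = ∫ y, ∫ x, f x * g y * (h (x * y) - h (y * x))
        ∂(Measure.haar : Measure G) ∂(Measure.haar : Measure G) := by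
  rw [isInnerDerivation_iff]
  constructor
  · rintro ⟨h, hh, hD⟩
    exact ⟨h, hh.memLinf, fun f g => (hD f g).trans (integral_integral_kernel hh f g).symm⟩
  · rintro ⟨h, hh, hD⟩
    obtain ⟨k, hk, e⟩ := hh.exists_wBounded
    refine ⟨k, hk, fun f g => (hD f g).trans ?_⟩
    rw [integral_integral_kernel_congr e, integral_integral_kernel hk]

/-- Every operator into the dual factors through `toDual`, by composing with the inverse of the
duality isomorphism. -/
theorem weaklyAmenable_iff_forall_linf : WeaklyAmenable (L1 ω) ↔
    ∀ D : L1 ω →L[ℂ] Linf ω, IsDerivation ((toDual ω).comp D) →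
      IsInnerDerivation ((toDual ω).comp D) := by
  refine ⟨fun ha D hD => ha _ hD, fun hb B hB => ?_⟩
  have e : (toDual ω).comp ((dualEquiv ω).symm.toContinuousLinearMap.comp B) = B :=
    ContinuousLinearMap.ext fun f => toDual_dualEquiv_symm (B f)
  have := hb ((dualEquiv ω).symm.toContinuousLinearMap.comp B)
  rw [e] at this
  exact this hB

/-- Every inner quasi-additive function agrees locally almost everywhere with a bounded one. -/
theorem classes_innerQA_subset : classes (innerQA ω) ⊆ classes (boundedQA ω) := by
  rintro _ ⟨p, ⟨-, h, hh, H⟩, rfl⟩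
  obtain ⟨k, hk, Hk⟩ := hh.exists_wBounded_hasKernel H
  -- The kernel of the bounded representative k is the required member of the class: it is bounded
  -- everywhere and, by associativity, quasi-additive at every point.
  have hw := hk.comp_mul.sub hk.comp_mul_swap
  refine ⟨_, ⟨⟨borelFun_iff (G := BProd G G) |>.2 hw.measurable,
    Eventually.of_forall fun t => ?_⟩, hw.supConst_lt_top⟩, Germ.coe_eq.2 (EventuallyEq.symm Hk)⟩
  change k (t.1 * t.2.1 * t.2.2) - k (t.2.2 * (t.1 * t.2.1)) =
    k (t.1 * (t.2.1 * t.2.2)) - k (t.2.1 * t.2.2 * t.1) +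
      (k (t.2.1 * (t.2.2 * t.1)) - k (t.2.2 * t.1 * t.2.1))
  simp only [mul_assoc]
  ring

/-- Being given by a kernel is invariant under changes on locally null sets, so it can be
transferred within a class. -/
theorem classes_subset_iff : classes (boundedQA ω) ⊆ classes (innerQA ω) ↔
    ∀ p ∈ boundedQA ω, ∃ h : G → ℂ, MemLinf ω h ∧ HasKernel p h := by
  constructor
  · intro hs p hp
    obtain ⟨q, ⟨-, h, hh, H⟩, e⟩ := hs ⟨p, hp, rfl⟩
    exact ⟨h, hh, (Germ.coe_eq.1 e.symm).trans H⟩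
  · rintro hc _ ⟨p, hp, rfl⟩
    exact ⟨p, ⟨hp.1, hc p hp⟩, rfl⟩

end Dual

end Beurling

theorem theorem2p4 (G : Type*) [Group G] [TopologicalSpace G] [IsTopologicalGroup G]
    [LocallyCompactSpace G] [T2Space G] [Infinite G] [MeasurableSpace G] [BorelSpace G]
    (ω : Beurling.Weight G) :
    List.TFAE [
      -- (a) weak amenability
      Beurling.WeaklyAmenable (Beurling.L1 ω),
      -- (b) every bounded derivation into the bimodule `L^∞(G, 1/ω)` is given by a kernel
      ∀ D : Beurling.L1 ω →L[ℂ] Beurling.Linf ω,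
        Beurling.IsDerivation ((Beurling.toDual ω).comp D) →
          ∃ h : G → ℂ, Beurling.MemLinf ω h ∧ ∀ f g : Beurling.L1 ω,
            Beurling.toDual ω (D f) g =
              ∫ y, ∫ x, f x * g y * (h (x * y) - h (y * x)) ∂(Measure.haar : Measure G)
                ∂(Measure.haar : Measure G),
      -- (c)
      ∀ p ∈ Beurling.boundedQA ω, ∃ h : G → ℂ, Beurling.MemLinf ω h ∧ Beurling.HasKernel p h,
      -- (d)
      ∀ p : G × G → ℂ, Beurling.QuasiAdditive p → Beurling.supConst ω p < ∞ →
        p ∈ Beurling.innerQA ω,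
      -- (e)
      ∀ p : G × G → ℂ, Beurling.QuasiAdditive p → p ∉ Beurling.innerQA ω →
        Beurling.supConst ω p = ∞,
      -- (f)
      Beurling.classes (Beurling.boundedQA ω) = Beurling.classes (Beurling.innerQA ω)] := by
  tfae_have 1 ↔ 2 := by
    simp only [Beurling.weaklyAmenable_iff_forall_linf, Beurling.isInnerDerivation_iff_integral]
  tfae_have 1 ↔ 3 := Beurling.weaklyAmenable_iff_forall_hasKernel
  tfae_have 3 ↔ 4 :=
    ⟨fun hc p hp hb => ⟨hp, hc p ⟨hp, hb⟩⟩, fun hd p hp => (hd p hp.1 hp.2).2⟩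
  tfae_have 4 ↔ 5 := by
    refine forall₂_congr fun p _ => ?_
    rw [← not_imp_not, lt_top_iff_ne_top, not_not]
  tfae_have 3 ↔ 6 := by
    rw [← Beurling.classes_subset_iff]
    exact ⟨fun h => h.antisymm Beurling.classes_innerQA_subset, fun h => h.subset⟩
  tfae_finish
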